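/- Let $D=(V,A)$ be a directed graph with $n=|V|\ge 1$ nodes and without loops and anti-parallel arcs, with integer capacities $0\le l_{ij}$ and $u_{ij}$ and real costs $c_{ij}$ for the arcs $(i,j)\in A$, and integer balances $b_i$ for the nodes $i\in V$. A feasible integer flow is a function $f\colon A\to\mathbb Z$ with $l_{ij}\le f_{ij}\le u_{ij}$ for all $(i,j)\in A$ and $\sum_{j:(i,j)\in A}f_{ij}-\sum_{j:(j,i)\in A}f_{ji}=b_i$ for all $i\in V$. Its cost is $c(f)=\sum_{(i,j)\in A}c_{ij}f_{ij}$, and $f$ is optimal if no feasible integer flow is cheaper. For a feasible integer flow $f$, the residual graph $D_f$ consists of the arcs $(i,j)$ with $(i,j)\in A$ and $f_{ij}<u_{ij}$, of cost $c_{ij}(f)=c_{ij}$, and the arcs $(i,j)$ with $(j,i)\in A$ and $f_{ji}>l_{ji}$, of cost $c_{ij}(f)=-c_{ji}$. To augment $f$ along a directed cycle of $D_f$ means to send one unit of flow along it. A cycle is proper if it does not contain both $(i,j)$ and $(j,i)$ for any $i,j$. Algorithm FindSecondBestFlow, given an optimal integer flow $f$, computes node potentials $y$ as shortest path distances in $D_f$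 (Bellman-Ford) and the reduced costs $\bar c_{ij}=c_{ij}+y_i-y_j$, with $\bar c_{ij}(f)=c_{ij}(f)+y_i-y_j$ on $D_f$. It removes all arcs of $A$ with $\bar c_{ij}\ne 0$ and searches the residual graph of the remaining network for a proper cycle by depth-first search; if it finds one, it augments $f$ along it. Otherwise it computes the table of the distances $\bar d_{ji}$ in $D_f$ with respect to $\bar c(f)$, with shortest paths $P_{ji}$ (Floyd-Warshall), and augments $f$ along a cycle $\{(i,j)\}\cup P_{ji}$ that minimizes $\bar c_{ij}(f)+\bar d_{ji}$ over the residual arcs $(i,j)$ without anti-parallel residual arc, i.e. with $(i,j)\in A$, $f_{ij}=l_{ij}$ or $(j,i)\in A$, $f_{ji}=u_{ji}$. If there is no such cycle, it reports that there is no second-best flow. Algorithm FindKBestFlows, given an optimal integer flow $f$ and $K\ge 1$, outputs $f$ and keeps a priority queue of triples $(f^1,f^2,D')$, where $D'$ is $D$ with modified capacities, $f^1$ is an optimal flow of $D'$, and $f^2$ is the second-best flow of $D'$ found by FindSecondBestFlow; the key is $c(f^2)$. Until $K$ flows are output or the queue is empty, it extracts a triple of minimal key, outputs $f^2$, splits $D'$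 at an arc $a$ with $f^1_a\neq f^2_a$ into two networks, containing $f^1$ and $f^2$ respectively (capacity constraints $z_a\le f^1_a$ and $z_a\ge f^1_a+1$ if $f^1_a<f^2_a$, and $z_a\ge f^1_a$ and $z_a\le f^1_a-1$ otherwise), and inserts the triples of the two parts, where a second-best flow exists. The priority queue is a tournament tree of first-in-first-out buckets: the bucket of a triple $(f^1,f^2,D')$ is determined by the signs of the entries of $f^1-f^2$ and of $f^1-g$, where $g$ is the second-best flow found for $f^1$ immediately before, and $g=f^1$ if there is none. Theorem. There is an absolute constant $C$ such that, for every such network and every optimal integer flow $f$ of it, the following holds on a unit-cost random access machine with integers and reals. (a) FindSecondBestFlow takes at most $Cn^3$ steps. If it returns $f'$, then $f'$ is a second-best flow, that is, a feasible integer flow $f'\ne f$ with $c(f')\le c(g)$ for all feasible integer flows $g\ne f$; if it reports that there is none, then $f$ is the only feasible integer flow. (b) For every $K\ge 1$, FindKBestFlows takes at most $CKn^3$ steps and finds $K$ best integer flows: it outputs pairwise different feasible integer flows $f_1,f_2,\dots$ with $c(f_1)\le c(f_2)\le\cdots$ such that every feasible integer flow that is not output costs at least as much as each flow that is output. The number of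 flows that are output is $K$, or the number of all feasible integer flows if that is smaller than $K$. -/

import Mathlib

namespace KBestFlow

/-! ### Networks, integer flows, and what the algorithms are supposed to find -/

/-- A network on the nodes `0, …, n - 1`, stored as adjacency matrices: the arcs, their lower and
upper capacities and costs, and the flow balances of the nodes. The entries of `lower`, `upper`
and `cost` at pairs that are not arcs are never used. -/
structure Network (n : ℕ) where
  arc : Fin n → Fin n → Bool
  lower : Fin n → Fin n → ℤ
  upper : Fin n → Fin n → ℤ
  balance : Fin n → ℤ
  cost : Fin n → Fin n → ℝ

/-- No anti-parallel arcs (in particular no loops), and nonnegative lower capacities. -/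
def Network.Valid {n : ℕ} (N : Network n) : Prop :=
  (∀ i j, N.arc i j = true → N.arc j i = false) ∧
  (∀ i j, N.arc i j = true → 0 ≤ N.lower i j)

/-- An integer-valued function on the arcs, extended by zero to all pairs of nodes
(see `Network.IsFeasible`). -/
abbrev Flow (n : ℕ) := Fin n → Fin n → ℤ

/-- Feasible integer flows. -/
def Network.IsFeasible {n : ℕ} (N : Network n) (f : Flow n) : Prop :=
  (∀ i j, N.arc i j = false → f i j = 0) ∧
  (∀ i j, N.arc i j = true → N.lower i j ≤ f i j ∧ f i j ≤ N.upper i j) ∧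
  (∀ i, (∑ j, if N.arc i j then f i j else 0) - (∑ j, if N.arc j i then f j i else 0)
    = N.balance i)

/-- The cost `c(f)` of a flow. -/
noncomputable def Network.totalCost {n : ℕ} (N : Network n) (f : Flow n) : ℝ :=
  ∑ i, ∑ j, if N.arc i j then N.cost i j * (f i j : ℝ) else 0

/-- Optimal integer flows. -/
def Network.IsOptimal {n : ℕ} (N : Network n) (f : Flow n) : Prop :=
  N.IsFeasible f ∧ ∀ g, N.IsFeasible g → N.totalCost f ≤ N.totalCost g

/-- `g` is a second-best integer flow, given the optimal flow `f`. -/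
def Network.IsSecondBest {n : ℕ} (N : Network n) (f g : Flow n) : Prop :=
  N.IsFeasible g ∧ g ≠ f ∧ ∀ h, N.IsFeasible h → h ≠ f → N.totalCost g ≤ N.totalCost h

/-- `L` lists `K` best integer flows: pairwise different feasible integer flows in the order of
nondecreasing cost such that no other feasible integer flow is cheaper than one of them. There are
`K` of them, or all feasible integer flows if there are fewer than `K`. -/
def Network.IsKBest {n : ℕ} (N : Network n) (K : ℕ) (L : List (Flow n)) : Prop :=
  L.length = min K {f : Flow n | N.IsFeasible f}.ncard ∧
  L.Nodup ∧
  (∀ f ∈ L, N.IsFeasible f) ∧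
  L.Pairwise (fun f g => N.totalCost f ≤ N.totalCost g) ∧
  (∀ g, N.IsFeasible g → g ∉ L → ∀ f ∈ L, N.totalCost f ≤ N.totalCost g)

/-! ### Running time

Unit-cost random access machine that holds integers, reals and pointers in its cells. -/

/-- The result of a computation together with the number of steps it took. -/
structure Timed (α : Type) where
  val : α
  time : ℕ

/-- Control flow is free, the steps of consecutive computations add up. -/
instance : Monad Timed where
  pure a := ⟨a, 0⟩
  bind x g := ⟨(g x.val).val, x.time + (g x.val).time⟩

/-- One step: a fixed number of elementary operations, that is, reading cells of arrays or fields
of records, arithmetic operations and comparisons of numbers, overwriting cells, and creating or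
linking a record. -/
def step {α : Type} (a : α) : Timed α := ⟨a, 1⟩

/-- Allocate an array of length `n` and compute its entries one after the other. -/
def fill {n : ℕ} {α : Type} (g : Fin n → Timed α) : Timed (Fin n → α) :=
  ⟨fun i => (g i).val, ∑ i, ((g i).time + 1)⟩

/-- Allocate an `n × n` matrix and compute its entries one after the other. -/
def fill₂ {n : ℕ} {α : Type} (g : Fin n → Fin n → Timed α) : Timed (Fin n → Fin n → α) :=
  fill fun i => fill fun j => g i j

/-- `for a in l do s ← body s a`, with one step of overhead for each pass. -/
def loop {ι σ : Type} (body : σ → ι → Timed σ) : List ι → σ → Timed σ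
  | [], s => pure s
  | a :: l, s => do
    let s ← step s
    let s ← body s a
    loop body l s

/-- Run `body a` for the `a` in `l` until the first time it returns something. -/
def firstSome {ι β : Type} (body : ι → Timed (Option β)) : List ι → Timed (Option β)
  | [] => pure none
  | a :: l => do
    let a ← step a
    match ← body a with
    | some b => pure (some b)
    | none => firstSome body l

/-- All nodes. -/
abbrev nodes (n : ℕ) : List (Fin n) := List.finRange n

/-- All pairs of nodes, row by row. -/
abbrev pairs (n : ℕ) : List (Fin n × Fin n) := (List.finRange n).product (List.finRange n)

/-- Overwrite one entry of a matrix. -/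
def setEntry {n : ℕ} {α : Type} (M : Fin n → Fin n → α) (i j : Fin n) (a : α) :
    Fin n → Fin n → α :=
  Function.update M i (Function.update (M i) j a)

/-- Copy a matrix. -/
def copy {n : ℕ} {α : Type} (M : Fin n → Fin n → α) : Timed (Fin n → Fin n → α) :=
  fill₂ fun i j => step (M i j)

/-! ### Residual graph, node potentials, augmentation -/

/-- BuildResidualNetwork: the adjacency matrix of the residual graph. -/
def residualGraph {n : ℕ} (N : Network n) (f : Flow n) : Timed (Fin n → Fin n → Bool) :=
  fill₂ fun i j => step
    ((N.arc i j && decide (f i j < N.upper i j)) || (N.arc j i && decide (N.lower j i < f j i)))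

/-- The costs (or reduced costs) of the residual arcs, computed from those of the arcs. -/
noncomputable def residualCost {n : ℕ} (N : Network n) (c : Fin n → Fin n → ℝ) :
    Timed (Fin n → Fin n → ℝ) :=
  fill₂ fun i j => step (if N.arc i j then c i j else -c j i)

/-- ComputeNodePotential: the distances in the residual graph from the root node `0`, by the
Bellman-Ford algorithm. So that all nodes are reachable, artificial arcs of the sufficiently high
cost `big` lead from the root to the other nodes. -/
noncomputable def computeNodePotential {n : ℕ} (N : Network n) (f : Flow n) :
    Timed (Fin n → ℝ) := do
  let res ← residualGraph N f
  let cres ← residualCost N N.cost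
  let big ← loop (fun (s : ℝ) (p : Fin n × Fin n) =>
    step (if N.arc p.1 p.2 then s + |N.cost p.1 p.2| else s)) (pairs n) 1
  let y ← fill fun j : Fin n => step (if j.val = 0 then (0 : ℝ) else big)
  loop (fun (y : Fin n → ℝ) (_ : Fin n) =>
    fill fun j => loop (fun (d : ℝ) (i : Fin n) =>
      step (if res i j then min d (y i + cres i j) else d)) (nodes n) (y j)) (nodes n) y

/-- ComputeReducedCost. -/
noncomputable def computeReducedCost {n : ℕ} (N : Network n) (y : Fin n → ℝ) :
    Timed (Fin n → Fin n → ℝ) :=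
  fill₂ fun i j => step (N.cost i j + y i - y j)

/-- `f + χ(C)`, where the cycle `C` of the residual graph is given by the list of its arcs. -/
def augment {n : ℕ} (N : Network n) (f : Flow n) (C : List (Fin n × Fin n)) :
    Timed (Flow n) := do
  let g ← copy f
  loop (fun (g : Flow n) (a : Fin n × Fin n) => step
    (if N.arc a.1 a.2 then setEntry g a.1 a.2 (g a.1 a.2 + 1)
     else setEntry g a.2 a.1 (g a.2 a.1 - 1))) C g

/-! ### Depth-first search -/

/-- A DFS forest: the nodes visited so far, their DFS numbers, their predecessors in the forest,
and the values `SBAlow`; `clock` is the next DFS number. -/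
structure Forest (n : ℕ) where
  visited : Fin n → Bool
  number : Fin n → ℕ
  parent : Fin n → Option (Fin n)
  sbaLow : Fin n → ℕ
  clock : ℕ

/-- Visit the node `i` and, recursively, all unvisited nodes reachable from it. The first argument
bounds the recursion depth. -/
def visit {n : ℕ} (res : Fin n → Fin n → Bool) : ℕ → Fin n → Forest n → Timed (Forest n)
  | 0, _, F => pure F
  | d + 1, i, F => do
    let low ← step
      (match F.parent i with
      | some p => if res i p then F.sbaLow p else F.clock
      | none => F.clock)
    let F ← step
      { F with
        visited := Function.update F.visited i true
        number := Function.update F.number i F.clock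
        sbaLow := Function.update F.sbaLow i low
        clock := F.clock + 1 }
    loop (fun (F : Forest n) (j : Fin n) => do
      if ← step (res i j && !F.visited j) then
        let F ← step { F with parent := Function.update F.parent j (some i) }
        visit res d j F
      else
        pure F) (nodes n) F

/-- BuildDFSForest. -/
def buildDFSForest {n : ℕ} (res : Fin n → Fin n → Bool) : Timed (Forest n) := do
  let visited ← fill fun _ : Fin n => step false
  let number ← fill fun _ : Fin n => step 0
  let parent ← fill fun _ : Fin n => step none
  let sbaLow ← fill fun _ : Fin n => step 0
  loop (fun (F : Forest n) (i : Fin n) => do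
    if ← step (F.visited i) then
      pure F
    else
      visit res n i F) (nodes n) ⟨visited, number, parent, sbaLow, 0⟩

/-- LowestCommonAncestor: climb from the node with the larger DFS number until the two nodes
coincide; `none` if they lie in different trees. The first argument bounds the number of rounds. -/
def lowestCommonAncestor {n : ℕ} (F : Forest n) : ℕ → Fin n → Fin n → Timed (Option (Fin n))
  | 0, _, _ => pure none
  | d + 1, x, y => do
    if ← step (decide (x = y)) then
      pure (some x)
    else if ← step (decide (F.number y < F.number x)) then
      match ← step (F.parent x) with
      | some p => lowestCommonAncestor F d p y
      | none => pure none
    else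
      match ← step (F.parent y) with
      | some p => lowestCommonAncestor F d x p
      | none => pure none

/-- The kinds of arcs relative to a DFS forest. A cross arc carries the lowest common ancestor of
its end nodes, or `none` if they lie in different trees. -/
inductive ArcKind (n : ℕ) where
  | noArc
  | tree
  | forward
  | backward
  | cross (a : Option (Fin n))

/-- Preprocess: determine the kind of each arc. -/
def preprocess {n : ℕ} (res : Fin n → Fin n → Bool) (F : Forest n) :
    Timed (Fin n → Fin n → ArcKind n) :=
  fill₂ fun i j => do
    if ← step (!res i j) then
      pure .noArc
    else if ← step (decide (F.parent j = some i)) then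
      pure .tree
    else if ← step (decide (F.number i < F.number j)) then
      pure .forward
    else
      let a ← lowestCommonAncestor F (2 * n) i j
      step (if a = some j then .backward else .cross a)

/-- Put the arcs of the tree path from the ancestor `top` to `x` in front of a list. The first
argument bounds the number of rounds. -/
def treePath {n : ℕ} (F : Forest n) (top : Fin n) :
    ℕ → Fin n → List (Fin n × Fin n) → Timed (List (Fin n × Fin n))
  | 0, _, acc => pure acc
  | d + 1, x, acc => do
    if ← step (decide (x = top)) then
      pure acc
    else
      match ← step (F.parent x) with
      | some p =>
        let acc ← step ((p, x) :: acc)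
        treePath F top d p acc
      | none => pure acc

/-- Put the arcs of the path of short backward arcs from `x` to its ancestor `top` in front of a
list. The first argument bounds the number of rounds. -/
def shortBackwardPath {n : ℕ} (F : Forest n) (top : Fin n) :
    ℕ → Fin n → List (Fin n × Fin n) → Timed (List (Fin n × Fin n))
  | 0, _, acc => pure acc
  | d + 1, x, acc => do
    if ← step (decide (x = top)) then
      pure acc
    else
      match ← step (F.parent x) with
      | some p =>
        let acc ← step ((x, p) :: acc)
        shortBackwardPath F top d p acc
      | none => pure acc

/-- FindAnotherFeasibleFlow: augment along a proper backward, forward or cross cycle. -/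
def findAnotherFeasibleFlow {n : ℕ} (N : Network n) (f : Flow n) :
    Timed (Option (Flow n)) := do
  let res ← residualGraph N f
  let F ← buildDFSForest res
  let kind ← preprocess res F
  let backwardCycle ← firstSome (fun a : Fin n × Fin n => do
    match ← step (kind a.1 a.2) with
    | .backward =>
      if ← step (decide (F.parent a.1 ≠ some a.2)) then
        let C ← treePath F a.2 n a.1 [a]
        pure (some C)
      else
        pure none
    | _ => pure none) (pairs n)
  match backwardCycle with
  | some C =>
    let g ← augment N f C
    pure (some g)
  | none =>
  let forwardCycle ← firstSome (fun a : Fin n × Fin n => do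
    match ← step (kind a.1 a.2) with
    | .forward =>
      if ← step (decide (F.sbaLow a.2 ≤ F.number a.1)) then
        let C ← shortBackwardPath F a.1 n a.2 [a]
        pure (some C)
      else
        pure none
    | _ => pure none) (pairs n)
  match forwardCycle with
  | some C =>
    let g ← augment N f C
    pure (some g)
  | none =>
  let crossCycle ← firstSome (fun a : Fin n × Fin n => do
    match ← step (kind a.1 a.2) with
    | .cross (some r) =>
      if ← step (decide (F.sbaLow a.2 ≤ F.number r)) then
        let P ← shortBackwardPath F r n a.2 [a]
        let C ← treePath F r n a.1 P
        pure (some C)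
      else
        pure none
    | _ => pure none) (pairs n)
  match crossCycle with
  | some C =>
    let g ← augment N f C
    pure (some g)
  | none => pure none

/-- FindAnotherOptimalFlow: remove the arcs of nonzero reduced cost, adapt the balances, find
another feasible flow of the reduced network, and extend it by `f`. -/
noncomputable def findAnotherOptimalFlow {n : ℕ} (N : Network n) (f : Flow n)
    (cbar : Fin n → Fin n → ℝ) : Timed (Option (Flow n)) := do
  let arcs ← fill₂ fun i j => step (N.arc i j && decide (cbar i j = 0))
  let bal ← fill fun i => loop (fun (s : ℤ) (j : Fin n) => step
    (s - (if N.arc i j && !arcs i j then f i j else 0)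
       + (if N.arc j i && !arcs j i then f j i else 0))) (nodes n) (N.balance i)
  let fred ← fill₂ fun i j => step (if arcs i j then f i j else 0)
  match ← findAnotherFeasibleFlow { N with arc := arcs, balance := bal } fred with
  | none => pure none
  | some g =>
    let h ← fill₂ fun i j => step (if arcs i j then g i j else f i j)
    pure (some h)

/-! ### Second-best flow -/

/-- A path, stored as a tree of pointers to its parts. -/
inductive Route (n : ℕ) where
  | nil
  | arc (i j : Fin n)
  | append (p q : Route n)

/-- Put the arcs of a path in front of a list. -/
def Route.flatten {n : ℕ} : Route n → List (Fin n × Fin n) → Timed (List (Fin n × Fin n))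
  | .nil, acc => step acc
  | .arc i j, acc => step ((i, j) :: acc)
  | .append p q, acc => do
    let acc ← step acc
    let acc ← q.flatten acc
    p.flatten acc

/-- One update of the Floyd-Warshall algorithm: the entries for `(i, k)`, `(k, j)`, `(i, j)` are
given, the new entry for `(i, j)` is returned; `none` is the distance `∞`. -/
noncomputable def relax {n : ℕ} :
    Option (ℝ × Route n) → Option (ℝ × Route n) → Option (ℝ × Route n) → Option (ℝ × Route n)
  | some (x, p), some (y, q), some (z, r) =>
    if x + y < z then some (x + y, .append p q) else some (z, r)
  | some (x, p), some (y, q), none => some (x + y, .append p q)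
  | _, _, e => e

/-- DetermineDistanceTableAndPaths, by the Floyd-Warshall algorithm. -/
noncomputable def distanceTable {n : ℕ} (res : Fin n → Fin n → Bool) (w : Fin n → Fin n → ℝ) :
    Timed (Fin n → Fin n → Option (ℝ × Route n)) := do
  let d ← fill₂ fun i j : Fin n => step
    (if i = j then some ((0 : ℝ), Route.nil) else if res i j then some (w i j, Route.arc i j)
     else none)
  loop (fun (d : Fin n → Fin n → Option (ℝ × Route n)) (k : Fin n) =>
    fill₂ fun i j => step (relax (d i k) (d k j) (d i j))) (nodes n) d

/-- FindSecondBestFlow. -/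
noncomputable def findSecondBestFlow {n : ℕ} (N : Network n) (f : Flow n) :
    Timed (Option (Flow n)) := do
  let y ← computeNodePotential N f
  let cbar ← computeReducedCost N y
  match ← findAnotherOptimalFlow N f cbar with
  | some g => pure (some g)
  | none =>
    let res ← residualGraph N f
    let w ← residualCost N cbar
    let dist ← distanceTable res w
    -- the cheapest candidate so far: its cost, an arc without anti-parallel arc, a path back
    let best ← loop (fun (best : Option (ℝ × (Fin n × Fin n) × Route n)) (a : Fin n × Fin n) =>
      step
        (if res a.1 a.2 ∧ ((N.arc a.1 a.2 ∧ f a.1 a.2 = N.lower a.1 a.2) ∨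
            (N.arc a.2 a.1 ∧ f a.2 a.1 = N.upper a.2 a.1)) then
          match dist a.2 a.1, best with
          | none, _ => best
          | some (x, p), none => some (w a.1 a.2 + x, a, p)
          | some (x, p), some (z, _) => if w a.1 a.2 + x < z then some (w a.1 a.2 + x, a, p) else best
        else best)) (pairs n) none
    match best with
    | none => pure none
    | some (_, a, p) =>
      let C ← p.flatten [a]
      let g ← augment N f C
      pure (some g)

/-! ### The priority queue of candidates

The candidates are kept in buckets. A bucket is a linked list with a pointer to its last cell; new
candidates are appended at the end, and the first candidate is the cheapest one, because the
address of the bucket (see `address`) is chosen so that candidates arrive there in the order of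
nondecreasing cost. The buckets are the leaves of a ternary tournament tree, in which every node
stores the smallest cost below it. The number of buckets, and hence the time of an insertion or an
extraction, does not depend on the number of candidates. -/

/-- A part `net` of the solution space with an optimal flow `first` and a second-best flow
`second` of cost `key`. -/
structure Candidate (n : ℕ) where
  key : ℝ
  first : Flow n
  second : Flow n
  net : Network n

inductive Queue (n : ℕ) where
  | empty
  | bucket (q : List (Candidate n))
  | node (m : WithTop ℝ) (a b c : Queue n)

/-- The smallest cost in the queue, by inspection of its root. -/
noncomputable def Queue.minKey {n : ℕ} : Queue n → WithTop ℝ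
  | .empty => ⊤
  | .bucket [] => ⊤
  | .bucket (e :: _) => (e.key : WithTop ℝ)
  | .node m _ _ _ => m

/-- Create a node of the tree. -/
noncomputable def Queue.mkNode {n : ℕ} (a b c : Queue n) : Timed (Queue n) :=
  step (.node (min a.minKey (min b.minKey c.minKey)) a b c)

/-- The three subtrees of a node. -/
def Queue.children {n : ℕ} : Queue n → Queue n × Queue n × Queue n
  | .node _ a b c => (a, b, c)
  | _ => (.empty, .empty, .empty)

/-- The list in a bucket. -/
def Queue.items {n : ℕ} : Queue n → List (Candidate n)
  | .bucket q => q
  | _ => []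

/-- Append a candidate to the bucket with the given address. -/
noncomputable def Queue.insert {n : ℕ} (e : Candidate n) :
    List Ordering → Queue n → Timed (Queue n)
  | [], B => step (.bucket (B.items ++ [e]))
  | .lt :: l, B => do
    let t ← step B.children
    let a ← Queue.insert e l t.1
    Queue.mkNode a t.2.1 t.2.2
  | .eq :: l, B => do
    let t ← step B.children
    let b ← Queue.insert e l t.2.1
    Queue.mkNode t.1 b t.2.2
  | .gt :: l, B => do
    let t ← step B.children
    let c ← Queue.insert e l t.2.2
    Queue.mkNode t.1 t.2.1 c

/-- ExtractMin: remove a candidate of smallest cost; `none` if the queue is empty. -/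
noncomputable def Queue.extractMin {n : ℕ} : Queue n → Timed (Option (Candidate n × Queue n))
  | .empty => step none
  | .bucket [] => step none
  | .bucket (e :: q) => step (some (e, .bucket q))
  | .node _ a b c => do
    if ← step (decide (a.minKey ≤ b.minKey ∧ a.minKey ≤ c.minKey)) then
      match ← a.extractMin with
      | none => pure none
      | some (e, a) =>
        let B ← Queue.mkNode a b c
        pure (some (e, B))
    else if ← step (decide (b.minKey ≤ c.minKey)) then
      match ← b.extractMin with
      | none => pure none
      | some (e, b) =>
        let B ← Queue.mkNode a b c
        pure (some (e, B))
    else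
      match ← c.extractMin with
      | none => pure none
      | some (e, c) =>
        let B ← Queue.mkNode a b c
        pure (some (e, B))

/-- Put the signs of the entries of `f - g` in front of a list. -/
def signs {n : ℕ} (f g : Flow n) (acc : List Ordering) : Timed (List Ordering) :=
  loop (fun (acc : List Ordering) (a : Fin n × Fin n) =>
    step (compare (f a.1 a.2) (g a.1 a.2) :: acc)) (pairs n) acc

/-- The address of the bucket for the new second-best flow `g` belonging to `f`, where `old` is the
previous second-best flow belonging to `f`, or `f` itself if there is none. -/
def address {n : ℕ} (f old g : Flow n) : Timed (List Ordering) := do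
  let acc ← signs f g []
  signs f old acc

/-- Compute the cost of a flow. -/
noncomputable def computeCost {n : ℕ} (N : Network n) (f : Flow n) : Timed ℝ :=
  loop (fun (s : ℝ) (a : Fin n × Fin n) => step
    (if N.arc a.1 a.2 then s + N.cost a.1 a.2 * (f a.1 a.2 : ℝ) else s)) (pairs n) 0

/-! ### The `K` best flows -/

/-- Copy of the network in which the lower capacity of the arc `a` is `v`. -/
def setLower {n : ℕ} (N : Network n) (a : Fin n × Fin n) (v : ℤ) : Timed (Network n) := do
  let M ← copy N.lower
  let M ← step (setEntry M a.1 a.2 v)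
  pure { N with lower := M }

/-- Copy of the network in which the upper capacity of the arc `a` is `v`. -/
def setUpper {n : ℕ} (N : Network n) (a : Fin n × Fin n) (v : ℤ) : Timed (Network n) := do
  let M ← copy N.upper
  let M ← step (setEntry M a.1 a.2 v)
  pure { N with upper := M }

/-- Partition: split the solution space at the first arc where `f` and `g` differ, such that `f`
is in the first part and `g` is in the second part. (For `f = g`, which does not occur, nothing is
split.) -/
def partition {n : ℕ} (N : Network n) (f g : Flow n) : Timed (Network n × Network n) := do
  let diff ← firstSome (fun a : Fin n × Fin n =>
    step (if f a.1 a.2 ≠ g a.1 a.2 then some a else none)) (pairs n)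
  match diff with
  | none => pure (N, N)
  | some a =>
    if ← step (decide (f a.1 a.2 < g a.1 a.2)) then
      let N₁ ← setUpper N a (f a.1 a.2)
      let N₂ ← setLower N a (f a.1 a.2 + 1)
      pure (N₁, N₂)
    else
      let N₁ ← setLower N a (f a.1 a.2)
      let N₂ ← setUpper N a (f a.1 a.2 - 1)
      pure (N₁, N₂)

/-- Find a second-best flow `g` of `N`, given its optimal flow `f`, and insert `(f, g, N)` into the
queue, if `g` exists. -/
noncomputable def insertSecondBest {n : ℕ} (N : Network n) (f old : Flow n) (B : Queue n) :
    Timed (Queue n) := do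
  match ← findSecondBestFlow N f with
  | none => pure B
  | some g =>
    let key ← computeCost N g
    let addr ← address f old g
    B.insert ⟨key, f, g, N⟩ addr

/-- The while loop; the first argument is the number of flows still to be printed, and the list of
printed flows is returned. -/
noncomputable def enumerate {n : ℕ} : ℕ → Queue n → Timed (List (Flow n))
  | 0, _ => pure []
  | k + 1, B => do
    match ← B.extractMin with
    | none => pure []
    | some (e, B) =>
      let out ← copy e.second
      if ← step (decide (k = 0)) then
        pure [out]
      else
        let parts ← partition e.net e.first e.second
        let B ← insertSecondBest parts.1 e.first e.second B
        let B ← insertSecondBest parts.2 e.second e.second B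
        let rest ← enumerate k B
        step (out :: rest)

/-- FindKBestFlows. -/
noncomputable def findKBestFlows {n : ℕ} (N : Network n) (f : Flow n) (K : ℕ) :
    Timed (List (Flow n)) := do
  let out ← copy f
  let B ← insertSecondBest N f f .empty
  let rest ← enumerate (K - 1) B
  step (out :: rest)

end KBestFlow

/-!
Two ideas carry the correctness of `findSecondBestFlow`. The difference of two feasible flows is a
circulation, and every arc that it uses lies on a cycle of residual arcs (`reach_back`). For an
optimal flow the residual graph has no negative cycle, so that the Bellman-Ford distances are
node potentials with nonnegative reduced residual costs (`reducedCost_nonneg`), and the cost of a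
circulation is the sum of the reduced costs of the residual arcs that it uses
(`Network.IsCirculation.linCost_eq`). Hence another flow of minimal cost differs from the given one
only on arcs of reduced cost zero, and it exists if and only if these arcs contain a proper residual
cycle. If there is none, then every other flow uses a residual arc of positive reduced cost; its
anti-parallel arc is not residual, and the rest of the circulation contains a path back, so that the
flow costs at least as much as the best cycle found from the distance table (`exists_candidate`).
Conversely the paths of the Floyd-Warshall algorithm are simple, because entries change only upon
strict improvement (`DistInv.relax`), so that augmentation along them respects the capacities.

The depth-first search for a proper cycle takes `O(n²)` steps, its preprocessing `O(n³)`. An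
unsuccessful search rules out proper cycles by the argument given at `no_proper_cycle`; it rests on
the invariant `DfsInv`, in particular on the facts that the numbers of the descendants of a node
form an interval and that arcs to larger numbers lead to descendants.

For `findKBestFlows`, the candidates in the queue stand for disjoint parts of the solution space,
which together contain the flows that have not been output (`enumerate_step`). The point that
avoids the logarithmic factor of a heap is that a bucket receives its candidates in the order of
nondecreasing cost. All flows found differ by at most one unit on each arc from the flow they are
found from, so that the signs in the address of a bucket determine these differences and their
costs (`totalCost_sub_eq_of_address_eq`). Therefore the key of a new candidate is the key extracted
last plus a constant of its bucket (`bucketOffset_address`), and the extracted keys do not decrease.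
Thus appending keeps the buckets sorted (`Queue.insert_spec`), and each operation of the tournament
tree takes time proportional to its depth `2 n²`.
-/

namespace KBestFlow

/-! ### Values and running times of the basic programs -/

@[simp] lemma val_pure {α : Type} (a : α) : (pure a : Timed α).val = a := rfl
@[simp] lemma time_pure {α : Type} (a : α) : (pure a : Timed α).time = 0 := rfl
@[simp] lemma val_bind {α β : Type} (x : Timed α) (g : α → Timed β) :
    (x >>= g).val = (g x.val).val := rfl
@[simp] lemma time_bind {α β : Type} (x : Timed α) (g : α → Timed β) :
    (x >>= g).time = x.time + (g x.val).time := rfl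
@[simp] lemma val_step {α : Type} (a : α) : (step a).val = a := rfl
@[simp] lemma time_step {α : Type} (a : α) : (step a).time = 1 := rfl
@[simp] lemma val_fill {n : ℕ} {α : Type} (g : Fin n → Timed α) (i : Fin n) :
    (fill g).val i = (g i).val := rfl
@[simp] lemma val_fill₂ {n : ℕ} {α : Type} (g : Fin n → Fin n → Timed α) (i j : Fin n) :
    (fill₂ g).val i j = (g i j).val := rfl
@[simp] lemma val_copy {n : ℕ} {α : Type} (M : Fin n → Fin n → α) : (copy M).val = M := rfl

lemma time_fill_le {n : ℕ} {α : Type} {g : Fin n → Timed α} {T : ℕ}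
    (h : ∀ i, (g i).time ≤ T) : (fill g).time ≤ n * (T + 1) := by
  calc (fill g).time = ∑ i, ((g i).time + 1) := rfl
    _ ≤ ∑ _i : Fin n, (T + 1) := Finset.sum_le_sum fun i _ => by have := h i; omega
    _ = n * (T + 1) := by simp

lemma time_fill₂_le {n : ℕ} {α : Type} {g : Fin n → Fin n → Timed α} {T : ℕ}
    (h : ∀ i j, (g i j).time ≤ T) : (fill₂ g).time ≤ n * (n * (T + 1) + 1) :=
  time_fill_le fun i => time_fill_le fun j => h i j

@[simp] lemma loop_nil {ι σ : Type} (body : σ → ι → Timed σ) (s : σ) :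
    loop body [] s = pure s := rfl

lemma loop_cons_val {ι σ : Type} (body : σ → ι → Timed σ) (a : ι) (l : List ι) (s : σ) :
    (loop body (a :: l) s).val = (loop body l (body s a).val).val := rfl

lemma loop_cons_time {ι σ : Type} (body : σ → ι → Timed σ) (a : ι) (l : List ι) (s : σ) :
    (loop body (a :: l) s).time
      = 1 + ((body s a).time + (loop body l (body s a).val).time) := rfl

lemma time_loop_le {ι σ : Type} {body : σ → ι → Timed σ} {T : ℕ}
    (h : ∀ s a, (body s a).time ≤ T) (l : List ι) (s : σ) :
    (loop body l s).time ≤ l.length * (T + 1) := by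
  induction l generalizing s with
  | nil => simp
  | cons a l ih =>
    rw [loop_cons_time, List.length_cons]
    have h1 := h s a
    have h2 := ih (body s a).val
    linarith

@[simp] lemma firstSome_nil {ι β : Type} (body : ι → Timed (Option β)) :
    firstSome body [] = pure none := rfl

lemma firstSome_cons_val {ι β : Type} (body : ι → Timed (Option β)) (a : ι) (l : List ι) :
    (firstSome body (a :: l)).val
      = match (body a).val with
        | some b => some b
        | none => (firstSome body l).val := by
  simp only [firstSome, val_bind, val_step]
  split <;> simp [*]

lemma time_firstSome_le {ι β : Type} {body : ι → Timed (Option β)} {T : ℕ}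
    (h : ∀ a, (body a).time ≤ T) (l : List ι) :
    (firstSome body l).time ≤ l.length * (T + 1) := by
  induction l with
  | nil => simp
  | cons a l ih =>
    simp only [firstSome, time_bind, val_step, time_step, List.length_cons]
    have h1 := h a
    split
    · simp only [time_pure]; nlinarith
    · linarith

lemma firstSome_eq_some {ι β : Type} {body : ι → Timed (Option β)} {l : List ι} {b : β}
    (h : (firstSome body l).val = some b) : ∃ a ∈ l, (body a).val = some b := by
  induction l with
  | nil => simp at h
  | cons a l ih =>
    rw [firstSome_cons_val] at h
    split at h
    · rename_i b' hb'
      exact ⟨a, by simp, hb'.trans h⟩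
    · obtain ⟨a', ha', h'⟩ := ih h
      exact ⟨a', by simp [ha'], h'⟩

lemma firstSome_eq_none {ι β : Type} {body : ι → Timed (Option β)} {l : List ι}
    (h : (firstSome body l).val = none) : ∀ a ∈ l, (body a).val = none := by
  induction l with
  | nil => simp
  | cons a l ih =>
    rw [firstSome_cons_val] at h
    split at h
    · simp at h
    · rename_i hn
      intro a' ha'
      rcases List.mem_cons.1 ha' with rfl | ha'
      · exact hn
      · exact ih h a' ha'

@[simp] lemma length_pairs (n : ℕ) : (pairs n).length = n * n := by
  exact (List.length_product _ _).trans (by simp)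

@[simp] lemma mem_pairs {n : ℕ} (a : Fin n × Fin n) : a ∈ pairs n :=
  List.pair_mem_product.2 ⟨List.mem_finRange _, List.mem_finRange _⟩

lemma setEntry_apply {n : ℕ} {α : Type} (M : Fin n → Fin n → α) (i j : Fin n) (a : α)
    (i' j' : Fin n) : setEntry M i j a i' j' = if i' = i ∧ j' = j then a else M i' j' := by
  unfold setEntry
  by_cases hi : i' = i
  · subst hi
    by_cases hj : j' = j
    · subst hj; simp
    · simp [hj]
  · simp [hi]

/-! ### Arc lists and walks -/

/-- The arcs of the list lead, one after the other, from the first node to the second one. -/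
def IsWalk {n : ℕ} : Fin n → List (Fin n × Fin n) → Fin n → Prop
  | i, [], j => i = j
  | i, a :: l, j => a.1 = i ∧ IsWalk a.2 l j

/-- The number of arcs of the list that leave `v` minus the number of those that enter `v`. -/
def netOut {n : ℕ} (l : List (Fin n × Fin n)) (v : Fin n) : ℤ :=
  (l.map fun a => (if a.1 = v then (1 : ℤ) else 0) - if a.2 = v then 1 else 0).sum

/-- The total weight of an arc list. -/
def weight {n : ℕ} (w : Fin n → Fin n → ℝ) (l : List (Fin n × Fin n)) : ℝ :=
  (l.map fun a => w a.1 a.2).sum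

section Walks
variable {n : ℕ}

@[simp] lemma netOut_nil (v : Fin n) : netOut [] v = 0 := rfl

lemma netOut_cons (a : Fin n × Fin n) (l : List (Fin n × Fin n)) (v : Fin n) :
    netOut (a :: l) v
      = ((if v = a.1 then (1 : ℤ) else 0) - if v = a.2 then 1 else 0) + netOut l v := by
  simp [netOut, eq_comm]

@[simp] lemma weight_nil (w : Fin n → Fin n → ℝ) : weight w [] = 0 := rfl

@[simp] lemma weight_cons (w : Fin n → Fin n → ℝ) (a : Fin n × Fin n)
    (l : List (Fin n × Fin n)) : weight w (a :: l) = w a.1 a.2 + weight w l := by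
  simp [weight]

@[simp] lemma weight_append (w : Fin n → Fin n → ℝ) (l l' : List (Fin n × Fin n)) :
    weight w (l ++ l') = weight w l + weight w l' := by
  simp [weight]

lemma weight_nonneg {w : Fin n → Fin n → ℝ} {l : List (Fin n × Fin n)}
    (h : ∀ a ∈ l, 0 ≤ w a.1 a.2) : 0 ≤ weight w l :=
  List.sum_nonneg fun x hx => by
    obtain ⟨a, ha, rfl⟩ := List.mem_map.1 hx
    exact h a ha

lemma IsWalk.append {i j k : Fin n} {l l' : List (Fin n × Fin n)} (h : IsWalk i l j)
    (h' : IsWalk j l' k) : IsWalk i (l ++ l') k := by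
  induction l generalizing i with
  | nil => cases h; exact h'
  | cons a l ih => exact ⟨h.1, ih h.2⟩

lemma IsWalk.netOut_eq {i j : Fin n} {l : List (Fin n × Fin n)} (h : IsWalk i l j) (v : Fin n) :
    netOut l v = (if v = i then (1 : ℤ) else 0) - if v = j then 1 else 0 := by
  induction l generalizing i with
  | nil => cases h; simp
  | cons a l ih =>
    obtain ⟨rfl, h⟩ := h
    rw [netOut_cons, ih h]
    ring

lemma IsWalk.split {i j m : Fin n} {l : List (Fin n × Fin n)} (h : IsWalk i l j)
    (hm : m ∈ l.map Prod.fst) :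
    ∃ l₁ l₂, l = l₁ ++ l₂ ∧ IsWalk i l₁ m ∧ IsWalk m l₂ j ∧ l₂ ≠ [] := by
  induction l generalizing i with
  | nil => simp at hm
  | cons a l ih =>
    by_cases hma : m = a.1
    · subst hma
      exact ⟨[], a :: l, rfl, h.1.symm, ⟨rfl, h.2⟩, by simp⟩
    · have hm' : m ∈ l.map Prod.fst := by
        simpa [hma] using hm
      obtain ⟨l₁, l₂, rfl, h₁, h₂, h₃⟩ := ih h.2 hm'
      exact ⟨a :: l₁, l₂, rfl, ⟨h.1, h₁⟩, h₂, h₃⟩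

lemma exists_walk_of_reflTransGen {R : Fin n → Fin n → Prop} {i j : Fin n}
    (h : Relation.ReflTransGen R i j) : ∃ l, IsWalk i l j ∧ ∀ a ∈ l, R a.1 a.2 := by
  induction h using Relation.ReflTransGen.head_induction_on with
  | refl => exact ⟨[], rfl, by simp⟩
  | head hab _ ih =>
    obtain ⟨l, hl, hR⟩ := ih
    exact ⟨(_, _) :: l, ⟨rfl, hl⟩, by simpa using ⟨hab, fun a b h => hR (a, b) h⟩⟩

/-- If simple cycles have nonnegative weight, then deleting cycles turns any walk into a simple
path of at most the same weight. -/
lemma exists_simple_walk {R : Fin n → Fin n → Prop} {w : Fin n → Fin n → ℝ}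
    (hcyc : ∀ i C, IsWalk i C i → (∀ a ∈ C, R a.1 a.2) → (C.map Prod.fst).Nodup →
      0 ≤ weight w C)
    {i j : Fin n} {l : List (Fin n × Fin n)} (hl : IsWalk i l j) (hR : ∀ a ∈ l, R a.1 a.2) :
    ∃ l', IsWalk i l' j ∧ (∀ a ∈ l', R a.1 a.2) ∧ (l'.map Prod.fst).Nodup ∧
      j ∉ l'.map Prod.fst ∧ weight w l' ≤ weight w l := by
  induction l generalizing i with
  | nil => exact ⟨[], hl, by simp, by simp, by simp, le_rfl⟩
  | cons a l ih =>
    obtain ⟨ha, hl⟩ := hl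
    subst ha
    obtain ⟨l', h1, h2, h3, h4, h5⟩ := ih hl fun b hb => hR b (by simp [hb])
    have haR : R a.1 a.2 := hR a (by simp)
    by_cases haj : a.1 = j
    · have hc := hcyc a.1 (a :: l') ⟨rfl, haj ▸ h1⟩
        (by intro b hb
            rcases List.mem_cons.1 hb with rfl | hb
            · exact haR
            · exact h2 b hb)
        (by rw [List.map_cons, List.nodup_cons]; exact ⟨haj ▸ h4, h3⟩)
      refine ⟨[], haj, by simp, by simp, by simp, ?_⟩
      simp only [weight_cons, weight_nil] at hc ⊢
      linarith
    by_cases hal : a.1 ∈ l'.map Prod.fst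
    · obtain ⟨l₁, l₂, rfl, hl₁, hl₂, hne⟩ := h1.split hal
      have hdis := h3
      rw [List.map_append, List.nodup_append] at hdis
      have ha₂ : a.1 ∈ l₂.map Prod.fst := by
        cases l₂ with
        | nil => exact absurd rfl hne
        | cons b l₂ => simp [hl₂.1]
      have hc := hcyc a.1 (a :: l₁) ⟨rfl, hl₁⟩
        (by intro b hb
            rcases List.mem_cons.1 hb with rfl | hb
            · exact haR
            · exact h2 b (by simp [hb]))
        (by rw [List.map_cons, List.nodup_cons]
            exact ⟨fun h => hdis.2.2 _ h _ ha₂ rfl, hdis.1⟩)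
      refine ⟨l₂, hl₂, fun b hb => h2 b (by simp [hb]), hdis.2.1, fun h => h4 ?_, ?_⟩
      · rw [List.map_append]; exact List.mem_append_right _ h
      · simp only [weight_cons, weight_append] at hc h5 ⊢
        linarith
    · refine ⟨a :: l', ⟨rfl, h1⟩, ?_, ?_, ?_, ?_⟩
      · intro b hb
        rcases List.mem_cons.1 hb with rfl | hb
        · exact haR
        · exact h2 b hb
      · rw [List.map_cons, List.nodup_cons]; exact ⟨hal, h3⟩
      · rw [List.map_cons, List.mem_cons, not_or]; exact ⟨fun h => haj h.symm, h4⟩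
      · simp only [weight_cons]; linarith

lemma length_le_of_nodup_sources {l : List (Fin n × Fin n)} (h : (l.map Prod.fst).Nodup) :
    l.length ≤ n := by
  simpa using h.length_le_card

lemma length_lt_of_nodup_sources {l : List (Fin n × Fin n)} {j : Fin n}
    (h : (l.map Prod.fst).Nodup) (hj : j ∉ l.map Prod.fst) : l.length < n := by
  have : (j :: l.map Prod.fst).Nodup := List.nodup_cons.2 ⟨hj, h⟩
  simpa using this.length_le_card

end Walks

/-! ### Circulations and residual arcs -/

/-- The cost `∑ c i j * x i j` of a matrix `x`. -/
noncomputable def linCost {n : ℕ} (c : Fin n → Fin n → ℝ) (x : Flow n) : ℝ :=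
  ∑ i, ∑ j, c i j * (x i j : ℝ)

/-- An integer function on the arcs, zero elsewhere, that is balanced at every node; such as the
difference of two feasible flows. -/
def Network.IsCirculation {n : ℕ} (N : Network n) (x : Flow n) : Prop :=
  (∀ i j, N.arc i j = false → x i j = 0) ∧ ∀ i, (∑ j, x i j) - ∑ j, x j i = 0

/-- `(i, j)` is an arc of the residual graph. -/
def Network.Res {n : ℕ} (N : Network n) (f : Flow n) (i j : Fin n) : Prop :=
  (N.arc i j = true ∧ f i j < N.upper i j) ∨ (N.arc j i = true ∧ N.lower j i < f j i)

/-- The weights of the residual arcs that belong to the weights `c` of the arcs. -/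
noncomputable def Network.resWeight {n : ℕ} (N : Network n) (c : Fin n → Fin n → ℝ)
    (i j : Fin n) : ℝ :=
  if N.arc i j then c i j else -c j i

/-- One unit of flow sent along each of the arcs of `C`. -/
def Network.augFlow {n : ℕ} (N : Network n) (f : Flow n) (C : List (Fin n × Fin n)) : Flow n :=
  fun i j => f i j + if N.arc i j then (C.count (i, j) : ℤ) - C.count (j, i) else 0

section Flows
variable {n : ℕ} {N : Network n}

lemma residualGraph_val {f : Flow n} {i j : Fin n} :
    (residualGraph N f).val i j = true ↔ N.Res f i j := by
  simp [residualGraph, Network.Res]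

lemma residualCost_val {c : Fin n → Fin n → ℝ} :
    (residualCost N c).val = N.resWeight c := rfl

lemma Network.IsFeasible.totalCost_eq {f : Flow n} (hf : N.IsFeasible f) :
    N.totalCost f = linCost N.cost f := by
  unfold Network.totalCost linCost
  refine Finset.sum_congr rfl fun i _ => Finset.sum_congr rfl fun j _ => ?_
  by_cases h : N.arc i j = true
  · simp [h]
  · simp [h, hf.1 i j (by simpa using h)]

lemma Network.IsFeasible.balance_eq {f : Flow n} (hf : N.IsFeasible f) (i : Fin n) :
    (∑ j, f i j) - ∑ j, f j i = N.balance i := by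
  rw [← hf.2.2 i]
  congr 1 <;> refine Finset.sum_congr rfl fun j _ => ?_
  · by_cases h : N.arc i j = true
    · simp [h]
    · simp [h, hf.1 i j (by simpa using h)]
  · by_cases h : N.arc j i = true
    · simp [h]
    · simp [h, hf.1 j i (by simpa using h)]

lemma isFeasible_iff {f : Flow n} : N.IsFeasible f ↔
    (∀ i j, N.arc i j = false → f i j = 0) ∧
    (∀ i j, N.arc i j = true → N.lower i j ≤ f i j ∧ f i j ≤ N.upper i j) ∧
    ∀ i, (∑ j, f i j) - ∑ j, f j i = N.balance i := by
  constructor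
  · exact fun h => ⟨h.1, h.2.1, h.balance_eq⟩
  · refine fun h => ⟨h.1, h.2.1, fun i => ?_⟩
    rw [← h.2.2 i]
    congr 1 <;> refine Finset.sum_congr rfl fun j _ => ?_
    · by_cases h' : N.arc i j = true
      · simp [h']
      · simp [h', h.1 i j (by simpa using h')]
    · by_cases h' : N.arc j i = true
      · simp [h']
      · simp [h', h.1 j i (by simpa using h')]

lemma Network.IsFeasible.sub {f h : Flow n} (hh : N.IsFeasible h) (hf : N.IsFeasible f) :
    N.IsCirculation fun i j => h i j - f i j := by
  refine ⟨fun i j hij => by simp [hh.1 i j hij, hf.1 i j hij], fun i => ?_⟩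
  have h1 := hh.balance_eq i
  have h2 := hf.balance_eq i
  simp only [Finset.sum_sub_distrib]
  linarith

lemma linCost_sub (c : Fin n → Fin n → ℝ) (f h : Flow n) :
    linCost c (fun i j => h i j - f i j) = linCost c h - linCost c f := by
  simp [linCost, mul_sub, Finset.sum_sub_distrib]

lemma Network.IsCirculation.linCost_reduced {x : Flow n} (hx : N.IsCirculation x)
    (c : Fin n → Fin n → ℝ) (y : Fin n → ℝ) :
    linCost (fun i j => c i j + y i - y j) x = linCost c x := by
  have h1 : linCost (fun i j => c i j + y i - y j) x
      = linCost c x + (∑ i, y i * ∑ j, (x i j : ℝ)) - ∑ i, y i * ∑ j, (x j i : ℝ) := by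
    simp only [linCost, Finset.mul_sum]
    rw [Finset.sum_comm (f := fun i j => y i * (x j i : ℝ)), ← Finset.sum_add_distrib,
      ← Finset.sum_sub_distrib]
    refine Finset.sum_congr rfl fun i _ => ?_
    rw [← Finset.sum_add_distrib, ← Finset.sum_sub_distrib]
    exact Finset.sum_congr rfl fun j _ => by ring
  rw [h1, add_sub_assoc, ← Finset.sum_sub_distrib, Finset.sum_eq_zero, add_zero]
  intro i _
  have h2 : (∑ j, (x i j : ℝ)) - ∑ j, (x j i : ℝ) = 0 := by exact_mod_cast hx.2 i
  rw [← mul_sub, h2, mul_zero]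

/-- Every arc of a circulation lies on a cycle of the circulation: otherwise flow would enter the
set of nodes reachable from the head of the arc, but not leave it. -/
lemma reach_back {φ : Fin n → Fin n → ℤ} (hanti : ∀ i j, φ i j = -φ j i)
    (hsum : ∀ i, ∑ j, φ i j = 0) {i j : Fin n} (hij : 0 < φ i j) :
    Relation.ReflTransGen (fun a b => 0 < φ a b) j i := by
  classical
  by_contra hcon
  set S : Finset (Fin n) :=
    Finset.univ.filter fun v => Relation.ReflTransGen (fun a b => 0 < φ a b) j v with hS
  have hiS : i ∈ Sᶜ := by simpa [hS] using hcon
  have hjS : j ∈ S := by simp [hS, Relation.ReflTransGen.refl]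
  have h0 : ∑ v ∈ S, ∑ u, φ v u = 0 := Finset.sum_eq_zero fun v _ => hsum v
  have h1 : ∑ v ∈ S, ∑ u ∈ S, φ v u = 0 := by
    have h : ∑ v ∈ S, ∑ u ∈ S, φ v u = -∑ v ∈ S, ∑ u ∈ S, φ v u := by
      conv_lhs => rw [Finset.sum_comm]
      rw [← Finset.sum_neg_distrib]
      refine Finset.sum_congr rfl fun u _ => ?_
      rw [← Finset.sum_neg_distrib]
      exact Finset.sum_congr rfl fun v _ => hanti v u
    omega
  have h2 : ∑ v ∈ S, ∑ u ∈ Sᶜ, φ v u = 0 := by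
    have : ∑ v ∈ S, ∑ u, φ v u = ∑ v ∈ S, (∑ u ∈ S, φ v u + ∑ u ∈ Sᶜ, φ v u) :=
      Finset.sum_congr rfl fun v _ => (Finset.sum_add_sum_compl S _).symm
    rw [Finset.sum_add_distrib] at this
    omega
  have hle : ∀ v ∈ S, ∀ u ∈ Sᶜ, 0 ≤ -φ v u := by
    intro v hv u hu
    by_contra hlt
    have hv' : Relation.ReflTransGen (fun a b => 0 < φ a b) j v := by simpa [hS] using hv
    have hu' : ¬Relation.ReflTransGen (fun a b => 0 < φ a b) j u := by simpa [hS] using hu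
    exact hu' (hv'.tail (by omega))
  have h3 : -φ j i ≤ ∑ v ∈ S, ∑ u ∈ Sᶜ, -φ v u :=
    (Finset.single_le_sum (f := fun u => -φ j u) (hle j hjS) hiS).trans
      (Finset.single_le_sum (f := fun v => ∑ u ∈ Sᶜ, -φ v u)
        (fun v hv => Finset.sum_nonneg (hle v hv)) hjS)
  simp only [Finset.sum_neg_distrib, h2] at h3
  have := hanti i j
  omega

lemma Network.IsCirculation.net_sum {x : Flow n} (hx : N.IsCirculation x) (i : Fin n) :
    ∑ j, (x i j - x j i) = 0 := by
  rw [Finset.sum_sub_distrib]; exact hx.2 i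

lemma Network.IsCirculation.reach_back {x : Flow n} (hx : N.IsCirculation x) {i j : Fin n}
    (hij : 0 < x i j - x j i) :
    Relation.ReflTransGen (fun a b => 0 < x a b - x b a) j i :=
  KBestFlow.reach_back (φ := fun a b => x a b - x b a) (fun _ _ => by ring) hx.net_sum hij

lemma Network.IsCirculation.exists_pos (hN : N.Valid) {x : Flow n} (hx : N.IsCirculation x)
    {i j : Fin n} (hij : x i j ≠ 0) : 0 < x i j - x j i ∨ 0 < x j i - x i j := by
  have harc : N.arc i j = true := by
    by_contra h
    exact hij (hx.1 i j (by simpa using h))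
  have := hx.1 j i (hN.1 i j harc)
  omega

/-- The cost of a circulation is the sum of the residual weights of the arcs that it uses, with
multiplicities. -/
lemma Network.IsCirculation.linCost_eq (hN : N.Valid) {x : Flow n} (hx : N.IsCirculation x)
    (c : Fin n → Fin n → ℝ) :
    linCost c x = ∑ i, ∑ j, if 0 < x i j - x j i
      then N.resWeight c i j * ((x i j - x j i : ℤ) : ℝ) else 0 := by
  set T : Fin n → Fin n → ℝ := fun i j => c i j * (x i j : ℝ) with hT
  set U : Fin n → Fin n → ℝ := fun i j => if 0 < x i j - x j i
      then N.resWeight c i j * ((x i j - x j i : ℤ) : ℝ) else 0 with hU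
  have key : ∀ i j, N.arc i j = true → T i j + T j i = U i j + U j i := by
    intro i j hij
    have hji := hN.1 i j hij
    have h0 : x j i = 0 := hx.1 j i hji
    simp only [hT, hU, h0, Network.resWeight, hij, hji]
    rcases lt_trichotomy (x i j) 0 with h | h | h
    · simp [h, not_lt.2 h.le]
    · simp [h]
    · simp [h, not_lt.2 h.le]
  have key' : ∀ i j, T i j + T j i = U i j + U j i := by
    intro i j
    by_cases hij : N.arc i j = true
    · exact key i j hij
    by_cases hji : N.arc j i = true
    · rw [add_comm, key j i hji, add_comm]
    · have h1 := hx.1 i j (by simpa using hij)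
      have h2 := hx.1 j i (by simpa using hji)
      simp [hT, hU, h1, h2]
  have h1 : ∑ i, ∑ j, (T i j + T j i) = ∑ i, ∑ j, (U i j + U j i) :=
    Finset.sum_congr rfl fun i _ => Finset.sum_congr rfl fun j _ => key' i j
  simp only [Finset.sum_add_distrib] at h1
  rw [Finset.sum_comm (f := fun i j => T j i), Finset.sum_comm (f := fun i j => U j i)] at h1
  change ∑ i, ∑ j, T i j = ∑ i, ∑ j, U i j
  linarith

lemma Network.IsCirculation.weight_le (hN : N.Valid) {x : Flow n} (hx : N.IsCirculation x)
    {c : Fin n → Fin n → ℝ} (hc : ∀ i j, 0 < x i j - x j i → 0 ≤ N.resWeight c i j)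
    {C : List (Fin n × Fin n)} (hC : C.Nodup) (hCx : ∀ a ∈ C, 0 < x a.1 a.2 - x a.2 a.1) :
    weight (N.resWeight c) C ≤ linCost c x := by
  rw [hx.linCost_eq hN, ← Fintype.sum_prod_type'
    (f := fun i j => if 0 < x i j - x j i
      then N.resWeight c i j * ((x i j - x j i : ℤ) : ℝ) else 0),
    show weight (N.resWeight c) C = ∑ a ∈ C.toFinset, N.resWeight c a.1 a.2 from
      (List.sum_toFinset _ hC).symm]
  refine le_trans (Finset.sum_le_sum (g := fun a : Fin n × Fin n => if 0 < x a.1 a.2 - x a.2 a.1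
      then N.resWeight c a.1 a.2 * ((x a.1 a.2 - x a.2 a.1 : ℤ) : ℝ) else 0)
      fun a ha => ?_) (Finset.sum_le_sum_of_subset_of_nonneg (Finset.subset_univ _) ?_)
  · have h := hCx a (List.mem_toFinset.1 ha)
    rw [if_pos h]
    have h1 : (1 : ℝ) ≤ ((x a.1 a.2 - x a.2 a.1 : ℤ) : ℝ) := by exact_mod_cast h
    exact le_mul_of_one_le_right (hc _ _ h) h1
  · intro a _ _
    split_ifs with h
    · exact mul_nonneg (hc _ _ h) (by exact_mod_cast h.le)
    · exact le_rfl

/-- A circulation that leads from one feasible flow to another uses residual arcs. -/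
lemma res_of_pos {f h : Flow n} (hf : N.IsFeasible f) (hh : N.IsFeasible h) {i j : Fin n}
    (hij : 0 < (h i j - f i j) - (h j i - f j i)) : N.Res f i j := by
  by_cases h1 : 0 < h i j - f i j
  · left
    have harc : N.arc i j = true := by
      by_contra hc
      have hc : N.arc i j = false := by simpa using hc
      rw [hf.1 i j hc, hh.1 i j hc] at h1
      omega
    exact ⟨harc, by have := (hh.2.1 i j harc).2; omega⟩
  · right
    have harc : N.arc j i = true := by
      by_contra hc
      have hc : N.arc j i = false := by simpa using hc
      rw [hf.1 j i hc, hh.1 j i hc] at hij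
      omega
    exact ⟨harc, by have := (hh.2.1 j i harc).1; omega⟩

lemma Network.Res.arc_or {f : Flow n} {i j : Fin n} (h : N.Res f i j) :
    N.arc i j = true ∨ N.arc j i = true := h.imp And.left And.left

/-! ### Augmentation -/

lemma augment_val (hN : N.Valid) (f : Flow n) {C : List (Fin n × Fin n)}
    (hC : ∀ a ∈ C, N.arc a.1 a.2 = true ∨ N.arc a.2 a.1 = true) :
    (augment N f C).val = N.augFlow f C := by
  simp only [augment, val_bind, val_copy]
  induction C generalizing f with
  | nil => funext i j; simp [Network.augFlow]
  | cons a C ih =>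
    rw [loop_cons_val, ih _ fun b hb => hC b (by simp [hb])]
    funext i j
    obtain ⟨p, q⟩ := a
    have ha : N.arc p q = true ∨ N.arc q p = true := hC (p, q) (by simp)
    simp only [Network.augFlow, List.count_cons, val_step, beq_iff_eq, Prod.mk.injEq,
      Nat.cast_add, Nat.cast_ite, Nat.cast_one, Nat.cast_zero]
    by_cases hpq : N.arc p q = true
    · have hqp := hN.1 p q hpq
      simp only [hpq, if_true, setEntry_apply]
      by_cases h1 : i = p ∧ j = q
      · obtain ⟨rfl, rfl⟩ := h1
        have : ¬(i = j ∧ j = i) := by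
          rintro ⟨rfl, -⟩
          rw [hpq] at hqp; cases hqp
        simp [hpq, this]
        ring
      · have h1' : ¬(p = i ∧ q = j) := fun h => h1 ⟨h.1.symm, h.2.symm⟩
        by_cases h2 : p = j ∧ q = i
        · obtain ⟨rfl, rfl⟩ := h2
          simp [h1, hqp]
        · simp [h1, h1', h2]
    · have hqp : N.arc q p = true := ha.resolve_left hpq
      have hpq' : N.arc p q = false := by simpa using hpq
      simp only [hpq', Bool.false_eq_true, if_false, setEntry_apply]
      by_cases h1 : i = q ∧ j = p
      · obtain ⟨rfl, rfl⟩ := h1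
        have : ¬(i = j ∧ j = i) := by
          rintro ⟨rfl, -⟩
          rw [hqp] at hpq'; cases hpq'
        have h' : ¬(j = i ∧ i = j) := fun h => this ⟨h.2, h.1⟩
        simp [hqp, h']
        ring
      · have h1' : ¬(p = j ∧ q = i) := fun h => h1 ⟨h.2.symm, h.1.symm⟩
        by_cases h2 : p = i ∧ q = j
        · obtain ⟨rfl, rfl⟩ := h2
          simp [h1, hpq']
        · simp [h1, h1', h2]

lemma time_augment_le (f : Flow n) (C : List (Fin n × Fin n)) :
    (augment N f C).time ≤ n * (n * 2 + 1) + C.length * 2 := by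
  simp only [augment, time_bind]
  exact Nat.add_le_add (time_fill₂_le fun i j => le_rfl) (time_loop_le (fun s a => by simp) _ _)

lemma netOut_eq_sum (C : List (Fin n × Fin n)) (v : Fin n) :
    netOut C v = ∑ j, ((C.count (v, j) : ℤ) - C.count (j, v)) := by
  induction C with
  | nil => simp
  | cons a C ih =>
    obtain ⟨p, q⟩ := a
    rw [netOut_cons, ih]
    simp only [List.count_cons, beq_iff_eq, Prod.mk.injEq, Nat.cast_add, Nat.cast_ite,
      Nat.cast_one, Nat.cast_zero, Finset.sum_sub_distrib, Finset.sum_add_distrib]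
    have h1 : ∑ j, (if p = v ∧ q = j then (1 : ℤ) else 0) = if v = p then 1 else 0 := by
      by_cases h : p = v
      · simp [h]
      · simp [h, Ne.symm h]
    have h2 : ∑ j, (if p = j ∧ q = v then (1 : ℤ) else 0) = if v = q then 1 else 0 := by
      by_cases h : q = v
      · simp [h]
      · simp [h, Ne.symm h]
    rw [h1, h2]
    ring

section Augment
variable {f : Flow n} {C : List (Fin n × Fin n)}

lemma augFlow_sub_isCirculation (hN : N.Valid)
    (hC : ∀ a ∈ C, N.arc a.1 a.2 = true ∨ N.arc a.2 a.1 = true) (hnet : ∀ v, netOut C v = 0) :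
    N.IsCirculation fun i j => N.augFlow f C i j - f i j := by
  refine ⟨fun i j h => by simp [Network.augFlow, h], fun i => ?_⟩
  rw [← hnet i, netOut_eq_sum, ← Finset.sum_sub_distrib]
  refine Finset.sum_congr rfl fun j _ => ?_
  simp only [Network.augFlow, add_sub_cancel_left]
  by_cases hij : N.arc i j = true
  · simp [hij, hN.1 i j hij]
  by_cases hji : N.arc j i = true
  · simp [hij, hji]
  · have h1 : C.count (i, j) = 0 := List.count_eq_zero.2 fun h => by
      rcases hC _ h with h | h <;> contradiction
    have h2 : C.count (j, i) = 0 := List.count_eq_zero.2 fun h => by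
      rcases hC _ h with h | h <;> contradiction
    simp [hij, hji, h1, h2]

lemma augFlow_isFeasible (hN : N.Valid) (hf : N.IsFeasible f) (hC : ∀ a ∈ C, N.Res f a.1 a.2)
    (hnd : C.Nodup) (hnet : ∀ v, netOut C v = 0) : N.IsFeasible (N.augFlow f C) := by
  have hcirc := augFlow_sub_isCirculation (f := f) hN (fun a ha => (hC a ha).arc_or) hnet
  refine isFeasible_iff.2 ⟨fun i j h => ?_, fun i j h => ?_, fun i => ?_⟩
  · simpa [Network.augFlow, h] using hf.1 i j h
  · have hb := hf.2.1 i j h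
    have hji := hN.1 i j h
    simp only [Network.augFlow, h, if_true]
    have c1 := List.nodup_iff_count_le_one.1 hnd (i, j)
    have c2 := List.nodup_iff_count_le_one.1 hnd (j, i)
    have r1 : 0 < C.count (i, j) → f i j < N.upper i j := fun hc => by
      rcases hC _ (List.count_pos_iff.1 hc) with h' | h'
      · exact h'.2
      · rw [hji] at h'; cases h'.1
    have r2 : 0 < C.count (j, i) → N.lower i j < f i j := fun hc => by
      rcases hC _ (List.count_pos_iff.1 hc) with h' | h'
      · rw [hji] at h'; cases h'.1
      · exact h'.2
    omega
  · have h1 := hcirc.2 i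
    have h2 := hf.balance_eq i
    simp only [Finset.sum_sub_distrib] at h1
    linarith

lemma augFlow_unit (hnd : C.Nodup) (i j : Fin n) : |N.augFlow f C i j - f i j| ≤ 1 := by
  have c1 := List.nodup_iff_count_le_one.1 hnd (i, j)
  have c2 := List.nodup_iff_count_le_one.1 hnd (j, i)
  rw [abs_le]
  unfold Network.augFlow
  split_ifs <;> omega

lemma augFlow_ne (hC : ∀ a ∈ C, N.arc a.1 a.2 = true ∨ N.arc a.2 a.1 = true)
    {a : Fin n × Fin n} (ha : a ∈ C) (ha' : (a.2, a.1) ∉ C) : N.augFlow f C ≠ f := by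
  intro h
  obtain ⟨i, j⟩ := a
  have h1 : 0 < C.count (i, j) := List.count_pos_iff.2 ha
  have h2 : C.count (j, i) = 0 := List.count_eq_zero.2 ha'
  rcases hC _ ha with h3 | h3
  · have := congrFun (congrFun h i) j
    simp only [Network.augFlow, h3, if_true] at this
    omega
  · have := congrFun (congrFun h j) i
    simp only [Network.augFlow, h3, if_true] at this
    omega

lemma linCost_augFlow (hN : N.Valid)
    (hC : ∀ a ∈ C, N.arc a.1 a.2 = true ∨ N.arc a.2 a.1 = true) (c : Fin n → Fin n → ℝ) :
    linCost c (fun i j => N.augFlow f C i j - f i j) = weight (N.resWeight c) C := by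
  simp only [Network.augFlow, add_sub_cancel_left]
  induction C with
  | nil => simp [linCost]
  | cons a C ih =>
    rw [weight_cons, ← ih fun b hb => hC b (by simp [hb])]
    obtain ⟨p, q⟩ := a
    have ha : N.arc p q = true ∨ N.arc q p = true := hC (p, q) (by simp)
    have key : ∀ i j, c i j * (((if N.arc i j then (((p, q) :: C).count (i, j) : ℤ)
          - ((p, q) :: C).count (j, i) else 0) : ℤ) : ℝ)
        = (if i = p then if j = q then (if N.arc p q then c p q else 0) else 0 else 0)
          + (if i = q then if j = p then (if N.arc q p then -c q p else 0) else 0 else 0)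
          + c i j * ((if N.arc i j then (C.count (i, j) : ℤ) - C.count (j, i) else 0 : ℤ) : ℝ) := by
      intro i j
      by_cases hij : N.arc i j = true
      · simp only [hij, if_true, List.count_cons, beq_iff_eq, Prod.mk.injEq]
        by_cases h1 : i = p ∧ j = q
        · obtain ⟨rfl, rfl⟩ := h1
          have hne : i ≠ j := by
            rintro rfl
            rw [hN.1 i i hij] at hij; cases hij
          simp [hij, hne]
          ring
        · by_cases h2 : i = q ∧ j = p
          · obtain ⟨rfl, rfl⟩ := h2
            have hne : i ≠ j := by
              rintro rfl
              rw [hN.1 i i hij] at hij; cases hij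
            simp [hij, hne, hne.symm]
            ring
          · have h1' : ¬(p = i ∧ q = j) := fun h => h1 ⟨h.1.symm, h.2.symm⟩
            have h2' : ¬(p = j ∧ q = i) := fun h => h2 ⟨h.2.symm, h.1.symm⟩
            have h1'' : ¬(i = p ∧ j = q ∧ N.arc p q = true) := fun h => h1 ⟨h.1, h.2.1⟩
            have h2'' : ¬(i = q ∧ j = p ∧ N.arc q p = true) := fun h => h2 ⟨h.1, h.2.1⟩
            simp only [h1', h2', if_false, ← ite_and, h1'', h2'']
            simp
      · have h1 : (if i = p then if j = q then (if N.arc p q then c p q else 0) else 0 else 0)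
            = 0 := by
          split_ifs with h1 h2 h3
          · subst h1 h2; contradiction
          all_goals rfl
        have h2 : (if i = q then if j = p then (if N.arc q p then -c q p else 0) else 0 else 0)
            = 0 := by
          split_ifs with h1 h2 h3
          · subst h1 h2; contradiction
          all_goals rfl
        rw [h1, h2]
        simp [hij]
    simp only [linCost, key, Finset.sum_add_distrib, Finset.sum_ite_irrel,
      Finset.sum_const_zero, Finset.sum_ite_eq', Finset.mem_univ, if_true]
    congr 1
    by_cases hpq : N.arc p q = true
    · simp [Network.resWeight, hpq, hN.1 p q hpq]
    · simp [Network.resWeight, hpq, ha.resolve_left hpq]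

end Augment

end Flows

/-! ### Depth-first search: the forest -/

/-- `w` is an ancestor of `u` (possibly `u` itself) in the DFS forest. -/
def Forest.Anc {n : ℕ} (F : Forest n) : Fin n → Fin n → Prop :=
  Relation.ReflTransGen fun a b => F.parent b = some a

/-- The number of visited nodes. -/
def Forest.numVisited {n : ℕ} (F : Forest n) : ℕ :=
  (Finset.univ.filter fun v => F.visited v = true).card

/-- `F'` arises from `F` by visiting further nodes. -/
def Forest.Ext {n : ℕ} (F F' : Forest n) : Prop :=
  ∀ v, F.visited v = true → F'.visited v = true ∧ F'.parent v = F.parent v ∧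
    F'.number v = F.number v ∧ F'.sbaLow v = F.sbaLow v

/-- The invariant of the depth-first search. The nodes in `G` are those whose visit has not been
completed; they form a path of the forest from a root to the current node. -/
structure DfsInv {n : ℕ} (res : Fin n → Fin n → Bool) (F : Forest n) (G : Fin n → Prop) :
    Prop where
  clock_eq : F.clock = F.numVisited
  lt_clock : ∀ v, F.visited v = true → F.number v < F.clock
  inj : ∀ u v, F.visited u = true → F.visited v = true → F.number u = F.number v → u = v
  parent : ∀ v p, F.parent v = some p →
    F.visited v = true ∧ F.visited p = true ∧ res p v = true ∧ F.number p < F.number v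
  low_some : ∀ v p, F.parent v = some p →
    F.sbaLow v = if res v p then F.sbaLow p else F.number v
  low_none : ∀ v, F.visited v = true → F.parent v = none → F.sbaLow v = F.number v
  white : ∀ u v, F.visited u = true → res u v = true → F.visited v = false → G u
  forward : ∀ u v, F.visited u = true → F.visited v = true → res u v = true →
    F.number u < F.number v → F.Anc u v
  interval : ∀ w u v, F.visited u = true → F.visited v = true → F.Anc w u →
    F.number w ≤ F.number v → F.number v ≤ F.number u → F.Anc w v
  grey : ∀ w, G w → F.visited w = true ∧
    ∀ v, F.visited v = true → F.number w ≤ F.number v → F.Anc w v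

section DFS
variable {n : ℕ} {res : Fin n → Fin n → Bool}

lemma Forest.Ext.refl (F : Forest n) : F.Ext F := fun _ h => ⟨h, rfl, rfl, rfl⟩

lemma Forest.Ext.trans {F F' F'' : Forest n} (h : F.Ext F') (h' : F'.Ext F'') : F.Ext F'' :=
  fun v hv => by
    obtain ⟨a1, a2, a3, a4⟩ := h v hv
    obtain ⟨b1, b2, b3, b4⟩ := h' v a1
    exact ⟨b1, b2.trans a2, b3.trans a3, b4.trans a4⟩

lemma DfsInv.visited_of_anc {F : Forest n} {G : Fin n → Prop} (h : DfsInv res F G)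
    {w u : Fin n} (hwu : F.Anc w u) (hu : F.visited u = true) : F.visited w = true := by
  induction hwu with
  | refl => exact hu
  | tail _ hbc ih => exact ih (h.parent _ _ hbc).2.1

lemma DfsInv.anc_ext {F F' : Forest n} {G : Fin n → Prop} (h : DfsInv res F G)
    (hext : F.Ext F') {w u : Fin n} (hu : F.visited u = true) : F'.Anc w u ↔ F.Anc w u := by
  constructor
  · intro hwu
    induction hwu with
    | refl => exact .refl
    | tail _ hbc ih =>
      rw [(hext _ hu).2.1] at hbc
      exact (ih (h.parent _ _ hbc).2.1).tail hbc
  · intro hwu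
    induction hwu with
    | refl => exact .refl
    | tail _ hbc ih =>
      exact (ih (h.parent _ _ hbc).2.1).tail ((hext _ hu).2.1.trans hbc)

lemma DfsInv.number_le {F : Forest n} {G : Fin n → Prop} (h : DfsInv res F G)
    {w u : Fin n} (hwu : F.Anc w u) : F.number w ≤ F.number u := by
  induction hwu with
  | refl => exact le_rfl
  | tail _ hbc ih => exact ih.trans (h.parent _ _ hbc).2.2.2.le

/-- The forest after the node `i` with predecessor `q` has been marked as visited. -/
def Forest.mark (res : Fin n → Fin n → Bool) (F : Forest n) (i : Fin n) (q : Option (Fin n)) :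
    Forest n where
  visited := Function.update F.visited i true
  number := Function.update F.number i F.clock
  parent := Function.update F.parent i q
  sbaLow := Function.update F.sbaLow i
    (match q with
      | some p => if res i p then F.sbaLow p else F.clock
      | none => F.clock)
  clock := F.clock + 1

lemma Forest.numVisited_mark {F : Forest n} {i : Fin n} {q : Option (Fin n)}
    (hi : F.visited i = false) : (F.mark res i q).numVisited = F.numVisited + 1 := by
  unfold Forest.numVisited
  have : (Finset.univ.filter fun v => (F.mark res i q).visited v = true)
      = insert i (Finset.univ.filter fun v => F.visited v = true) := by
    ext v
    rw [Finset.mem_filter, Finset.mem_insert, Finset.mem_filter]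
    by_cases hv : v = i
    · simp [Forest.mark, hv]
    · simp [Forest.mark, hv]
  rw [this, Finset.card_insert_of_notMem (by simp [hi])]

lemma Forest.ext_mark {F : Forest n} {i : Fin n} {q : Option (Fin n)}
    (hi : F.visited i = false) : F.Ext (F.mark res i q) := by
  intro v hv
  have hvi : v ≠ i := by rintro rfl; rw [hi] at hv; cases hv
  simp [Forest.mark, hvi, hv]

lemma DfsInv.anc_mark {F : Forest n} {G : Fin n → Prop} (h : DfsInv res F G) {i : Fin n}
    {q : Option (Fin n)} (hi : F.visited i = false)
    (hq : ∀ p, q = some p → F.visited p = true ∧ res p i = true)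
    (hG : ∀ w, G w ↔ ∃ p, q = some p ∧ F.Anc w p) (w : Fin n) :
    (G w ∨ w = i) ↔ (F.mark res i q).Anc w i := by
  have hext : F.Ext (F.mark res i q) := Forest.ext_mark hi
  have hpar : (F.mark res i q).parent i = q := by simp [Forest.mark]
  constructor
  · rintro (hw | rfl)
    · obtain ⟨p, rfl, hp⟩ := (hG w).1 hw
      exact ((h.anc_ext hext (hq p rfl).1).2 hp).tail hpar
    · exact .refl
  · intro hw
    rcases Relation.ReflTransGen.cases_tail hw with rfl | ⟨p, hp, hpi⟩
    · exact Or.inr rfl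
    · rw [hpar] at hpi
      exact Or.inl ((hG w).2 ⟨p, hpi, (h.anc_ext hext (hq p hpi).1).1 hp⟩)

lemma DfsInv.mark {F : Forest n} {G : Fin n → Prop} (h : DfsInv res F G) {i : Fin n}
    {q : Option (Fin n)} (hi : F.visited i = false)
    (hq : ∀ p, q = some p → F.visited p = true ∧ res p i = true)
    (hG : ∀ w, G w ↔ ∃ p, q = some p ∧ F.Anc w p) :
    DfsInv res (F.mark res i q) fun w => G w ∨ w = i := by
  have hext : F.Ext (F.mark res i q) := Forest.ext_mark hi
  have hanc := h.anc_mark hi hq hG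
  have hne : ∀ v, F.visited v = true → v ≠ i := by
    rintro v hv rfl; rw [hi] at hv; cases hv
  have hvis : ∀ v, (F.mark res i q).visited v = true ↔ v = i ∨ F.visited v = true := by
    intro v
    by_cases hv : v = i <;> simp [Forest.mark, hv]
  have hpari : (F.mark res i q).parent i = q := by simp [Forest.mark]
  have hpar : ∀ v, v ≠ i → (F.mark res i q).parent v = F.parent v := fun v hv => by
    simp [Forest.mark, hv]
  have hnumi : (F.mark res i q).number i = F.clock := by simp [Forest.mark]
  have hnum : ∀ v, F.visited v = true → (F.mark res i q).number v = F.number v := fun v hv =>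
    (hext v hv).2.2.1
  have hgrey : ∀ w, G w ∨ w = i → (F.mark res i q).visited w = true ∧
      ∀ v, (F.mark res i q).visited v = true →
        (F.mark res i q).number w ≤ (F.mark res i q).number v → (F.mark res i q).Anc w v := by
    rintro w (hw | rfl)
    · obtain ⟨hw1, hw2⟩ := h.grey w hw
      refine ⟨(hext w hw1).1, fun v hv hwv => ?_⟩
      rcases (hvis v).1 hv with rfl | hv
      · exact (hanc w).1 (Or.inl hw)
      · rw [hnum v hv, hnum w hw1] at hwv
        exact (h.anc_ext hext hv).2 (hw2 v hv hwv)
    · refine ⟨(hvis w).2 (Or.inl rfl), fun v hv hwv => ?_⟩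
      rcases (hvis v).1 hv with rfl | hv
      · exact .refl
      · rw [hnumi, hnum v hv] at hwv
        exact absurd (h.lt_clock v hv) (not_lt.2 hwv)
  refine ⟨?_, ?_, ?_, ?_, ?_, ?_, ?_, ?_, ?_, hgrey⟩
  · rw [Forest.numVisited_mark hi, ← h.clock_eq]; rfl
  · intro v hv
    change _ < F.clock + 1
    rcases (hvis v).1 hv with rfl | hv
    · rw [hnumi]; omega
    · rw [hnum v hv]; have := h.lt_clock v hv; omega
  · intro u v hu hv huv
    rcases (hvis u).1 hu with rfl | hu
    · rcases (hvis v).1 hv with rfl | hv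
      · rfl
      · rw [hnumi, hnum v hv] at huv; have := h.lt_clock v hv; omega
    · rcases (hvis v).1 hv with rfl | hv
      · rw [hnumi, hnum u ‹_›] at huv; have := h.lt_clock u ‹_›; omega
      · rw [hnum u hu, hnum v hv] at huv; exact h.inj u v hu hv huv
  · intro v p hvp
    by_cases hv : v = i
    · subst hv
      rw [hpari] at hvp
      obtain ⟨hp, hr⟩ := hq p hvp
      refine ⟨(hvis v).2 (Or.inl rfl), (hext p hp).1, hr, ?_⟩
      rw [hnumi, hnum p hp]; exact h.lt_clock p hp
    · rw [hpar v hv] at hvp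
      obtain ⟨h1, h2, h3, h4⟩ := h.parent v p hvp
      refine ⟨(hext v h1).1, (hext p h2).1, h3, ?_⟩
      rw [hnum v h1, hnum p h2]; exact h4
  · intro v p hvp
    by_cases hv : v = i
    · subst hv
      rw [hpari] at hvp
      obtain ⟨hp, -⟩ := hq p hvp
      subst hvp
      rw [(hext p hp).2.2.2, hnumi]
      simp [Forest.mark]
    · rw [hpar v hv] at hvp
      obtain ⟨h1, h2, -, -⟩ := h.parent v p hvp
      rw [(hext v h1).2.2.2, (hext p h2).2.2.2, hnum v h1]
      exact h.low_some v p hvp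
  · intro v hv hvp
    rcases (hvis v).1 hv with rfl | hv
    · rw [hpari] at hvp
      subst hvp
      simp [Forest.mark]
    · rw [hpar v (hne v hv)] at hvp
      rw [(hext v hv).2.2.2, hnum v hv]
      exact h.low_none v hv hvp
  · intro u v hu huv hv
    have hv' : ¬(v = i ∨ F.visited v = true) := fun hc => by
      rw [(hvis v).2 hc] at hv; cases hv
    rw [not_or] at hv'
    rcases (hvis u).1 hu with rfl | hu
    · exact Or.inr rfl
    · exact Or.inl (h.white u v hu huv (by simpa using hv'.2))
  · intro u v hu hv huv hlt
    rcases (hvis v).1 hv with rfl | hv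
    · rcases (hvis u).1 hu with rfl | hu
      · exact .refl
      · exact (hanc u).1 (Or.inl (h.white u v hu huv hi))
    · rcases (hvis u).1 hu with rfl | hu
      · rw [hnumi, hnum v ‹_›] at hlt; have := h.lt_clock v ‹_›; omega
      · rw [hnum u hu, hnum v hv] at hlt
        exact (h.anc_ext hext hv).2 (h.forward u v hu hv huv hlt)
  · intro w u v hu hv hwu hwv hvu
    rcases (hvis u).1 hu with rfl | hu
    · exact (hgrey w ((hanc w).2 hwu)).2 v hv hwv
    · have hwu' := (h.anc_ext hext hu).1 hwu
      have hw := h.visited_of_anc hwu' hu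
      rcases (hvis v).1 hv with rfl | hv
      · rw [hnumi, hnum u ‹_›] at hvu; have := h.lt_clock u ‹_›; omega
      · rw [hnum w hw, hnum v hv] at hwv
        rw [hnum v hv, hnum u hu] at hvu
        exact (h.anc_ext hext hv).2 (h.interval w u v hu hv hwu' hwv hvu)

lemma visit_succ_val (d : ℕ) (i : Fin n) (F : Forest n) (q : Option (Fin n)) :
    (visit res (d + 1) i { F with parent := Function.update F.parent i q }).val
      = (loop (fun (F : Forest n) (j : Fin n) => do
          if ← step (res i j && !F.visited j) then
            let F ← step { F with parent := Function.update F.parent j (some i) }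
            visit res d j F
          else
            pure F) (nodes n) (F.mark res i q)).val ∧
    (visit res (d + 1) i { F with parent := Function.update F.parent i q }).time
      = 2 + (loop (fun (F : Forest n) (j : Fin n) => do
          if ← step (res i j && !F.visited j) then
            let F ← step { F with parent := Function.update F.parent j (some i) }
            visit res d j F
          else
            pure F) (nodes n) (F.mark res i q)).time := by
  simp only [visit, val_bind, time_bind, val_step, time_step, Forest.mark, Function.update_self,
    ← add_assoc]
  constructor <;> trivial

/-- Every visit marks its node and spends `O(n)` steps outside of the recursive calls. The recursion
depth suffices because all the nodes on the recursion stack have been visited. -/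
lemma visit_spec (d : ℕ) : ∀ (F : Forest n) (G : Fin n → Prop) (i : Fin n) (q : Option (Fin n)),
    DfsInv res F G → F.visited i = false →
    (∀ p, q = some p → F.visited p = true ∧ res p i = true) →
    (∀ w, G w ↔ ∃ p, q = some p ∧ F.Anc w p) → n ≤ d + F.numVisited →
    DfsInv res (visit res d i { F with parent := Function.update F.parent i q }).val G ∧
    F.Ext (visit res d i { F with parent := Function.update F.parent i q }).val ∧
    (visit res d i { F with parent := Function.update F.parent i q }).val.visited i = true ∧
    F.numVisited
      ≤ (visit res d i { F with parent := Function.update F.parent i q }).val.numVisited ∧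
    (visit res d i { F with parent := Function.update F.parent i q }).time
      + (3 * n + 2) * F.numVisited ≤ (3 * n + 2) *
        (visit res d i { F with parent := Function.update F.parent i q }).val.numVisited := by
  induction d with
  | zero =>
    intro F G i q _ hi _ _ hd
    exfalso
    have h1 : (Finset.univ.filter fun v => F.visited v = true) ⊂ Finset.univ :=
      Finset.filter_ssubset.2 ⟨i, Finset.mem_univ _, by simp [hi]⟩
    have h2 := Finset.card_lt_card h1
    simp only [Finset.card_univ, Fintype.card_fin] at h2
    unfold Forest.numVisited at hd
    omega
  | succ d ih =>
    intro F G i q hinv hi hq hG hd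
    rw [(visit_succ_val d i F q).1, (visit_succ_val d i F q).2]
    set body : Forest n → Fin n → Timed (Forest n) := fun F j => do
      if ← step (res i j && !F.visited j) then
        let F ← step { F with parent := Function.update F.parent j (some i) }
        visit res d j F
      else
        pure F with hbody
    have hloop : ∀ (l : List (Fin n)) (F₁ : Forest n),
        DfsInv res F₁ (fun w => G w ∨ w = i) → (∀ w, (G w ∨ w = i) ↔ F₁.Anc w i) →
        F₁.visited i = true → n ≤ d + F₁.numVisited →
        DfsInv res (loop body l F₁).val (fun w => G w ∨ w = i) ∧
        F₁.Ext (loop body l F₁).val ∧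
        (∀ j ∈ l, res i j = true → (loop body l F₁).val.visited j = true) ∧
        F₁.numVisited ≤ (loop body l F₁).val.numVisited ∧
        (loop body l F₁).time + (3 * n + 2) * F₁.numVisited
          ≤ 3 * l.length + (3 * n + 2) * (loop body l F₁).val.numVisited := by
      intro l
      induction l with
      | nil =>
        intro F₁ h _ _ _
        exact ⟨h, .refl _, by simp, le_rfl, by simp⟩
      | cons j l ihl =>
        intro F₁ h hanc hvis hd'
        by_cases hj : res i j = true ∧ F₁.visited j = false
        · have hv : (body F₁ j).val
              = (visit res d j
                  { F₁ with parent := Function.update F₁.parent j (some i) }).val := by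
            simp [hbody, hj.1, hj.2]
          have ht : (body F₁ j).time
              = 2 + (visit res d j
                  { F₁ with parent := Function.update F₁.parent j (some i) }).time := by
            simp [hbody, hj.1, hj.2, ← add_assoc]
          rw [loop_cons_val, loop_cons_time, hv, ht]
          obtain ⟨a1, a2, a3, a4, a5⟩ := ih F₁ (fun w => G w ∨ w = i) j (some i) h hj.2
            (fun p hp => by cases hp; exact ⟨hvis, hj.1⟩)
            (fun w => by simp [hanc w]) hd'
          set F₂ := (visit res d j
            { F₁ with parent := Function.update F₁.parent j (some i) }).val
          obtain ⟨b1, b2, b3, b4, b5⟩ := ihl F₂ a1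
            (fun w => (hanc w).trans (h.anc_ext a2 hvis).symm) (a2 i hvis).1 (by omega)
          refine ⟨b1, a2.trans b2, fun k hk hik => ?_, a4.trans b4, ?_⟩
          · rcases List.mem_cons.1 hk with rfl | hk
            · exact (b2 _ a3).1
            · exact b3 k hk hik
          · rw [List.length_cons]; linarith
        · have hv : body F₁ j = ⟨F₁, 1⟩ := by
            have : (res i j && !F₁.visited j) = false := by
              rcases h1 : res i j <;> rcases h2 : F₁.visited j <;> simp_all
            simp only [hbody, this]
            rfl
          rw [loop_cons_val, loop_cons_time, hv]
          obtain ⟨b1, b2, b3, b4, b5⟩ := ihl F₁ h hanc hvis hd'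
          refine ⟨b1, b2, fun k hk hik => ?_, b4, ?_⟩
          · rcases List.mem_cons.1 hk with rfl | hk
            · refine (b2 k ?_).1
              by_contra hc
              exact hj ⟨hik, by simpa using hc⟩
            · exact b3 k hk hik
          · rw [List.length_cons]; dsimp only; linarith
    have hn1 : (F.mark res i q).numVisited = F.numVisited + 1 := Forest.numVisited_mark hi
    obtain ⟨c1, c2, c3, c4, c5⟩ := hloop (nodes n) (F.mark res i q) (hinv.mark hi hq hG)
      (hinv.anc_mark hi hq hG) (by simp [Forest.mark]) (by omega)
    have hext : F.Ext (loop body (nodes n) (F.mark res i q)).val :=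
      (Forest.ext_mark hi).trans c2
    refine ⟨⟨c1.clock_eq, c1.lt_clock, c1.inj, c1.parent, c1.low_some, c1.low_none, ?_,
      c1.forward, c1.interval, fun w hw => c1.grey w (Or.inl hw)⟩, hext,
      (c2 i (by simp [Forest.mark])).1, by omega, ?_⟩
    · intro u v hu huv hv
      rcases c1.white u v hu huv hv with h | rfl
      · exact h
      · rw [c3 v (List.mem_finRange v) huv] at hv; cases hv
    · rw [hn1, List.length_finRange] at c5
      linarith

lemma buildDFSForest_spec (res : Fin n → Fin n → Bool) :
    DfsInv res (buildDFSForest res).val (fun _ => False) ∧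
    (∀ v, (buildDFSForest res).val.visited v = true) ∧
    (buildDFSForest res).time ≤ 10 * n + (3 * n + 2) * n := by
  set body : Forest n → Fin n → Timed (Forest n) := fun F i => do
    if ← step (F.visited i) then
      pure F
    else
      visit res n i F with hbody
  have hloop : ∀ (l : List (Fin n)) (F : Forest n), DfsInv res F (fun _ => False) →
      DfsInv res (loop body l F).val (fun _ => False) ∧ F.Ext (loop body l F).val ∧
      (∀ j ∈ l, (loop body l F).val.visited j = true) ∧
      (loop body l F).time + (3 * n + 2) * F.numVisited
          ≤ 2 * l.length + (3 * n + 2) * (loop body l F).val.numVisited := by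
    intro l
    induction l with
    | nil => intro F h; exact ⟨h, .refl _, by simp, by simp⟩
    | cons i l ih =>
      intro F h
      by_cases hi : F.visited i = true
      · have hv : body F i = ⟨F, 1⟩ := by
          simp only [hbody, hi]; rfl
        rw [loop_cons_val, loop_cons_time, hv]
        obtain ⟨b1, b2, b3, b4⟩ := ih F h
        refine ⟨b1, b2, fun j hj => ?_, ?_⟩
        · rcases List.mem_cons.1 hj with rfl | hj
          · exact (b2 _ hi).1
          · exact b3 j hj
        · rw [List.length_cons]; dsimp only; linarith
      · have hi' : F.visited i = false := by simpa using hi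
        have hpar : F.parent i = none := by
          rcases hp : F.parent i with _ | p
          · rfl
          · exact absurd (h.parent i p hp).1 hi
        have hF : F = { F with parent := Function.update F.parent i none } := by
          rw [← hpar, Function.update_eq_self]
        have hv : (body F i).val
            = (visit res n i { F with parent := Function.update F.parent i none }).val := by
          rw [← hF]; simp [hbody, hi']
        have ht : (body F i).time
            = 1 + (visit res n i { F with parent := Function.update F.parent i none }).time := by
          rw [← hF]; simp [hbody, hi']
        rw [loop_cons_val, loop_cons_time, hv, ht]
        obtain ⟨a1, a2, a3, a4, a5⟩ := visit_spec n F (fun _ => False) i none h hi'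
          (by simp) (by simp) (by omega)
        obtain ⟨b1, b2, b3, b4⟩ := ih _ a1
        refine ⟨b1, a2.trans b2, fun j hj => ?_, ?_⟩
        · rcases List.mem_cons.1 hj with rfl | hj
          · exact (b2 _ a3).1
          · exact b3 j hj
        · rw [List.length_cons]; linarith
  set F₀ : Forest n := ⟨fun _ => false, fun _ => 0, fun _ => none, fun _ => 0, 0⟩ with hF₀
  have hval : (buildDFSForest res).val = (loop body (nodes n) F₀).val := rfl
  have htime : (buildDFSForest res).time = (fill fun _ : Fin n => step false).time
      + ((fill fun _ : Fin n => step 0).time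
      + ((fill fun _ : Fin n => step (none : Option (Fin n))).time
      + ((fill fun _ : Fin n => step 0).time + (loop body (nodes n) F₀).time))) := rfl
  have h0 : DfsInv res F₀ (fun _ => False) := by
    constructor <;> simp [F₀, Forest.numVisited]
  obtain ⟨c1, c2, c3, c4⟩ := hloop (nodes n) F₀ h0
  rw [hval, htime]
  refine ⟨c1, fun v => c3 v (List.mem_finRange v), ?_⟩
  have hnv : (loop body (nodes n) F₀).val.numVisited ≤ n := by
    unfold Forest.numVisited
    exact (Finset.card_filter_le _ _).trans (by simp)
  have hmul : (3 * n + 2) * (loop body (nodes n) F₀).val.numVisited ≤ (3 * n + 2) * n :=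
    Nat.mul_le_mul_left _ hnv
  have f1 := time_fill_le (n := n) (g := fun _ => step false) (T := 1) fun _ => le_rfl
  have f2 := time_fill_le (n := n) (g := fun _ => step 0) (T := 1) fun _ => le_rfl
  have f3 := time_fill_le (n := n) (g := fun _ => step (none : Option (Fin n))) (T := 1)
    fun _ => le_rfl
  rw [List.length_finRange] at c4
  have : F₀.numVisited = 0 := by simp [F₀, Forest.numVisited]
  rw [this] at c4
  omega

end DFS

/-! ### Depth-first search: proper cycles -/

/-- The arcs of `C` form vertex-disjoint cycles of the graph `R`, and for one of them the opposite
arc is missing in `C`. Augmentation along `C` is possible and changes the flow. -/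
structure IsCycleSet {n : ℕ} (R : Fin n → Fin n → Prop) (C : List (Fin n × Fin n)) : Prop where
  arcs : ∀ a ∈ C, R a.1 a.2
  nodup : (C.map Prod.fst).Nodup
  net : ∀ v, netOut C v = 0
  proper : ∃ a ∈ C, (a.2, a.1) ∉ C

lemma netOut_append {n : ℕ} (l l' : List (Fin n × Fin n)) (v : Fin n) :
    netOut (l ++ l') v = netOut l v + netOut l' v := by
  simp [netOut]

lemma time_bind_le {α β : Type} {x : Timed α} {g : α → Timed β} {a b : ℕ} (hx : x.time ≤ a)
    (hg : (g x.val).time ≤ b) : (x >>= g).time ≤ a + b := by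
  rw [time_bind]; omega

section Cycles
variable {n : ℕ} {res : Fin n → Fin n → Bool} {F : Forest n}

lemma Forest.Anc.of_parent {p x : Fin n} (h : F.parent x = some p) : F.Anc p x :=
  Relation.ReflTransGen.single h

lemma Forest.Anc.cases {w x : Fin n} (h : F.Anc w x) :
    w = x ∨ ∃ p, F.parent x = some p ∧ F.Anc w p := by
  rcases Relation.ReflTransGen.cases_tail h with h | ⟨p, hp, hpx⟩
  · exact Or.inl h.symm
  · exact Or.inr ⟨p, hpx, hp⟩

section Final
variable (h : DfsInv res F fun _ => False) (hvis : ∀ v, F.visited v = true)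
include h hvis

lemma number_lt (v : Fin n) : F.number v < n := by
  have h1 := h.lt_clock v (hvis v)
  rw [h.clock_eq] at h1
  refine h1.trans_le ?_
  unfold Forest.numVisited
  exact (Finset.card_filter_le _ _).trans (by simp)

lemma anc_antisymm {u v : Fin n} (huv : F.Anc u v) (hvu : F.Anc v u) : u = v :=
  h.inj u v (hvis u) (hvis v) (le_antisymm (h.number_le huv) (h.number_le hvu))

lemma number_lt_of_anc {u v : Fin n} (huv : F.Anc u v) (hne : u ≠ v) :
    F.number u < F.number v :=
  lt_of_le_of_ne (h.number_le huv) fun heq => hne (h.inj u v (hvis u) (hvis v) heq)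

lemma lowestCommonAncestor_spec (d : ℕ) : ∀ x y : Fin n, F.number x + F.number y < d →
    (∀ r, (lowestCommonAncestor F d x y).val = some r →
      F.Anc r x ∧ F.Anc r y ∧ ∀ z, F.Anc z x → F.Anc z y → F.Anc z r) ∧
    ((lowestCommonAncestor F d x y).val = none → ∀ z, F.Anc z x → ¬F.Anc z y) := by
  induction d with
  | zero => intro x y hd; omega
  | succ d ih =>
    intro x y hd
    simp only [lowestCommonAncestor, val_bind, val_step]
    by_cases hxy : x = y
    · subst hxy
      simp only [decide_true, if_true, val_pure, Option.some.injEq, reduceCtorEq, false_imp_iff,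
        and_true]
      rintro r rfl
      exact ⟨.refl, .refl, fun z hz _ => hz⟩
    · simp only [hxy, decide_false, Bool.false_eq_true, if_false, val_bind, val_step]
      by_cases hlt : F.number y < F.number x
      · simp only [hlt, decide_true, if_true, val_bind, val_step]
        have hxy' : ¬F.Anc x y := fun hc => by have := h.number_le hc; omega
        rcases hp : F.parent x with _ | p
        · simp only [val_pure, reduceCtorEq, false_imp_iff, implies_true, true_and]
          intro _ z hz hzy
          rcases hz.cases with rfl | ⟨p, hp', -⟩
          · exact hxy' hzy
          · rw [hp] at hp'; cases hp'
        · simp only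
          have hpl := (h.parent x p hp).2.2.2
          obtain ⟨h1, h2⟩ := ih p y (by omega)
          have hcases : ∀ z, F.Anc z x → F.Anc z y → F.Anc z p := by
            intro z hz hzy
            rcases hz.cases with rfl | ⟨p', hp', hz'⟩
            · exact absurd hzy hxy'
            · rw [hp] at hp'; cases hp'; exact hz'
          refine ⟨fun r hr => ?_, fun hr z hz hzy => h2 hr z (hcases z hz hzy) hzy⟩
          obtain ⟨a1, a2, a3⟩ := h1 r hr
          exact ⟨a1.tail hp, a2, fun z hz hzy => a3 z (hcases z hz hzy) hzy⟩
      · simp only [hlt, decide_false, Bool.false_eq_true, if_false, val_bind, val_step]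
        have hyx' : ¬F.Anc y x := fun hc =>
          hlt (number_lt_of_anc h hvis hc fun e => hxy e.symm)
        rcases hp : F.parent y with _ | p
        · simp only [val_pure, reduceCtorEq, false_imp_iff, implies_true, true_and]
          intro _ z hzx hz
          rcases hz.cases with rfl | ⟨p, hp', -⟩
          · exact hyx' hzx
          · rw [hp] at hp'; cases hp'
        · simp only
          have hpl := (h.parent y p hp).2.2.2
          obtain ⟨h1, h2⟩ := ih x p (by omega)
          have hcases : ∀ z, F.Anc z x → F.Anc z y → F.Anc z p := by
            intro z hzx hz
            rcases hz.cases with rfl | ⟨p', hp', hz'⟩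
            · exact absurd hzx hyx'
            · rw [hp] at hp'; cases hp'; exact hz'
          refine ⟨fun r hr => ?_, fun hr z hzx hz => h2 hr z hzx (hcases z hzx hz)⟩
          obtain ⟨a1, a2, a3⟩ := h1 r hr
          exact ⟨a1, a2.tail hp, fun z hzx hz => a3 z hzx (hcases z hzx hz)⟩

omit h hvis in
lemma time_lowestCommonAncestor_le (d : ℕ) : ∀ x y : Fin n,
    (lowestCommonAncestor F d x y).time ≤ 3 * d := by
  induction d with
  | zero => intro x y; simp [lowestCommonAncestor]
  | succ d ih =>
    intro x y
    simp only [lowestCommonAncestor, time_bind, val_step, time_step, decide_eq_true_eq]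
    split_ifs
    · simp; omega
    · simp only [time_bind, time_step, val_step, decide_eq_true_eq]
      split_ifs
      · simp only [time_bind, time_step, val_step]
        split
        · have := ih ‹_› y; omega
        · simp
      · simp only [time_bind, time_step, val_step]
        split
        · have := ih x ‹_›; omega
        · simp

omit hvis in
lemma treePath_spec (top : Fin n) (d : ℕ) : ∀ (x : Fin n) (acc : List (Fin n × Fin n)),
    F.Anc top x → F.number x < d + F.number top →
    ∃ P, (treePath F top d x acc).val = P ++ acc ∧
      (∀ a ∈ P, F.parent a.2 = some a.1) ∧ (P.map Prod.fst).Nodup ∧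
      (∀ v ∈ P.map Prod.fst, F.Anc top v ∧ F.Anc v x ∧ v ≠ x) ∧
      ∀ v, netOut P v = (if v = top then (1 : ℤ) else 0) - if v = x then 1 else 0 := by
  induction d with
  | zero => intro x acc hx hd; have := h.number_le hx; omega
  | succ d ih =>
    intro x acc hx hd
    simp only [treePath, val_bind, val_step]
    by_cases hxt : x = top
    · subst hxt
      exact ⟨[], by simp⟩
    · rcases hx.cases with rfl | ⟨p, hp, htp⟩
      · exact absurd rfl hxt
      · simp only [hxt, decide_false, Bool.false_eq_true, if_false, hp, val_bind, val_step]
        have hpl := (h.parent x p hp).2.2.2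
        obtain ⟨P, h1, h2, h3, h4, h5⟩ := ih p ((p, x) :: acc) htp (by omega)
        refine ⟨P ++ [(p, x)], by simp [h1], ?_, ?_, ?_, ?_⟩
        · intro a ha
          rcases List.mem_append.1 ha with ha | ha
          · exact h2 a ha
          · rw [List.mem_singleton.1 ha]; exact hp
        · rw [List.map_append, List.nodup_append]
          refine ⟨h3, by simp, ?_⟩
          intro v hv u hu
          rw [show u = p by simpa using hu]
          exact (h4 v hv).2.2
        · intro v hv
          rw [List.map_append, List.mem_append] at hv
          have hvp : F.Anc top v ∧ F.Anc v p := by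
            rcases hv with hv | hv
            · exact ⟨(h4 v hv).1, (h4 v hv).2.1⟩
            · rw [show v = p by simpa using hv]; exact ⟨htp, .refl⟩
          refine ⟨hvp.1, hvp.2.tail hp, ?_⟩
          rintro rfl
          have := h.number_le hvp.2
          omega
        · intro v
          rw [netOut_append, h5, netOut_cons, netOut_nil]
          ring

omit h hvis in
lemma time_treePath_le (top : Fin n) (d : ℕ) : ∀ (x : Fin n) (acc : List (Fin n × Fin n)),
    (treePath F top d x acc).time ≤ 3 * d := by
  induction d with
  | zero => intro x acc; simp [treePath]
  | succ d ih =>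
    intro x acc
    simp only [treePath, time_bind, val_step, time_step, decide_eq_true_eq]
    split_ifs
    · simp; omega
    · simp only [time_bind, time_step, val_step]
      split
      · simp only [time_bind, time_step, val_step]
        have := ih ‹_› ((‹_›, x) :: acc); omega
      · simp; omega

omit hvis in
/-- A node whose value `sbaLow` is at most the number of its proper ancestor `top` is the start
of a short backward arc, and so are the nodes between them. -/
lemma sbaLow_step {top x p : Fin n} (hp : F.parent x = some p) (htp : F.Anc top p)
    (hlow : F.sbaLow x ≤ F.number top) : res x p = true ∧ F.sbaLow p ≤ F.number top := by
  have h1 := h.low_some x p hp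
  have h2 := (h.parent x p hp).2.2.2
  have h3 := h.number_le htp
  split_ifs at h1 with hr
  · exact ⟨hr, by omega⟩
  · omega

lemma sbaLow_le_number (x : Fin n) : F.sbaLow x ≤ F.number x := by
  induction hk : F.number x using Nat.strong_induction_on generalizing x with
  | _ k ih =>
    subst hk
    rcases hp : F.parent x with _ | p
    · exact (h.low_none x (hvis x) hp).le
    · have h1 := h.low_some x p hp
      have h2 := (h.parent x p hp).2.2.2
      split_ifs at h1
      · have := ih _ h2 p rfl; omega
      · omega

omit hvis in
lemma shortBackwardPath_spec (top : Fin n) (d : ℕ) : ∀ (x : Fin n) (acc : List (Fin n × Fin n)),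
    F.Anc top x → F.sbaLow x ≤ F.number top → F.number x < d + F.number top →
    ∃ P, (shortBackwardPath F top d x acc).val = P ++ acc ∧
      (∀ a ∈ P, F.parent a.1 = some a.2 ∧ res a.1 a.2 = true) ∧ (P.map Prod.fst).Nodup ∧
      (∀ v ∈ P.map Prod.fst, F.Anc top v ∧ F.Anc v x ∧ v ≠ top) ∧
      ∀ v, netOut P v = (if v = x then (1 : ℤ) else 0) - if v = top then 1 else 0 := by
  induction d with
  | zero => intro x acc hx _ hd; have := h.number_le hx; omega
  | succ d ih =>
    intro x acc hx hlow hd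
    simp only [shortBackwardPath, val_bind, val_step]
    by_cases hxt : x = top
    · subst hxt
      exact ⟨[], by simp⟩
    · rcases hx.cases with rfl | ⟨p, hp, htp⟩
      · exact absurd rfl hxt
      · simp only [hxt, decide_false, Bool.false_eq_true, if_false, hp, val_bind, val_step]
        have hpl := (h.parent x p hp).2.2.2
        obtain ⟨hres, hlow'⟩ := sbaLow_step h hp htp hlow
        obtain ⟨P, h1, h2, h3, h4, h5⟩ := ih p ((x, p) :: acc) htp hlow' (by omega)
        refine ⟨P ++ [(x, p)], by simp [h1], ?_, ?_, ?_, ?_⟩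
        · intro a ha
          rcases List.mem_append.1 ha with ha | ha
          · exact h2 a ha
          · rw [List.mem_singleton.1 ha]; exact ⟨hp, hres⟩
        · rw [List.map_append, List.nodup_append]
          refine ⟨h3, by simp, ?_⟩
          intro v hv u hu
          rw [show u = x by simpa using hu]
          rintro rfl
          have := h.number_le (h4 v hv).2.1
          omega
        · intro v hv
          rw [List.map_append, List.mem_append] at hv
          rcases hv with hv | hv
          · exact ⟨(h4 v hv).1, (h4 v hv).2.1.tail hp, (h4 v hv).2.2⟩
          · rw [show v = x by simpa using hv]; exact ⟨hx, .refl, hxt⟩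
        · intro v
          rw [netOut_append, h5, netOut_cons, netOut_nil]
          ring

omit h hvis in
lemma time_shortBackwardPath_le (top : Fin n) (d : ℕ) :
    ∀ (x : Fin n) (acc : List (Fin n × Fin n)),
      (shortBackwardPath F top d x acc).time ≤ 3 * d := by
  induction d with
  | zero => intro x acc; simp [shortBackwardPath]
  | succ d ih =>
    intro x acc
    simp only [shortBackwardPath, time_bind, val_step, time_step, decide_eq_true_eq]
    split_ifs
    · simp; omega
    · simp only [time_bind, time_step, val_step]
      split
      · simp only [time_bind, time_step, val_step]
        have := ih ‹_› ((x, ‹_›) :: acc); omega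
      · simp; omega

omit h hvis in
lemma preprocess_val (i j : Fin n) : (preprocess res F).val i j =
    if res i j = false then .noArc
    else if F.parent j = some i then .tree
    else if F.number i < F.number j then .forward
    else if (lowestCommonAncestor F (2 * n) i j).val = some j then .backward
    else .cross (lowestCommonAncestor F (2 * n) i j).val := by
  simp only [preprocess, val_fill₂, val_bind, val_step]
  by_cases h1 : res i j = false
  · simp [h1]
  · by_cases h2 : F.parent j = some i
    · simp [h1, h2]
    · by_cases h3 : F.number i < F.number j
      · simp [h1, h2, h3]
      · simp [h1, h2, h3]

omit h hvis in
lemma time_preprocess_le : (preprocess res F).time ≤ n * (n * (6 * n + 5) + 1) := by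
  refine time_fill₂_le (T := 6 * n + 4) fun i j => ?_
  have hlca := time_lowestCommonAncestor_le (F := F) (2 * n) i j
  simp only [time_bind, val_step, time_step]
  by_cases h1 : res i j = false
  · simp [h1]
  by_cases h2 : F.parent j = some i
  · simp [h1, h2]
  by_cases h3 : F.number i < F.number j
  · simp [h1, h2, h3]
  · simp [h1, h2, h3]; omega

lemma lca_spec (i j : Fin n) :
    (∀ r, (lowestCommonAncestor F (2 * n) i j).val = some r →
      F.Anc r i ∧ F.Anc r j ∧ ∀ z, F.Anc z i → F.Anc z j → F.Anc z r) ∧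
    ((lowestCommonAncestor F (2 * n) i j).val = none → ∀ z, F.Anc z i → ¬F.Anc z j) :=
  lowestCommonAncestor_spec h hvis (2 * n) i j (by
    have := number_lt h hvis i
    have := number_lt h hvis j
    omega)

variable (hloop : ∀ i, res i i = false)
include hloop

lemma backwardCycle_spec {i j : Fin n} (hk : (preprocess res F).val i j = .backward)
    (hp : F.parent i ≠ some j) :
    IsCycleSet (fun i j => res i j = true) (treePath F j n i [(i, j)]).val := by
  rw [preprocess_val] at hk
  split_ifs at hk with h1 h2 h3 h4
  have hij : res i j = true := by simpa using h1
  obtain ⟨hji, -, -⟩ := (lca_spec h hvis i j).1 j h4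
  have hni := number_lt h hvis i
  obtain ⟨P, p1, p2, p3, p4, p5⟩ := treePath_spec h j n i [(i, j)] hji (by omega)
  rw [p1]
  refine ⟨?_, ?_, ?_, (i, j), by simp, ?_⟩
  · intro a ha
    rcases List.mem_append.1 ha with ha | ha
    · exact (h.parent _ _ (p2 a ha)).2.2.1
    · rw [List.mem_singleton.1 ha]; exact hij
  · rw [List.map_append, List.nodup_append]
    refine ⟨p3, by simp, fun v hv u hu => ?_⟩
    rw [show u = i by simpa using hu]
    exact (p4 v hv).2.2
  · intro v
    rw [netOut_append, p5, netOut_cons, netOut_nil]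
    ring
  · intro ha
    rcases List.mem_append.1 ha with ha | ha
    · exact hp (p2 _ ha)
    · have : j = i := by simpa using congrArg Prod.fst (List.mem_singleton.1 ha)
      rw [this, hloop] at hij; cases hij

lemma forwardCycle_spec {i j : Fin n} (hk : (preprocess res F).val i j = .forward)
    (hlow : F.sbaLow j ≤ F.number i) :
    IsCycleSet (fun i j => res i j = true) (shortBackwardPath F i n j [(i, j)]).val := by
  rw [preprocess_val] at hk
  split_ifs at hk with h1 h2 h3 h4
  have hij : res i j = true := by simpa using h1
  have hanc := h.forward i j (hvis i) (hvis j) hij h3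
  have hnj := number_lt h hvis j
  obtain ⟨P, p1, p2, p3, p4, p5⟩ :=
    shortBackwardPath_spec h i n j [(i, j)] hanc hlow (by omega)
  rw [p1]
  refine ⟨?_, ?_, ?_, (i, j), by simp, ?_⟩
  · intro a ha
    rcases List.mem_append.1 ha with ha | ha
    · exact (p2 a ha).2
    · rw [List.mem_singleton.1 ha]; exact hij
  · rw [List.map_append, List.nodup_append]
    refine ⟨p3, by simp, fun v hv u hu => ?_⟩
    rw [show u = i by simpa using hu]
    exact (p4 v hv).2.2
  · intro v
    rw [netOut_append, p5, netOut_cons, netOut_nil]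
    ring
  · intro ha
    rcases List.mem_append.1 ha with ha | ha
    · exact h2 (p2 _ ha).1
    · have : j = i := by simpa using congrArg Prod.fst (List.mem_singleton.1 ha)
      rw [this, hloop] at hij; cases hij

lemma crossCycle_spec {i j r : Fin n} (hk : (preprocess res F).val i j = .cross (some r))
    (hlow : F.sbaLow j ≤ F.number r) :
    IsCycleSet (fun i j => res i j = true)
      (treePath F r n i (shortBackwardPath F r n j [(i, j)]).val).val := by
  rw [preprocess_val] at hk
  split_ifs at hk with h1 h2 h3 h4
  simp only [ArcKind.cross.injEq] at hk
  rw [hk] at h4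
  have hij : res i j = true := by simpa using h1
  have hne : i ≠ j := by rintro rfl; rw [hloop] at hij; cases hij
  obtain ⟨hri, hrj, hlca⟩ := (lca_spec h hvis i j).1 r hk
  have hni := number_lt h hvis i
  have hnj := number_lt h hvis j
  obtain ⟨P, p1, p2, p3, p4, p5⟩ :=
    shortBackwardPath_spec h r n j [(i, j)] hrj hlow (by omega)
  obtain ⟨T, t1, t2, t3, t4, t5⟩ :=
    treePath_spec h r n i (P ++ [(i, j)]) hri (by omega)
  rw [p1, t1]
  refine ⟨?_, ?_, ?_, (i, j), by simp, ?_⟩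
  · intro a ha
    rcases List.mem_append.1 ha with ha | ha
    · exact (h.parent _ _ (t2 a ha)).2.2.1
    rcases List.mem_append.1 ha with ha | ha
    · exact (p2 a ha).2
    · rw [List.mem_singleton.1 ha]; exact hij
  · rw [List.map_append, List.nodup_append, List.map_append, List.nodup_append]
    refine ⟨t3, ⟨p3, by simp, fun v hv u hu => ?_⟩, fun v hv u hu => ?_⟩
    · rw [show u = i by simpa using hu]
      rintro rfl
      exact h3 (number_lt_of_anc h hvis (p4 v hv).2.1 hne)
    · rintro rfl
      rcases List.mem_append.1 hu with hu | hu
      · exact (p4 v hu).2.2 (anc_antisymm h hvis (hlca v (t4 v hv).2.1 (p4 v hu).2.1)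
          (p4 v hu).1)
      · exact (t4 v hv).2.2 (by simpa using hu)
  · intro v
    rw [netOut_append, netOut_append, p5, t5, netOut_cons, netOut_nil]
    ring
  · intro ha
    rcases List.mem_append.1 ha with ha | ha
    · exact h4 (congrArg some
        (anc_antisymm h hvis hrj (hlca j (Forest.Anc.of_parent (t2 _ ha)) .refl)))
    rcases List.mem_append.1 ha with ha | ha
    · exact h2 (p2 _ ha).1
    · exact hne (by simpa using (congrArg Prod.fst (List.mem_singleton.1 ha)).symm)

omit h hvis hloop in
lemma exists_exit {E : Fin n → Fin n → Prop} {P : Fin n → Prop} {x y : Fin n}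
    (hxy : Relation.ReflTransGen E x y) (hx : P x) (hy : ¬P y) :
    ∃ u v, Relation.ReflTransGen E x u ∧ E u v ∧ P u ∧ ¬P v := by
  induction hxy with
  | refl => exact absurd hx hy
  | @tail b c hab hbc ih =>
    by_cases hb : P b
    · exact ⟨b, c, hab, hbc, hb, hy⟩
    · exact ih hb

/-- If none of the three searches is successful, then the graph contains no proper cycle. The
cycles are given here by a set `E` of arcs that contains no two opposite arcs and in which every
arc lies on a closed walk. Let `r` be the node of the smallest DFS number. By induction on the DFS
numbers, every node on `E` has a path of short backward arcs to `r`: when `E` leaves the subtree of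
a node `w`, it does so by the arc from `w` to its predecessor, or by a cross arc, which would
complete a cross cycle. Now `E` leaves `r` by a tree arc to some `a`; it leaves the subtree of `a`
again, neither by `(a, r)` nor by a cross arc. -/
lemma no_proper_cycle
    (hB : ∀ i j, (preprocess res F).val i j = .backward → F.parent i = some j)
    (hF : ∀ i j, (preprocess res F).val i j = .forward → F.number i < F.sbaLow j)
    (hC : ∀ i j r, (preprocess res F).val i j = .cross (some r) → F.number r < F.sbaLow j)
    {E : Fin n → Fin n → Prop} (hE : ∀ i j, E i j → res i j = true)
    (hanti : ∀ i j, E i j → ¬E j i) (hback : ∀ i j, E i j → Relation.ReflTransGen E j i)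
    (i j : Fin n) : ¬E i j := by
  classical
  intro hij
  have hne : ∀ u v, res u v = true → u ≠ v := by
    rintro u v huv rfl; rw [hloop] at huv; cases huv
  have hF' : ∀ u v, res u v = true → F.number u < F.number v → F.parent v ≠ some u →
      F.number u < F.sbaLow v := by
    intro u v huv hlt hp
    refine hF u v ?_
    rw [preprocess_val]
    simp [huv, hp, hlt]
  have hback' : ∀ u v, res u v = true → F.number v < F.number u →
      (F.Anc v u ∧ F.parent u = some v) ∨
      ∀ r, F.Anc r u → F.Anc r v → F.number r < F.sbaLow v := by
    intro u v huv hlt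
    have hp : F.parent v ≠ some u := fun hp => by
      have := (h.parent v u hp).2.2.2
      omega
    have hk : (preprocess res F).val u v =
      if (lowestCommonAncestor F (2 * n) u v).val = some v then .backward
      else .cross (lowestCommonAncestor F (2 * n) u v).val := by
      rw [preprocess_val]
      simp [huv, hp, not_lt.2 hlt.le]
    have hl := lca_spec h hvis u v
    by_cases hlv : (lowestCommonAncestor F (2 * n) u v).val = some v
    · rw [if_pos hlv] at hk
      exact Or.inl ⟨(hl.1 v hlv).1, hB u v hk⟩
    · rw [if_neg hlv] at hk
      refine Or.inr fun r hru hrv => ?_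
      rcases hq : (lowestCommonAncestor F (2 * n) u v).val with _ | q
      · exact absurd hrv (hl.2 hq r hru)
      · rw [hq] at hk
        exact (h.number_le ((hl.1 q hq).2.2 r hru hrv)).trans_lt (hC u v q hk)
  -- the node of the smallest number on `E`
  obtain ⟨r, hr, hmin⟩ : ∃ r, (∃ b, E r b) ∧ ∀ v, (∃ b, E v b) → F.number r ≤ F.number v := by
    obtain ⟨r, hr, hmin⟩ := Finset.exists_min_image
      (Finset.univ.filter fun v => ∃ b, E v b) F.number ⟨i, by simpa using ⟨j, hij⟩⟩
    exact ⟨r, by simpa using hr, fun v hv => hmin v (by simpa using hv)⟩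
  have hret : ∀ v, Relation.ReflTransGen E r v → Relation.ReflTransGen E v r := by
    intro v hv
    induction hv with
    | refl => exact .refl
    | tail _ hbc ih => exact (hback _ _ hbc).trans ih
  have hnum : ∀ v, Relation.ReflTransGen E r v → F.number r ≤ F.number v := by
    intro v hv
    rcases Relation.ReflTransGen.cases_head (hret v hv) with rfl | ⟨b, hb, -⟩
    · exact le_rfl
    · exact hmin v ⟨b, hb⟩
  have hanc : ∀ v, Relation.ReflTransGen E r v → F.Anc r v := by
    intro v hv
    induction hv with
    | refl => exact .refl
    | @tail b c hb hbc ih =>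
      rcases le_or_gt (F.number c) (F.number b) with hle | hlt
      · exact h.interval r b c (hvis b) (hvis c) ih (hnum c (hb.tail hbc)) hle
      · exact ih.trans (h.forward b c (hvis b) (hvis c) (hE b c hbc) hlt)
  -- leaving the subtree of `w`
  have hexit : ∀ w, Relation.ReflTransGen E r w → w ≠ r → ∃ v,
      Relation.ReflTransGen E r v ∧ F.number v < F.number w ∧
      ((E w v ∧ F.parent w = some v) ∨ F.number r < F.sbaLow v) := by
    intro w hw hwr
    obtain ⟨u, v, hwu, huv, hau, hav⟩ := exists_exit (P := fun x => F.Anc w x) (hret w hw)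
      .refl fun hc => hwr (anc_antisymm h hvis hc (hanc w hw))
    have hru := hw.trans hwu
    have hrv := hru.tail huv
    have hres := hE u v huv
    have hlt : F.number v < F.number u := by
      rcases lt_trichotomy (F.number v) (F.number u) with hlt | heq | hgt
      · exact hlt
      · exact absurd (h.inj v u (hvis v) (hvis u) heq).symm (hne u v hres)
      · exact absurd (hau.trans (h.forward u v (hvis u) (hvis v) hres hgt)) hav
    have hlw : F.number v < F.number w := by
      by_contra hc
      exact hav (h.interval w u v (hvis u) (hvis v) hau (not_lt.1 hc) hlt.le)
    refine ⟨v, hrv, hlw, ?_⟩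
    rcases hback' u v hres hlt with ⟨-, hp⟩ | hcross
    · rcases hau.cases with rfl | ⟨p, hp', hwp⟩
      · exact Or.inl ⟨huv, hp⟩
      · rw [hp] at hp'; cases hp'; exact absurd hwp hav
    · exact Or.inr (hcross r (hanc u hru) (hanc v hrv))
  have hlow : ∀ k, ∀ w, F.number w = k → Relation.ReflTransGen E r w →
      F.sbaLow w ≤ F.number r := by
    intro k
    induction k using Nat.strong_induction_on with
    | _ k ih =>
      rintro w rfl hw
      by_cases hwr : w = r
      · subst hwr; exact sbaLow_le_number h hvis w
      obtain ⟨v, hrv, hvw, ⟨hE', hp⟩ | hc⟩ := hexit w hw hwr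
      · have hv := ih _ hvw v rfl hrv
        have := h.low_some w v hp
        rw [if_pos (hE w v hE')] at this
        omega
      · have hv := ih _ hvw v rfl hrv
        omega
  obtain ⟨a, hra⟩ := hr
  have hRa : Relation.ReflTransGen E r a := .single hra
  have hrane := hne r a (hE r a hra)
  have hpa : F.parent a = some r := by
    by_contra hp
    have h1 := hF' r a (hE r a hra) (number_lt_of_anc h hvis (hanc a hRa) hrane) hp
    have h2 := hlow _ a rfl hRa
    omega
  obtain ⟨v, hrv, -, ⟨hE', hp⟩ | hc⟩ := hexit a hRa hrane.symm
  · rw [hpa] at hp; cases hp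
    exact hanti r a hra hE'
  · have h2 := hlow _ v rfl hrv
    omega

end Final

end Cycles

/-! ### Another feasible flow -/

section Feasible
variable {n : ℕ} {N : Network n} {f : Flow n}

lemma IsCycleSet.nodup_arcs {R : Fin n → Fin n → Prop} {C : List (Fin n × Fin n)}
    (hC : IsCycleSet R C) : C.Nodup := hC.nodup.of_map _

lemma IsCycleSet.augment_val (hN : N.Valid) {C : List (Fin n × Fin n)}
    (hC : IsCycleSet (N.Res f) C) : (augment N f C).val = N.augFlow f C :=
  KBestFlow.augment_val hN f fun a ha => (hC.arcs a ha).arc_or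

lemma Network.Valid.not_res_self (hN : N.Valid) (i : Fin n) :
    (residualGraph N f).val i i = false := by
  have : N.arc i i = false := by
    by_contra h
    have h : N.arc i i = true := by simpa using h
    have := hN.1 i i h
    rw [h] at this; cases this
  simp [residualGraph, this]

lemma findAnotherFeasibleFlow_some (hN : N.Valid) {g : Flow n}
    (hg : (findAnotherFeasibleFlow N f).val = some g) :
    ∃ C, IsCycleSet (N.Res f) C ∧ g = N.augFlow f C := by
  obtain ⟨hinv, hvis, -⟩ := buildDFSForest_spec (residualGraph N f).val
  have hloop := hN.not_res_self (f := f)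
  have hconv : ∀ C, IsCycleSet (fun i j => (residualGraph N f).val i j = true) C →
      some (augment N f C).val = some g → ∃ C, IsCycleSet (N.Res f) C ∧ g = N.augFlow f C := by
    intro C hC hCg
    have hC' : IsCycleSet (N.Res f) C :=
      ⟨fun a ha => residualGraph_val.1 (hC.arcs a ha), hC.nodup, hC.net, hC.proper⟩
    rw [hC'.augment_val hN] at hCg
    exact ⟨C, hC', (Option.some.inj hCg).symm⟩
  simp only [findAnotherFeasibleFlow, val_bind] at hg
  split at hg
  · rename_i C hC
    refine hconv C ?_ hg
    obtain ⟨a, -, ha⟩ := firstSome_eq_some hC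
    simp only [val_bind, val_step] at ha
    split at ha
    · rename_i hk
      by_cases hp : ((buildDFSForest (residualGraph N f).val).val).parent a.1 = some a.2
      · simp [hp] at ha
      · simp only [val_bind, val_step, ne_eq, hp, not_false_eq_true, decide_true, if_true,
          val_pure, Option.some.injEq] at ha
        rw [← ha]
        exact backwardCycle_spec hinv hvis hloop hk hp
    · simp at ha
  simp only [val_bind] at hg
  split at hg
  · rename_i C hC
    refine hconv C ?_ hg
    obtain ⟨a, -, ha⟩ := firstSome_eq_some hC
    simp only [val_bind, val_step] at ha
    split at ha
    · rename_i hk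
      simp only [val_bind, val_step, decide_eq_true_eq] at ha
      split_ifs at ha with hp
      · simp only [val_bind, val_pure, Option.some.injEq] at ha
        rw [← ha]
        exact forwardCycle_spec hinv hvis hloop hk hp
    · simp at ha
  simp only [val_bind] at hg
  split at hg
  · rename_i C hC
    refine hconv C ?_ hg
    obtain ⟨a, -, ha⟩ := firstSome_eq_some hC
    simp only [val_bind, val_step] at ha
    split at ha
    · rename_i r hk
      simp only [val_bind, val_step, decide_eq_true_eq] at ha
      split_ifs at ha with hp
      · simp only [val_bind, val_pure, Option.some.injEq] at ha
        rw [← ha]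
        exact crossCycle_spec hinv hvis hloop hk hp
    · simp at ha
  · simp at hg

lemma findAnotherFeasibleFlow_none (hN : N.Valid) (hf : N.IsFeasible f)
    (hg : (findAnotherFeasibleFlow N f).val = none) {h : Flow n} (hh : N.IsFeasible h) :
    h = f := by
  obtain ⟨hinv, hvis, -⟩ := buildDFSForest_spec (residualGraph N f).val
  have hloop := hN.not_res_self (f := f)
  simp only [findAnotherFeasibleFlow, val_bind] at hg
  split at hg
  · simp at hg
  rename_i h1
  simp only [val_bind] at hg
  split at hg
  · simp at hg
  rename_i h2
  simp only [val_bind] at hg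
  split at hg
  · simp at hg
  rename_i h3
  have hx := hh.sub hf
  have hno := no_proper_cycle hinv hvis hloop
    (fun i j hk => by
      have := firstSome_eq_none h1 (i, j) (mem_pairs _)
      simp only [val_bind, val_step, hk, decide_eq_true_eq, ne_eq] at this
      by_contra hp
      simp [hp] at this)
    (fun i j hk => by
      have := firstSome_eq_none h2 (i, j) (mem_pairs _)
      simp only [val_bind, val_step, hk, decide_eq_true_eq] at this
      by_contra hp
      simp [not_lt.1 hp] at this)
    (fun i j r hk => by
      have := firstSome_eq_none h3 (i, j) (mem_pairs _)
      simp only [val_bind, val_step, hk, decide_eq_true_eq] at this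
      by_contra hp
      simp [not_lt.1 hp] at this)
    (E := fun i j => 0 < (h i j - f i j) - (h j i - f j i))
    (fun i j hij => residualGraph_val.2 (res_of_pos hf hh hij))
    (fun i j hij hji => by omega)
    (fun i j hij => hx.reach_back hij)
  funext i j
  by_contra hne
  rcases hx.exists_pos hN (i := i) (j := j) (sub_ne_zero.2 hne) with hpos | hpos
  · exact hno i j hpos
  · exact hno j i hpos

lemma time_residualGraph_le : (residualGraph N f).time ≤ n * (n * 2 + 1) :=
  time_fill₂_le fun _ _ => le_rfl

lemma time_residualCost_le (c : Fin n → Fin n → ℝ) :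
    (residualCost N c).time ≤ n * (n * 2 + 1) :=
  time_fill₂_le fun _ _ => le_rfl

lemma time_findAnotherFeasibleFlow_le (hN : N.Valid) (hn : 0 < n) :
    (findAnotherFeasibleFlow N f).time ≤ 70 * n ^ 3 := by
  obtain ⟨hinv, hvis, htime⟩ := buildDFSForest_spec (residualGraph N f).val
  have hloop := hN.not_res_self (f := f)
  have haug : ∀ C, IsCycleSet (fun i j => (residualGraph N f).val i j = true) C →
      (augment N f C >>= fun g => pure (some g)).time ≤ n * (n * 2 + 1) + n * 2 := by
    intro C hC
    have h1 := time_augment_le (N := N) f C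
    have h2 : C.length ≤ n := length_le_of_nodup_sources hC.nodup
    simp only [time_bind, time_pure]
    omega
  have hfirst : ∀ {ι : Type} (body : Fin n × Fin n → Timed (Option ι)),
      (∀ a, (body a).time ≤ 6 * n + 2) →
      (firstSome body (pairs n)).time ≤ n * n * (6 * n + 3) := fun body hb => by
    have := time_firstSome_le hb (pairs n)
    rwa [length_pairs] at this
  have hsum : n * (n * 2 + 1) + (10 * n + (3 * n + 2) * n + (n * (n * (6 * n + 5) + 1)
      + (n * n * (6 * n + 3) + (n * n * (6 * n + 3) + (n * n * (6 * n + 3)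
      + (n * (n * 2 + 1) + n * 2)))))) ≤ 70 * n ^ 3 := by
    have h1 : n ≤ n ^ 3 := Nat.le_self_pow (by norm_num) n
    have h2 : n ^ 2 ≤ n ^ 3 := Nat.pow_le_pow_right hn (by norm_num)
    ring_nf
    omega
  refine le_trans ?_ hsum
  unfold findAnotherFeasibleFlow
  refine time_bind_le time_residualGraph_le (time_bind_le htime (time_bind_le
    time_preprocess_le (time_bind_le (hfirst _ fun a => ?_) ?_)))
  · simp only [time_bind, time_step, val_step]
    split
    · simp only [time_bind, time_step, val_step, decide_eq_true_eq]
      split_ifs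
      · simp only [time_bind, time_pure]
        have := time_treePath_le (F := (buildDFSForest (residualGraph N f).val).val) a.2 n a.1 [a]
        omega
      · simp
    · simp
  split
  · rename_i C hC
    obtain ⟨a, -, ha⟩ := firstSome_eq_some hC
    simp only [val_bind, val_step] at ha
    split at ha
    · rename_i hk
      by_cases hp : ((buildDFSForest (residualGraph N f).val).val).parent a.1 = some a.2
      · simp [hp] at ha
      · simp only [val_bind, val_step, ne_eq, hp, not_false_eq_true, decide_true, if_true,
          val_pure, Option.some.injEq] at ha
        have := haug C (ha ▸ backwardCycle_spec hinv hvis hloop hk hp)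
        omega
    · simp at ha
  refine time_bind_le (hfirst _ fun a => ?_) ?_
  · simp only [time_bind, time_step, val_step]
    split
    · simp only [time_bind, time_step, val_step, decide_eq_true_eq]
      split_ifs
      · simp only [time_bind, time_pure]
        have := time_shortBackwardPath_le (F := (buildDFSForest (residualGraph N f).val).val)
          a.1 n a.2 [a]
        omega
      · simp
    · simp
  split
  · rename_i C hC
    obtain ⟨a, -, ha⟩ := firstSome_eq_some hC
    simp only [val_bind, val_step] at ha
    split at ha
    · rename_i hk
      simp only [val_bind, val_step, decide_eq_true_eq] at ha
      split_ifs at ha with hp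
      · simp only [val_bind, val_pure, Option.some.injEq] at ha
        have := haug C (ha ▸ forwardCycle_spec hinv hvis hloop hk hp)
        omega
    · simp at ha
  refine time_bind_le (hfirst _ fun a => ?_) ?_
  · simp only [time_bind, time_step, val_step]
    split
    · rename_i r _
      simp only [time_bind, time_step, val_step, decide_eq_true_eq]
      split_ifs
      · simp only [time_bind, time_pure]
        have h1 := time_shortBackwardPath_le
          (F := (buildDFSForest (residualGraph N f).val).val) r n a.2 [a]
        have h2 := time_treePath_le (F := (buildDFSForest (residualGraph N f).val).val) r n a.1
          (shortBackwardPath (buildDFSForest (residualGraph N f).val).val r n a.2 [a]).val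
        omega
      · simp
    · simp
  split
  · rename_i C hC
    obtain ⟨a, -, ha⟩ := firstSome_eq_some hC
    simp only [val_bind, val_step] at ha
    split at ha
    · rename_i r hk
      simp only [val_bind, val_step, decide_eq_true_eq] at ha
      split_ifs at ha with hp
      · simp only [val_bind, val_pure, Option.some.injEq] at ha
        exact haug C (ha ▸ crossCycle_spec hinv hvis hloop hk hp)
    · simp at ha
  · simp

end Feasible

/-! ### Node potentials -/

section Potential
variable {n : ℕ} {N : Network n} {f : Flow n}

lemma augFlow_totalCost (hN : N.Valid) (hf : N.IsFeasible f) {C : List (Fin n × Fin n)}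
    (hC : ∀ a ∈ C, N.Res f a.1 a.2) (hnd : C.Nodup) (hnet : ∀ v, netOut C v = 0) :
    N.totalCost (N.augFlow f C) = N.totalCost f + weight (N.resWeight N.cost) C := by
  rw [(augFlow_isFeasible hN hf hC hnd hnet).totalCost_eq, hf.totalCost_eq,
    ← linCost_augFlow (f := f) hN (fun a ha => (hC a ha).arc_or) N.cost, linCost_sub]
  ring

lemma IsWalk.netOut_eq_zero {i : Fin n} {C : List (Fin n × Fin n)} (h : IsWalk i C i)
    (v : Fin n) : netOut C v = 0 := by
  rw [h.netOut_eq, sub_self]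

/-- The residual graph of an optimal flow has no negative cycle. -/
lemma Network.IsOptimal.weight_nonneg (hN : N.Valid) (hf : N.IsOptimal f) {i : Fin n}
    {C : List (Fin n × Fin n)} (hC : IsWalk i C i) (hres : ∀ a ∈ C, N.Res f a.1 a.2)
    (hnd : (C.map Prod.fst).Nodup) : 0 ≤ weight (N.resWeight N.cost) C := by
  have h1 := hf.2 _ (augFlow_isFeasible hN hf.1 hres (hnd.of_map _) hC.netOut_eq_zero)
  rw [augFlow_totalCost hN hf.1 hres (hnd.of_map _) hC.netOut_eq_zero] at h1
  linarith

lemma minLoop_spec (p : Fin n → Prop) [DecidablePred p] (t : Fin n → ℝ) (l : List (Fin n))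
    (d : ℝ) :
    (loop (fun (d : ℝ) (i : Fin n) => step (if p i then min d (t i) else d)) l d).val ≤ d ∧
    (∀ i ∈ l, p i →
      (loop (fun (d : ℝ) (i : Fin n) => step (if p i then min d (t i) else d)) l d).val ≤ t i) ∧
    ((loop (fun (d : ℝ) (i : Fin n) => step (if p i then min d (t i) else d)) l d).val = d ∨
      ∃ i, p i ∧
        (loop (fun (d : ℝ) (i : Fin n) => step (if p i then min d (t i) else d)) l d).val
          = t i) := by
  induction l generalizing d with
  | nil => simp
  | cons a l ih =>
    rw [loop_cons_val, val_step]
    obtain ⟨h1, h2, h3⟩ := ih (if p a then min d (t a) else d)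
    refine ⟨h1.trans ?_, fun i hi hpi => ?_, ?_⟩
    · split_ifs
      · exact min_le_left _ _
      · exact le_rfl
    · rcases List.mem_cons.1 hi with rfl | hi
      · refine h1.trans ?_
        rw [if_pos hpi]
        exact min_le_right _ _
      · exact h2 i hi hpi
    · rcases h3 with h3 | h3
      · rw [h3]
        split_ifs with hp
        · rcases min_choice d (t a) with h | h
          · exact Or.inl h
          · exact Or.inr ⟨a, hp, h⟩
        · exact Or.inl rfl
      · exact Or.inr h3

/-- After `k` rounds of the Bellman-Ford algorithm, the value at `j` is the minimum, over all walks
with at most `k` arcs that end in `j`, of the weight plus the initial value at the start. -/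
lemma bellmanFord_spec (res : Fin n → Fin n → Bool) (c : Fin n → Fin n → ℝ) (l : List (Fin n))
    (y : Fin n → ℝ) (j : Fin n) :
    (∀ i L, IsWalk i L j → (∀ a ∈ L, res a.1 a.2 = true) → L.length ≤ l.length →
      (loop (fun (y : Fin n → ℝ) (_ : Fin n) =>
        fill fun j => loop (fun (d : ℝ) (i : Fin n) =>
          step (if res i j then min d (y i + c i j) else d)) (nodes n) (y j)) l y).val j
        ≤ y i + weight c L) ∧
    ∃ i L, IsWalk i L j ∧ (∀ a ∈ L, res a.1 a.2 = true) ∧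
      (loop (fun (y : Fin n → ℝ) (_ : Fin n) =>
        fill fun j => loop (fun (d : ℝ) (i : Fin n) =>
          step (if res i j then min d (y i + c i j) else d)) (nodes n) (y j)) l y).val j
        = y i + weight c L := by
  induction l generalizing y with
  | nil =>
    refine ⟨fun i L hL _ hlen => ?_, j, [], rfl, by simp, by simp⟩
    have : L = [] := by simpa using hlen
    subst this
    cases hL
    simp
  | cons k l ih =>
    rw [loop_cons_val]
    set y₁ : Fin n → ℝ := (fill fun j => loop (fun (d : ℝ) (i : Fin n) =>
      step (if res i j then min d (y i + c i j) else d)) (nodes n) (y j)).val with hy₁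
    have hspec := fun j => minLoop_spec (fun i => res i j = true) (fun i => y i + c i j)
      (nodes n) (y j)
    obtain ⟨h1, i, L, h2, h3, h4⟩ := ih y₁
    refine ⟨fun i L hL hLres hlen => ?_, ?_⟩
    · cases L with
      | nil =>
        cases hL
        have := h1 j [] rfl (by simp) (by simp)
        simp only [weight_nil, add_zero] at this ⊢
        exact this.trans (hspec j).1
      | cons a L =>
        obtain ⟨rfl, hL⟩ := hL
        have h5 := h1 a.2 L hL (fun b hb => hLres b (by simp [hb])) (by simpa using hlen)
        have h6 : y₁ a.2 ≤ y a.1 + c a.1 a.2 :=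
          (hspec a.2).2.1 a.1 (List.mem_finRange _) (hLres a (by simp))
        rw [weight_cons]
        linarith
    · rw [h4]
      rcases (hspec i).2.2 with h5 | ⟨k, hk, h5⟩
      · exact ⟨i, L, h2, h3, congrArg (· + weight c L) h5⟩
      · refine ⟨k, (k, i) :: L, ⟨rfl, h2⟩, ?_, ?_⟩
        · intro a ha
          rcases List.mem_cons.1 ha with rfl | ha
          · exact hk
          · exact h3 a ha
        · rw [weight_cons, ← add_assoc]
          exact congrArg (· + weight c L) h5

lemma resWeight_reduced (c : Fin n → Fin n → ℝ) (y : Fin n → ℝ) (i j : Fin n) :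
    N.resWeight (fun i j => c i j + y i - y j) i j = N.resWeight c i j + y i - y j := by
  unfold Network.resWeight
  split_ifs <;> ring

lemma computeReducedCost_val (y : Fin n → ℝ) :
    (computeReducedCost N y).val = fun i j => N.cost i j + y i - y j := rfl

/-- The reduced residual costs are nonnegative. Since there are no negative cycles, the minimum over
all walks is attained at a simple path, which has fewer than `n` arcs and can be prolonged by a
further arc within the `n` rounds. -/
lemma reducedCost_nonneg (hN : N.Valid) (hf : N.IsOptimal f) {i j : Fin n} (hij : N.Res f i j) :
    0 ≤ N.resWeight (computeReducedCost N (computeNodePotential N f).val).val i j := by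
  rw [computeReducedCost_val, resWeight_reduced]
  simp only [computeNodePotential, val_bind, residualCost_val]
  set y₀ : Fin n → ℝ := (fill fun j : Fin n => step (if j.val = 0 then (0 : ℝ) else
    (loop (fun (s : ℝ) (p : Fin n × Fin n) =>
      step (if N.arc p.1 p.2 then s + |N.cost p.1 p.2| else s)) (pairs n) 1).val)).val
  obtain ⟨-, s, L, hL, hLres, hval⟩ := bellmanFord_spec (residualGraph N f).val
    (N.resWeight N.cost) (nodes n) y₀ i
  have hupper := (bellmanFord_spec (residualGraph N f).val
    (N.resWeight N.cost) (nodes n) y₀ j).1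
  obtain ⟨L', h1, h2, h3, h4, h5⟩ := exists_simple_walk (R := N.Res f)
    (w := N.resWeight N.cost) (fun i C hC hres hnd => hf.weight_nonneg hN hC hres hnd) hL
    (fun a ha => residualGraph_val.1 (hLres a ha))
  have hlen := length_lt_of_nodup_sources h3 h4
  have h6 := hupper s (L' ++ [(i, j)]) (h1.append ⟨rfl, rfl⟩)
    (by
      intro a ha
      rcases List.mem_append.1 ha with ha | ha
      · exact residualGraph_val.2 (h2 a ha)
      · rw [List.mem_singleton.1 ha]; exact residualGraph_val.2 hij)
    (by simp; omega)
  rw [weight_append, weight_cons, weight_nil] at h6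
  dsimp only at h6
  linarith

lemma time_computeNodePotential_le (hn : 0 < n) :
    (computeNodePotential N f).time ≤ 20 * n ^ 3 := by
  have hsum : n * (n * 2 + 1) + (n * (n * 2 + 1) + (n * n * 2 + (n * 2
      + n * (n * (n * 2 + 1) + 1)))) ≤ 20 * n ^ 3 := by
    have h1 : n ≤ n ^ 3 := Nat.le_self_pow (by norm_num) n
    have h2 : n ^ 2 ≤ n ^ 3 := Nat.pow_le_pow_right hn (by norm_num)
    ring_nf
    omega
  refine le_trans ?_ hsum
  unfold computeNodePotential
  refine time_bind_le time_residualGraph_le (time_bind_le (time_residualCost_le _)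
    (time_bind_le ?_ (time_bind_le (time_fill_le fun _ => le_rfl) ?_)))
  · refine (time_loop_le (T := 1) (fun _ _ => le_rfl) _ _).trans ?_
    rw [length_pairs]
  · refine (time_loop_le (T := n * (n * 2 + 1)) (fun y _ => time_fill_le fun j => ?_) _ _).trans ?_
    · exact (time_loop_le (T := 1) (fun _ _ => le_rfl) _ _).trans (by simp)
    · simp

lemma time_computeReducedCost_le (y : Fin n → ℝ) :
    (computeReducedCost N y).time ≤ n * (n * 2 + 1) :=
  time_fill₂_le fun _ _ => le_rfl

/-! ### Another optimal flow -/

lemma balanceLoop_val (a b : Fin n → ℤ) (s : ℤ) :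
    (loop (fun (s : ℤ) (j : Fin n) => step (s - a j + b j)) (nodes n) s).val
      = s - ∑ j, a j + ∑ j, b j := by
  have key : ∀ (l : List (Fin n)) (s : ℤ),
      (loop (fun (s : ℤ) (j : Fin n) => step (s - a j + b j)) l s).val
        = s - (l.map a).sum + (l.map b).sum := by
    intro l
    induction l with
    | nil => simp
    | cons k l ih =>
      intro s
      rw [loop_cons_val, ih, List.map_cons, List.map_cons, List.sum_cons, List.sum_cons, val_step]
      ring
  rw [key, Fin.sum_univ_def, Fin.sum_univ_def]

/-- The network without the arcs of nonzero reduced cost, with balances adapted to the flow `f`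
on these arcs. -/
noncomputable def reducedNetwork (N : Network n) (f : Flow n) (c : Fin n → Fin n → ℝ) :
    Network n where
  arc i j := N.arc i j && decide (c i j = 0)
  lower := N.lower
  upper := N.upper
  cost := N.cost
  balance i := (loop (fun (s : ℤ) (j : Fin n) => step
    (s - (if N.arc i j && !(N.arc i j && decide (c i j = 0)) then f i j else 0)
       + (if N.arc j i && !(N.arc j i && decide (c j i = 0)) then f j i else 0))) (nodes n)
    (N.balance i)).val

section Reduced
variable {c : Fin n → Fin n → ℝ}

lemma reducedNetwork_valid (hN : N.Valid) : (reducedNetwork N f c).Valid := by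
  constructor
  · intro i j hij
    simp only [reducedNetwork, Bool.and_eq_true] at hij
    simp [reducedNetwork, hN.1 i j hij.1]
  · intro i j hij
    simp only [reducedNetwork, Bool.and_eq_true] at hij
    exact hN.2 i j hij.1

lemma reducedNetwork_balance (i : Fin n) : (reducedNetwork N f c).balance i = N.balance i
    - ∑ j, (if N.arc i j && !(N.arc i j && decide (c i j = 0)) then f i j else 0)
    + ∑ j, (if N.arc j i && !(N.arc j i && decide (c j i = 0)) then f j i else 0) :=
  balanceLoop_val _ _ _

/-- The feasible flows of the reduced network are the restrictions of the feasible flows that agree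
with `f` on the removed arcs. -/
lemma reducedNetwork_isFeasible_iff (hf : N.IsFeasible f) {g h : Flow n}
    (hgh : ∀ i j, h i j = if (reducedNetwork N f c).arc i j then g i j else f i j)
    (hg : ∀ i j, (reducedNetwork N f c).arc i j = false → g i j = 0) :
    (reducedNetwork N f c).IsFeasible g ↔ N.IsFeasible h := by
  have harc : ∀ i j, (reducedNetwork N f c).arc i j = true → N.arc i j = true := by
    intro i j hij
    simp only [reducedNetwork, Bool.and_eq_true] at hij
    exact hij.1
  have hpt : ∀ i j, h i j = g i j
      + if N.arc i j && !(N.arc i j && decide (c i j = 0)) then f i j else 0 := by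
    intro i j
    rw [hgh]
    by_cases hij : (reducedNetwork N f c).arc i j = true
    · have h1 : (N.arc i j && decide (c i j = 0)) = true := hij
      simp only [hij, if_true, h1]
      simp
    · have h1 : (N.arc i j && decide (c i j = 0)) = false := Bool.eq_false_iff.2 hij
      rw [if_neg hij, hg i j (Bool.eq_false_iff.2 hij), h1]
      by_cases h2 : N.arc i j = true
      · simp [h2]
      · simp [h2, hf.1 i j (by simpa using h2)]
  have hbal : ∀ i, ((∑ j, h i j) - ∑ j, h j i = N.balance i) ↔
      ((∑ j, g i j) - ∑ j, g j i = (reducedNetwork N f c).balance i) := by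
    intro i
    have h1 : ∑ j, h i j = _ := Finset.sum_congr rfl fun j _ => hpt i j
    have h2 : ∑ j, h j i = _ := Finset.sum_congr rfl fun j _ => hpt j i
    rw [h1, h2, reducedNetwork_balance, Finset.sum_add_distrib, Finset.sum_add_distrib]
    constructor <;> intro h <;> linarith
  rw [isFeasible_iff, isFeasible_iff]
  constructor
  · rintro ⟨-, h2, h3⟩
    refine ⟨fun i j hij => ?_, fun i j hij => ?_, fun i => (hbal i).2 (h3 i)⟩
    · rw [hgh, if_neg fun hc => by rw [harc i j hc] at hij; cases hij]
      exact hf.1 i j hij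
    · rw [hgh]
      split_ifs with hc
      · exact h2 i j hc
      · exact hf.2.1 i j hij
  · rintro ⟨-, h2, h3⟩
    refine ⟨hg, fun i j hij => ?_, fun i => (hbal i).1 (h3 i)⟩
    have := h2 i j (harc i j hij)
    rwa [hgh, if_pos hij] at this

lemma restrict_isFeasible (hf : N.IsFeasible f) {h : Flow n} (hh : N.IsFeasible h)
    (hagree : ∀ i j, (reducedNetwork N f c).arc i j = false → h i j = f i j) :
    (reducedNetwork N f c).IsFeasible
      fun i j => if (reducedNetwork N f c).arc i j then h i j else 0 := by
  refine (reducedNetwork_isFeasible_iff hf (h := h) (fun i j => ?_) fun i j hij => ?_).2 hh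
  · by_cases hij : (reducedNetwork N f c).arc i j = true
    · simp [hij]
    · simp [hij, hagree i j (by simpa using hij)]
  · simp [hij]

lemma findAnotherOptimalFlow_some (hN : N.Valid) (hf : N.IsFeasible f) {y : Fin n → ℝ}
    {h : Flow n} (hh : (findAnotherOptimalFlow N f (computeReducedCost N y).val).val = some h) :
    N.IsFeasible h ∧ h ≠ f ∧ (∀ i j, |h i j - f i j| ≤ 1) ∧ N.totalCost h = N.totalCost f := by
  set c := (computeReducedCost N y).val with hc
  set M := reducedNetwork N f c with hM
  have hMf : M.IsFeasible fun i j => if M.arc i j then f i j else 0 :=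
    restrict_isFeasible hf hf fun _ _ _ => rfl
  simp only [findAnotherOptimalFlow, val_bind] at hh
  split at hh
  · simp at hh
  rename_i g hg
  have hg : (findAnotherFeasibleFlow M fun i j => if M.arc i j then f i j else 0).val = some g :=
    hg
  have hMN : M.Valid := reducedNetwork_valid hN
  obtain ⟨C, hC, rfl⟩ := findAnotherFeasibleFlow_some hMN hg
  set fr : Flow n := fun i j => if M.arc i j then f i j else 0 with hfr
  have hgM := augFlow_isFeasible hMN hMf hC.arcs hC.nodup_arcs hC.net
  have hh' : ∀ i j, h i j = if M.arc i j then M.augFlow fr C i j else f i j := by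
    intro i j
    rw [← Option.some.inj hh]
    rfl
  have hhN : N.IsFeasible h := (reducedNetwork_isFeasible_iff hf hh' hgM.1).1 hgM
  have hdiff : ∀ i j, h i j - f i j = if M.arc i j then M.augFlow fr C i j - fr i j else 0 := by
    intro i j
    rw [hh']
    by_cases hij : M.arc i j = true <;> simp [hij, hfr]
  refine ⟨hhN, ?_, fun i j => ?_, ?_⟩
  · obtain ⟨a, ha, ha'⟩ := hC.proper
    intro heq
    refine augFlow_ne (f := fr) (fun a ha => (hC.arcs a ha).arc_or) ha ha' ?_
    funext i j
    have h1 := hdiff i j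
    rw [heq, sub_self] at h1
    by_cases hij : M.arc i j = true
    · rw [if_pos hij] at h1; linarith
    · rw [hgM.1 i j (by simpa using hij)]; simp [hfr, hij]
  · rw [hdiff]
    split_ifs
    · exact augFlow_unit hC.nodup_arcs i j
    · simp
  · have h1 := (hhN.sub hf).linCost_reduced N.cost y
    rw [linCost_sub N.cost, ← hhN.totalCost_eq, ← hf.totalCost_eq] at h1
    have h2 : linCost (fun i j => N.cost i j + y i - y j) (fun i j => h i j - f i j) = 0 := by
      refine Finset.sum_eq_zero fun i _ => Finset.sum_eq_zero fun j _ => ?_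
      dsimp only
      rw [hdiff]
      by_cases hij : M.arc i j = true
      · have : c i j = 0 := by
          have h3 : (N.arc i j && decide (c i j = 0)) = true := hij
          simp only [Bool.and_eq_true, decide_eq_true_eq] at h3
          exact h3.2
        have h4 : N.cost i j + y i - y j = 0 := this
        rw [h4, zero_mul]
      · simp [hij]
    linarith

/-- A further flow of minimal cost differs from `f` only on arcs of reduced cost zero. -/
lemma findAnotherOptimalFlow_none (hN : N.Valid) (hf : N.IsFeasible f) {y : Fin n → ℝ}
    (hy : ∀ i j, N.Res f i j → 0 ≤ N.resWeight (computeReducedCost N y).val i j)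
    (hnone : (findAnotherOptimalFlow N f (computeReducedCost N y).val).val = none)
    {h : Flow n} (hh : N.IsFeasible h) (hle : N.totalCost h ≤ N.totalCost f) : h = f := by
  set c := (computeReducedCost N y).val with hc
  set M := reducedNetwork N f c with hM
  have hMf : M.IsFeasible fun i j => if M.arc i j then f i j else 0 :=
    restrict_isFeasible hf hf fun _ _ _ => rfl
  simp only [findAnotherOptimalFlow, val_bind] at hnone
  split at hnone
  swap
  · simp at hnone
  rename_i hg
  have hg : (findAnotherFeasibleFlow M fun i j => if M.arc i j then f i j else 0).val = none :=
    hg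
  have hx := hh.sub hf
  have hcost : linCost c (fun i j => h i j - f i j) ≤ 0 := by
    have h1 := hx.linCost_reduced N.cost y
    rw [linCost_sub N.cost, ← hh.totalCost_eq, ← hf.totalCost_eq] at h1
    have h2 : linCost c (fun i j => h i j - f i j) = N.totalCost h - N.totalCost f := h1
    linarith
  have hzero : ∀ i j, 0 < (h i j - f i j) - (h j i - f j i) → N.resWeight c i j = 0 := by
    intro i j hij
    refine le_antisymm ?_ (hy i j (res_of_pos hf hh hij))
    have := hx.weight_le hN (c := c) (fun i j hij => hy i j (res_of_pos hf hh hij))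
      (C := [(i, j)]) (by simp) (by simpa using hij)
    simp only [weight_cons, weight_nil, add_zero] at this
    exact this.trans hcost
  have hagree : ∀ i j, M.arc i j = false → h i j = f i j := by
    intro i j hij
    by_contra hne
    have harc : N.arc i j = true := by
      by_contra hna
      have hna : N.arc i j = false := by simpa using hna
      rw [hh.1 i j hna, hf.1 i j hna] at hne
      exact hne rfl
    have hcij : c i j ≠ 0 := by
      have h3 : (N.arc i j && decide (c i j = 0)) = false := hij
      simpa [harc] using h3
    rcases hx.exists_pos hN (i := i) (j := j) (sub_ne_zero.2 hne) with hpos | hpos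
    · have := hzero i j hpos
      rw [Network.resWeight, if_pos harc] at this
      exact hcij this
    · have := hzero j i hpos
      rw [Network.resWeight, if_neg (by simp [hN.1 i j harc])] at this
      exact hcij (by linarith)
  have h1 := findAnotherFeasibleFlow_none (reducedNetwork_valid hN) hMf hg
    (restrict_isFeasible hf hh hagree)
  funext i j
  have h2 := congrFun (congrFun h1 i) j
  by_cases hij : M.arc i j = true
  · simpa [hij, ← hM] using h2
  · exact hagree i j (by simpa using hij)

lemma time_findAnotherOptimalFlow_le (hN : N.Valid) (hn : 0 < n) :
    (findAnotherOptimalFlow N f c).time ≤ 85 * n ^ 3 := by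
  have hsum : n * (n * 2 + 1) + (n * (n * 2 + 1) + (n * (n * 2 + 1) + (70 * n ^ 3
      + n * (n * 2 + 1)))) ≤ 85 * n ^ 3 := by
    have h1 : n ≤ n ^ 3 := Nat.le_self_pow (by norm_num) n
    have h2 : n ^ 2 ≤ n ^ 3 := Nat.pow_le_pow_right hn (by norm_num)
    ring_nf
    omega
  refine le_trans ?_ hsum
  have hM : (reducedNetwork N f c).Valid := reducedNetwork_valid hN
  unfold findAnotherOptimalFlow
  refine time_bind_le (time_fill₂_le fun _ _ => le_rfl) (time_bind_le
    (time_fill_le (T := n * 2) fun i => ?_) (time_bind_le (time_fill₂_le fun _ _ => le_rfl)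
    (time_bind_le (time_findAnotherFeasibleFlow_le hM hn) ?_)))
  · exact (time_loop_le (T := 1) (fun _ _ => le_rfl) _ _).trans (by simp)
  · split
    · simp
    · rw [time_bind, time_pure, add_zero]
      exact time_fill₂_le fun _ _ => le_rfl

end Reduced

end Potential

/-! ### Shortest paths with respect to nonnegative weights -/

/-- The arcs of a path that is stored as a tree of pointers. -/
def Route.arcs {n : ℕ} : Route n → List (Fin n × Fin n)
  | .nil => []
  | .arc i j => [(i, j)]
  | .append p q => p.arcs ++ q.arcs

/-- The number of records in the tree of pointers. -/
def Route.size {n : ℕ} : Route n → ℕ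
  | .nil => 1
  | .arc _ _ => 1
  | .append p q => 1 + p.size + q.size

/-- The length of a shortest path, as an entry of the distance table; `none` means `∞`. -/
def distVal {n : ℕ} : Option (ℝ × Route n) → WithTop ℝ
  | none => ⊤
  | some e => (e.1 : ℝ)

/-- The invariant of the Floyd-Warshall algorithm after the nodes in `S` have been processed. The
paths are simple and they are represented without empty parts, whence the size of the
representation is linear in the number of arcs. -/
structure DistInv {n : ℕ} (res : Fin n → Fin n → Prop) (w : Fin n → Fin n → ℝ)
    (S : Fin n → Prop) (d : Fin n → Fin n → Option (ℝ × Route n)) : Prop where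
  diag : ∀ i, d i i = some (0, .nil)
  arc_le : ∀ i j, res i j → distVal (d i j) ≤ (w i j : ℝ)
  triangle : ∀ m, S m → ∀ i j, distVal (d i j) ≤ distVal (d i m) + distVal (d m j)
  walk : ∀ i j x p, d i j = some (x, p) → IsWalk i p.arcs j ∧ (∀ a ∈ p.arcs, res a.1 a.2) ∧
    weight w p.arcs = x
  simple : ∀ i j x p, d i j = some (x, p) →
    (p.arcs.map Prod.fst).Nodup ∧ j ∉ p.arcs.map Prod.fst
  inner : ∀ i j x p, d i j = some (x, p) → ∀ v ∈ (p.arcs.map Prod.fst).tail, S v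
  size_eq : ∀ i j x p, d i j = some (x, p) → i ≠ j → p.size + 1 = 2 * p.arcs.length

section Distances
variable {n : ℕ}

lemma Route.flatten_val (p : Route n) : ∀ acc, (p.flatten acc).val = p.arcs ++ acc := by
  induction p with
  | nil => intro acc; rfl
  | arc i j => intro acc; rfl
  | append p q ihp ihq =>
    intro acc
    simp [Route.flatten, Route.arcs, ihp, ihq]

lemma Route.time_flatten (p : Route n) : ∀ acc, (p.flatten acc).time = p.size := by
  induction p with
  | nil => intro acc; rfl
  | arc i j => intro acc; rfl
  | append p q ihp ihq =>
    intro acc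
    simp only [Route.flatten, Route.size, time_bind, time_step, val_step, ihp, ihq]
    omega

lemma distVal_relax (a b c : Option (ℝ × Route n)) :
    distVal (relax a b c) = min (distVal a + distVal b) (distVal c) := by
  rcases a with _ | ⟨x, p⟩
  · simp [relax, distVal]
  rcases b with _ | ⟨y, q⟩
  · simp [relax, distVal]
  rcases c with _ | ⟨z, r⟩
  · simp [relax, distVal]
  · simp only [relax, distVal, ← WithTop.coe_add]
    split_ifs with h
    · rw [min_eq_left (by exact_mod_cast h.le)]
    · rw [min_eq_right (by exact_mod_cast not_lt.1 h)]

lemma relax_cases (a b c : Option (ℝ × Route n)) : relax a b c = c ∨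
    ∃ x p y q, a = some (x, p) ∧ b = some (y, q) ∧ relax a b c = some (x + y, .append p q) ∧
      ((x + y : ℝ) : WithTop ℝ) < distVal c := by
  rcases a with _ | ⟨x, p⟩
  · exact Or.inl (by simp [relax])
  rcases b with _ | ⟨y, q⟩
  · exact Or.inl (by simp [relax])
  rcases c with _ | ⟨z, r⟩
  · exact Or.inr ⟨x, p, y, q, rfl, rfl, rfl, WithTop.coe_lt_top _⟩
  · by_cases h : x + y < z
    · exact Or.inr ⟨x, p, y, q, rfl, rfl, by simp [relax, h], by
        simp only [distVal]; exact_mod_cast h⟩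
    · exact Or.inl (by simp [relax, h])

section Inv
variable {res : Fin n → Fin n → Prop} {w : Fin n → Fin n → ℝ} {S : Fin n → Prop}
  {d : Fin n → Fin n → Option (ℝ × Route n)}

lemma DistInv.nonneg (h : DistInv res w S d) (hw : ∀ i j, res i j → 0 ≤ w i j) (i j : Fin n) :
    0 ≤ distVal (d i j) := by
  rcases hd : d i j with _ | ⟨x, p⟩
  · exact le_top
  · obtain ⟨-, h2, rfl⟩ := h.walk i j x p hd
    have := weight_nonneg (w := w) fun a ha => hw _ _ (h2 a ha)
    exact WithTop.coe_le_coe.2 this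

/-- The table entries are at most the lengths of the walks whose inner nodes have been
processed. -/
lemma DistInv.le_weight (h : DistInv res w S d) {j : Fin n} {L : List (Fin n × Fin n)} :
    ∀ {i : Fin n}, IsWalk i L j → (∀ a ∈ L, res a.1 a.2) →
      (∀ v ∈ (L.map Prod.fst).tail, S v) → distVal (d i j) ≤ (weight w L : ℝ) := by
  induction L with
  | nil =>
    intro i hL _ _
    cases hL
    simp [h.diag, distVal]
  | cons a L ih =>
    intro i hL hres hS
    obtain ⟨rfl, hL⟩ := hL
    have harc := h.arc_le _ _ (hres a (by simp))
    cases L with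
    | nil =>
      cases hL
      simpa using harc
    | cons b L =>
      have hb : S a.2 := hS a.2 (by simp [hL.1])
      have h1 := ih hL (fun c hc => hres c (by simp [hc])) fun v hv =>
        hS v (List.mem_of_mem_tail (by simpa using hv))
      rw [weight_cons, WithTop.coe_add]
      exact (h.triangle a.2 hb a.1 j).trans (add_le_add harc h1)

lemma mem_tail_append_left {α : Type} {l l' : List α} {v : α} (h : v ∈ l.tail) :
    v ∈ (l ++ l').tail := by
  cases l with
  | nil => simp at h
  | cons a l =>
    simp only [List.tail_cons, List.cons_append] at h ⊢
    exact List.mem_append_left _ h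

lemma mem_tail_append_right {α : Type} {l l' : List α} {v : α} (h : v ∈ l'.tail) :
    v ∈ (l ++ l').tail := by
  cases l with
  | nil => exact h
  | cons a l =>
    simp only [List.tail_cons, List.cons_append]
    exact List.mem_append_right _ (List.mem_of_mem_tail h)

lemma DistInv.relax (h : DistInv res w S d) (hw : ∀ i j, res i j → 0 ≤ w i j) (k : Fin n) :
    DistInv res w (fun v => S v ∨ v = k)
      fun i j => KBestFlow.relax (d i k) (d k j) (d i j) := by
  have hnn := h.nonneg hw
  -- an improvement at `k` concatenates two nonempty paths without common nodes
  have himp : ∀ i j x p y q, d i k = some (x, p) → d k j = some (y, q) →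
      ((x + y : ℝ) : WithTop ℝ) < distVal (d i j) → i ≠ k ∧ k ≠ j ∧
      (∀ v ∈ p.arcs.map Prod.fst, v ∉ q.arcs.map Prod.fst) ∧ j ∉ p.arcs.map Prod.fst := by
    intro i j x p y q hp hq hlt
    have hik : i ≠ k := by
      rintro rfl
      rw [h.diag] at hp
      cases hp
      rw [hq, zero_add] at hlt
      exact lt_irrefl _ hlt
    have hkj : k ≠ j := by
      rintro rfl
      rw [h.diag] at hq
      cases hq
      rw [hp, add_zero] at hlt
      exact lt_irrefl _ hlt
    obtain ⟨p1, p2, p3⟩ := h.walk i k x p hp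
    obtain ⟨q1, q2, q3⟩ := h.walk k j y q hq
    have hx : 0 ≤ x := p3 ▸ weight_nonneg fun a ha => hw _ _ (p2 a ha)
    have hy : 0 ≤ y := q3 ▸ weight_nonneg fun a ha => hw _ _ (q2 a ha)
    have hsplit : ∀ m ∈ p.arcs.map Prod.fst, ∃ z : ℝ, z ≤ x ∧ distVal (d i m) ≤ (z : ℝ) := by
      intro m hm
      obtain ⟨l₁, l₂, hl, hl₁, -, -⟩ := p1.split hm
      refine ⟨weight w l₁, ?_, h.le_weight hl₁ (fun a ha => p2 a (by simp [hl, ha])) ?_⟩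
      · have := weight_nonneg (w := w) (l := l₂) fun a ha => hw _ _ (p2 a (by simp [hl, ha]))
        rw [hl, weight_append] at p3
        linarith
      · intro v hv
        refine h.inner i k x p hp v ?_
        rw [hl, List.map_append]
        exact mem_tail_append_left hv
    refine ⟨hik, hkj, fun v hvp hvq => ?_, fun hj => ?_⟩
    · have hSv : S v := by
        refine h.inner k j y q hq v ?_
        cases hqa : q.arcs with
        | nil => rw [hqa] at hvq; simp at hvq
        | cons b l =>
          rw [hqa] at hvq q1
          rcases List.mem_cons.1 (by simpa using hvq : v ∈ b.1 :: l.map Prod.fst) with rfl | hv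
          · rw [q1.1] at hvp
            exact absurd hvp (h.simple i k x p hp).2
          · simpa using hv
      obtain ⟨z, hz, hdz⟩ := hsplit v hvp
      obtain ⟨l₁, l₂, hl, -, hl₂, -⟩ := q1.split hvq
      have h2 : distVal (d v j) ≤ (weight w l₂ : ℝ) := by
        refine h.le_weight hl₂ (fun a ha => q2 a (by simp [hl, ha])) fun u hu => ?_
        refine h.inner k j y q hq u ?_
        rw [hl, List.map_append]
        exact mem_tail_append_right hu
      have h3 : weight w l₂ ≤ y := by
        have := weight_nonneg (w := w) (l := l₁) fun a ha => hw _ _ (q2 a (by simp [hl, ha]))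
        rw [hl, weight_append] at q3
        linarith
      have h4 : distVal (d i j) ≤ ((x + y : ℝ) : WithTop ℝ) :=
        (h.triangle v hSv i j).trans ((add_le_add hdz h2).trans
          (by rw [← WithTop.coe_add]; exact WithTop.coe_le_coe.2 (by linarith)))
      exact absurd hlt (not_lt.2 h4)
    · obtain ⟨z, hz, hdz⟩ := hsplit j hj
      exact absurd hlt (not_lt.2 (hdz.trans (WithTop.coe_le_coe.2 (by linarith))))
  refine ⟨?_, ?_, ?_, ?_, ?_, ?_, ?_⟩
  · intro i
    rcases relax_cases (d i k) (d k i) (d i i) with hr | ⟨x, p, y, q, hp, hq, -, hlt⟩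
    · rw [hr, h.diag]
    · exfalso
      have h1 := hnn i k
      have h2 := hnn k i
      rw [h.diag] at hlt
      rw [hp] at h1
      rw [hq] at h2
      have h1' : (0 : ℝ) ≤ x := by simpa [distVal] using h1
      have h2' : (0 : ℝ) ≤ y := by simpa [distVal] using h2
      have h3 : x + y < 0 := by
        have : ((x + y : ℝ) : WithTop ℝ) < ((0 : ℝ) : WithTop ℝ) := hlt
        exact WithTop.coe_lt_coe.1 this
      linarith
  · intro i j hij
    rw [distVal_relax]
    exact (min_le_right _ _).trans (h.arc_le i j hij)
  · have hkk : distVal (d k k) = 0 := by simp [h.diag, distVal]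
    have htri : ∀ m, (S m ∨ m = k) → ∀ i, distVal (d i k) ≤ distVal (d i m) + distVal (d m k) ∧
        distVal (d k i) ≤ distVal (d k m) + distVal (d m i) := by
      rintro m (hm | rfl) i
      · exact ⟨h.triangle m hm i k, h.triangle m hm k i⟩
      · simp [hkk]
    intro m hm i j
    simp only [distVal_relax]
    rcases min_choice (distVal (d i k) + distVal (d k m)) (distVal (d i m)) with h1 | h1 <;>
      rcases min_choice (distVal (d m k) + distVal (d k j)) (distVal (d m j)) with h2 | h2 <;>
      rw [h1, h2]
    · refine (min_le_left _ _).trans ?_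
      exact add_le_add (le_add_of_nonneg_right (hnn k m)) (le_add_of_nonneg_left (hnn m k))
    · refine (min_le_left _ _).trans ?_
      rw [add_assoc]
      exact add_le_add le_rfl (htri m hm j).2
    · refine (min_le_left _ _).trans ?_
      rw [← add_assoc]
      exact add_le_add (htri m hm i).1 le_rfl
    · rcases hm with hm | rfl
      · exact (min_le_right _ _).trans (h.triangle m hm i j)
      · exact min_le_left _ _
  · intro i j x p hd
    rcases relax_cases (d i k) (d k j) (d i j) with hr | ⟨x', p', y', q', hp, hq, hr, -⟩
    · exact h.walk i j x p (hr ▸ hd)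
    · rw [hr] at hd
      cases hd
      obtain ⟨p1, p2, p3⟩ := h.walk _ _ _ _ hp
      obtain ⟨q1, q2, q3⟩ := h.walk _ _ _ _ hq
      refine ⟨p1.append q1, fun a ha => ?_, by rw [Route.arcs, weight_append, p3, q3]⟩
      rcases List.mem_append.1 ha with ha | ha
      · exact p2 a ha
      · exact q2 a ha
  · intro i j x p hd
    rcases relax_cases (d i k) (d k j) (d i j) with hr | ⟨x', p', y', q', hp, hq, hr, hlt⟩
    · exact h.simple i j x p (hr ▸ hd)
    · rw [hr] at hd
      cases hd
      obtain ⟨-, -, h3, h4⟩ := himp _ _ _ _ _ _ hp hq hlt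
      obtain ⟨p1, p2⟩ := h.simple _ _ _ _ hp
      obtain ⟨q1, q2⟩ := h.simple _ _ _ _ hq
      rw [Route.arcs, List.map_append]
      refine ⟨List.nodup_append.2 ⟨p1, q1, fun a ha b hb hab => h3 a ha (hab ▸ hb)⟩, fun hj => ?_⟩
      rcases List.mem_append.1 hj with hj | hj
      · exact h4 hj
      · exact q2 hj
  · intro i j x p hd
    rcases relax_cases (d i k) (d k j) (d i j) with hr | ⟨x', p', y', q', hp, hq, hr, -⟩
    · exact fun v hv => Or.inl (h.inner i j x p (hr ▸ hd) v hv)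
    · rw [hr] at hd
      cases hd
      intro v hv
      have hq1 := (h.walk _ _ _ _ hq).1
      have hi1 := h.inner _ _ _ _ hp
      have hi2 := h.inner _ _ _ _ hq
      have hv' : v ∈ (p'.arcs.map Prod.fst).tail ∨ v ∈ q'.arcs.map Prod.fst := by
        rw [Route.arcs, List.map_append] at hv
        cases hpa : p'.arcs.map Prod.fst with
        | nil => rw [hpa] at hv; exact Or.inr (List.mem_of_mem_tail hv)
        | cons b l => rw [hpa] at hv; exact List.mem_append.1 hv
      rcases hv' with hv' | hv'
      · exact Or.inl (hi1 v hv')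
      · cases hqa : q'.arcs with
        | nil => rw [hqa] at hv'; simp at hv'
        | cons b l =>
          rw [hqa] at hv' hq1 hi2
          rcases List.mem_cons.1 (by simpa using hv' : v ∈ b.1 :: l.map Prod.fst) with rfl | hv'
          · exact Or.inr hq1.1
          · exact Or.inl (hi2 v (by simpa using hv'))
  · intro i j x p hd hij
    rcases relax_cases (d i k) (d k j) (d i j) with hr | ⟨x', p', y', q', hp, hq, hr, hlt⟩
    · exact h.size_eq i j x p (hr ▸ hd) hij
    · rw [hr] at hd
      cases hd
      obtain ⟨h1, h2, -, -⟩ := himp _ _ _ _ _ _ hp hq hlt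
      have hp' := h.size_eq _ _ _ _ hp h1
      have hq' := h.size_eq _ _ _ _ hq h2
      simp only [Route.size, Route.arcs, List.length_append]
      omega

end Inv

lemma distanceTable_spec {res : Fin n → Fin n → Bool} {w : Fin n → Fin n → ℝ}
    (hw : ∀ i j, res i j = true → 0 ≤ w i j) :
    DistInv (fun i j => res i j = true) w (fun _ => True) (distanceTable res w).val := by
  have hloop : ∀ (l : List (Fin n)) (S : Fin n → Prop)
      (d : Fin n → Fin n → Option (ℝ × Route n)),
      DistInv (fun i j => res i j = true) w S d →
      DistInv (fun i j => res i j = true) w (fun v => S v ∨ v ∈ l)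
        (loop (fun (d : Fin n → Fin n → Option (ℝ × Route n)) (k : Fin n) =>
          fill₂ fun i j => step (relax (d i k) (d k j) (d i j))) l d).val := by
    intro l
    induction l with
    | nil => intro S d h; simpa using h
    | cons k l ih =>
      intro S d h
      rw [loop_cons_val]
      have hS : (fun v => S v ∨ v ∈ k :: l) = fun v => (S v ∨ v = k) ∨ v ∈ l := by
        funext v
        simp [or_assoc]
      rw [hS]
      exact ih _ _ (h.relax hw k)
  set d₀ : Fin n → Fin n → Option (ℝ × Route n) := fun i j =>
    if i = j then some ((0 : ℝ), Route.nil) else if res i j then some (w i j, Route.arc i j)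
     else none with hd₀
  have h0 : DistInv (fun i j => res i j = true) w (fun _ => False) d₀ := by
    have hsome : ∀ i j x p, d₀ i j = some (x, p) → (i = j ∧ x = 0 ∧ p = Route.nil) ∨
        (i ≠ j ∧ res i j = true ∧ x = w i j ∧ p = Route.arc i j) := by
      intro i j x p hd
      simp only [hd₀] at hd
      split_ifs at hd with h1 h2
      · cases hd; exact Or.inl ⟨h1, rfl, rfl⟩
      · cases hd; exact Or.inr ⟨h1, h2, rfl, rfl⟩
    refine ⟨fun i => by simp [hd₀], fun i j hij => ?_, fun m hm => hm.elim, ?_, ?_, ?_, ?_⟩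
    · simp only [hd₀]
      split_ifs with h1
      · simpa [distVal] using hw i j hij
      · exact le_rfl
    · intro i j x p hd
      rcases hsome i j x p hd with ⟨rfl, rfl, rfl⟩ | ⟨h1, h2, rfl, rfl⟩
      · exact ⟨rfl, by simp [Route.arcs], by simp [Route.arcs]⟩
      · exact ⟨⟨rfl, rfl⟩, by simpa [Route.arcs] using h2, by simp [Route.arcs]⟩
    · intro i j x p hd
      rcases hsome i j x p hd with ⟨rfl, rfl, rfl⟩ | ⟨h1, h2, rfl, rfl⟩
      · simp [Route.arcs]
      · simpa [Route.arcs] using Ne.symm h1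
    · intro i j x p hd
      rcases hsome i j x p hd with ⟨rfl, rfl, rfl⟩ | ⟨h1, h2, rfl, rfl⟩ <;> simp [Route.arcs]
    · intro i j x p hd hij
      rcases hsome i j x p hd with ⟨rfl, rfl, rfl⟩ | ⟨h1, h2, rfl, rfl⟩
      · exact absurd rfl hij
      · simp [Route.arcs, Route.size]
  have hS : (fun _ => True) = fun v => False ∨ v ∈ nodes n := by
    funext v
    simp
  rw [hS]
  exact hloop (nodes n) _ d₀ h0

lemma time_distanceTable_le {res : Fin n → Fin n → Bool} {w : Fin n → Fin n → ℝ} :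
    (distanceTable res w).time ≤ n * (n * 2 + 1) + n * (n * (n * 2 + 1) + 1) := by
  unfold distanceTable
  refine time_bind_le (time_fill₂_le fun _ _ => le_rfl) ?_
  refine (time_loop_le (T := n * (n * 2 + 1)) (fun d k => time_fill₂_le fun _ _ => le_rfl) _ _).trans
    ?_
  simp

/-! ### The second-best flow -/

lemma bestLoop_spec (P : Fin n × Fin n → Prop) [DecidablePred P] (w : Fin n → Fin n → ℝ)
    (dist : Fin n → Fin n → Option (ℝ × Route n)) (l : List (Fin n × Fin n))
    (best r : Option (ℝ × (Fin n × Fin n) × Route n))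
    (hr : r = (loop (fun (best : Option (ℝ × (Fin n × Fin n) × Route n)) (a : Fin n × Fin n) =>
      step (if P a then
          match dist a.2 a.1, best with
          | none, _ => best
          | some (x, p), none => some (w a.1 a.2 + x, a, p)
          | some (x, p), some (z, _) =>
            if w a.1 a.2 + x < z then some (w a.1 a.2 + x, a, p) else best
        else best)) l best).val) :
    (r = best ∨ ∃ a x p, P a ∧ dist a.2 a.1 = some (x, p) ∧ r = some (w a.1 a.2 + x, a, p)) ∧
    (∀ a ∈ l, P a → ∀ x p, dist a.2 a.1 = some (x, p) →
      ∃ z e, r = some (z, e) ∧ z ≤ w a.1 a.2 + x) ∧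
    ∀ z e, best = some (z, e) → ∃ z' e', r = some (z', e') ∧ z' ≤ z := by
  induction l generalizing best with
  | nil =>
    rw [loop_nil, val_pure] at hr
    subst hr
    exact ⟨Or.inl rfl, by simp, fun z e hz => ⟨z, e, hz, le_rfl⟩⟩
  | cons a l ih =>
    rw [loop_cons_val, val_step] at hr
    obtain ⟨h1, h2, h3⟩ := ih _ hr
    by_cases hP : P a
    · rw [if_pos hP] at h1 h3
      rcases hd : dist a.2 a.1 with _ | ⟨x, p⟩
      · simp only [hd] at h1 h3
        refine ⟨h1, fun b hb hPb x p hx => ?_, h3⟩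
        rcases List.mem_cons.1 hb with rfl | hb
        · rw [hd] at hx; cases hx
        · exact h2 b hb hPb x p hx
      · rcases best with _ | ⟨z, e⟩
        · simp only [hd] at h1 h3
          refine ⟨Or.inr ?_, fun b hb hPb x p hx => ?_, by simp⟩
          · rcases h1 with h1 | h1
            · exact ⟨a, x, p, hP, hd, h1⟩
            · exact h1
          · rcases List.mem_cons.1 hb with rfl | hb
            · rw [hd] at hx; cases hx
              exact h3 _ _ rfl
            · exact h2 b hb hPb x p hx
        · simp only [hd] at h1 h3
          by_cases hlt : w a.1 a.2 + x < z
          · rw [if_pos hlt] at h1 h3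
            refine ⟨Or.inr ?_, fun b hb hPb x p hx => ?_, fun z' e' hz' => ?_⟩
            · rcases h1 with h1 | h1
              · exact ⟨a, x, p, hP, hd, h1⟩
              · exact h1
            · rcases List.mem_cons.1 hb with rfl | hb
              · rw [hd] at hx; cases hx
                exact h3 _ _ rfl
              · exact h2 b hb hPb x p hx
            · cases hz'
              obtain ⟨z', e', hz, hle⟩ := h3 _ _ rfl
              exact ⟨z', e', hz, hle.trans hlt.le⟩
          · rw [if_neg hlt] at h1 h3
            refine ⟨h1, fun b hb hPb x p hx => ?_, h3⟩
            rcases List.mem_cons.1 hb with rfl | hb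
            · rw [hd] at hx; cases hx
              obtain ⟨z', e', hz, hle⟩ := h3 _ _ rfl
              exact ⟨z', e', hz, hle.trans (not_lt.1 hlt)⟩
            · exact h2 b hb hPb x p hx
    · rw [if_neg hP] at h1 h3
      refine ⟨h1, fun b hb hPb x p hx => ?_, h3⟩
      rcases List.mem_cons.1 hb with rfl | hb
      · exact absurd hPb hP
      · exact h2 b hb hPb x p hx

end Distances

section SecondBest
variable {n : ℕ} {N : Network n} {f : Flow n}

/-- `a` is a residual arc without anti-parallel residual arc. -/
def Network.OneWay (N : Network n) (f : Flow n) (a : Fin n × Fin n) : Prop :=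
  (residualGraph N f).val a.1 a.2 = true ∧
    ((N.arc a.1 a.2 = true ∧ f a.1 a.2 = N.lower a.1 a.2) ∨
      (N.arc a.2 a.1 = true ∧ f a.2 a.1 = N.upper a.2 a.1))

instance : DecidablePred (N.OneWay f) := fun _ => inferInstanceAs (Decidable (_ ∧ _))

lemma Network.OneWay.not_res (hN : N.Valid) {a : Fin n × Fin n} (h : N.OneWay f a) :
    ¬N.Res f a.2 a.1 := by
  rintro (⟨h1, h2⟩ | ⟨h1, h2⟩) <;> rcases h.2 with ⟨h3, h4⟩ | ⟨h3, h4⟩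
  · rw [hN.1 _ _ h3] at h1; cases h1
  · omega
  · omega
  · rw [hN.1 _ _ h3] at h1; cases h1

lemma oneWay_of_not_res (hf : N.IsFeasible f) {i j : Fin n} (hij : N.Res f i j)
    (hji : ¬N.Res f j i) : N.OneWay f (i, j) := by
  refine ⟨residualGraph_val.2 hij, ?_⟩
  rcases hij with ⟨h1, h2⟩ | ⟨h1, h2⟩
  · refine Or.inl ⟨h1, ?_⟩
    have h3 : ¬N.lower i j < f i j := fun h => hji (Or.inr ⟨h1, h⟩)
    have := (hf.2.1 i j h1).1
    dsimp only
    omega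
  · refine Or.inr ⟨h1, ?_⟩
    have h3 : ¬f j i < N.upper j i := fun h => hji (Or.inl ⟨h1, h⟩)
    have := (hf.2.1 j i h1).2
    dsimp only
    omega

lemma resWeight_swap (hN : N.Valid) (c : Fin n → Fin n → ℝ) {i j : Fin n}
    (hij : N.arc i j = true ∨ N.arc j i = true) :
    N.resWeight c j i = -N.resWeight c i j := by
  rcases hij with h | h <;> simp [Network.resWeight, h, hN.1 _ _ h]

/-- Every dearer flow costs at least as much as some candidate cycle: the difference to `f` uses an
arc of positive reduced cost, whose anti-parallel arc cannot be residual, and contains a path back.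
-/
lemma exists_candidate (hN : N.Valid) (hf : N.IsFeasible f) {y : Fin n → ℝ}
    (hy : ∀ i j, N.Res f i j → 0 ≤ N.resWeight (computeReducedCost N y).val i j)
    {h : Flow n} (hh : N.IsFeasible h) (hlt : N.totalCost f < N.totalCost h) :
    ∃ a x p, N.OneWay f a ∧
      (distanceTable (residualGraph N f).val (N.resWeight (computeReducedCost N y).val)).val a.2 a.1
        = some (x, p) ∧
      N.totalCost f + (N.resWeight (computeReducedCost N y).val a.1 a.2 + x) ≤ N.totalCost h := by
  set c := (computeReducedCost N y).val with hc
  have hx := hh.sub hf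
  have hcost : linCost c (fun i j => h i j - f i j) = N.totalCost h - N.totalCost f := by
    rw [hh.totalCost_eq, hf.totalCost_eq, ← linCost_sub]
    exact hx.linCost_reduced N.cost y
  have hE : ∀ i j, 0 < (h i j - f i j) - (h j i - f j i) → 0 ≤ N.resWeight c i j :=
    fun i j hij => hy i j (res_of_pos hf hh hij)
  obtain ⟨i, j, hij, hpos⟩ : ∃ i j, 0 < (h i j - f i j) - (h j i - f j i) ∧
      0 < N.resWeight c i j := by
    by_contra hcon
    push Not at hcon
    have h1 : linCost c (fun i j => h i j - f i j) ≤ 0 := by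
      rw [hx.linCost_eq hN]
      refine Finset.sum_nonpos fun i _ => Finset.sum_nonpos fun j _ => ?_
      split_ifs with hij
      · exact mul_nonpos_of_nonpos_of_nonneg (hcon i j hij) (by exact_mod_cast hij.le)
      · exact le_rfl
    linarith
  have hres := res_of_pos hf hh hij
  have hnres : ¬N.Res f j i := fun hji => by
    have h1 := hy j i hji
    rw [resWeight_swap hN c hres.arc_or] at h1
    linarith
  obtain ⟨L, hL, hLE⟩ := exists_walk_of_reflTransGen (hx.reach_back hij)
  obtain ⟨L', h1, h2, h3, h4, -⟩ := exists_simple_walk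
    (R := fun a b => 0 < (h a b - f a b) - (h b a - f b a)) (w := N.resWeight c)
    (fun i C _ hCE _ => weight_nonneg fun a ha => hE _ _ (hCE a ha)) hL hLE
  have hle := hx.weight_le hN hE (C := (i, j) :: L')
    (List.nodup_cons.2 ⟨fun hmem => h4 (List.mem_map.2 ⟨(i, j), hmem, rfl⟩), h3.of_map _⟩)
    (by
      intro a ha
      rcases List.mem_cons.1 ha with rfl | ha
      · exact hij
      · exact h2 a ha)
  have hdist := (distanceTable_spec (res := (residualGraph N f).val) (w := N.resWeight c)
    fun i j hij => hy i j (residualGraph_val.1 hij)).le_weight h1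
    (fun a ha => residualGraph_val.2 (res_of_pos hf hh (h2 a ha))) (fun _ _ => trivial)
  rcases hd : (distanceTable (residualGraph N f).val (N.resWeight c)).val j i with _ | ⟨x, p⟩
  · rw [hd] at hdist
    exact absurd hdist (not_le.2 (WithTop.coe_lt_top _))
  · rw [hd] at hdist
    have hxle : x ≤ weight (N.resWeight c) L' := WithTop.coe_le_coe.1 hdist
    refine ⟨(i, j), x, p, oneWay_of_not_res hf hres hnres, hd, ?_⟩
    rw [weight_cons] at hle
    dsimp only at hle ⊢
    linarith

lemma isCycleSet_candidate (hN : N.Valid) {y : Fin n → ℝ}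
    (hy : ∀ i j, N.Res f i j → 0 ≤ N.resWeight (computeReducedCost N y).val i j)
    {a : Fin n × Fin n} {x : ℝ} {p : Route n} (ha : N.OneWay f a)
    (hd : (distanceTable (residualGraph N f).val
      (N.resWeight (computeReducedCost N y).val)).val a.2 a.1 = some (x, p)) :
    IsCycleSet (N.Res f) (p.arcs ++ [a]) := by
  have hinv := distanceTable_spec (res := (residualGraph N f).val)
    (w := N.resWeight (computeReducedCost N y).val)
    fun i j hij => hy i j (residualGraph_val.1 hij)
  obtain ⟨h1, h2, -⟩ := hinv.walk _ _ _ _ hd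
  obtain ⟨h3, h4⟩ := hinv.simple _ _ _ _ hd
  have harcs : ∀ b ∈ p.arcs ++ [a], N.Res f b.1 b.2 := by
    intro b hb
    rcases List.mem_append.1 hb with hb | hb
    · exact residualGraph_val.1 (h2 b hb)
    · rw [List.mem_singleton.1 hb]; exact residualGraph_val.1 ha.1
  refine ⟨harcs, ?_, ?_, a, by simp, fun hmem => ha.not_res hN (harcs _ hmem)⟩
  · rw [List.map_append, List.nodup_append]
    refine ⟨h3, by simp, fun v hv u hu huv => h4 ?_⟩
    have : u = a.1 := by simpa using hu
    rw [← this, ← huv]; exact hv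
  · exact IsWalk.netOut_eq_zero (h1.append ⟨rfl, rfl⟩)

lemma candidate_totalCost (hN : N.Valid) (hf : N.IsFeasible f) {y : Fin n → ℝ}
    (hy : ∀ i j, N.Res f i j → 0 ≤ N.resWeight (computeReducedCost N y).val i j)
    {a : Fin n × Fin n} {x : ℝ} {p : Route n} (ha : N.OneWay f a)
    (hd : (distanceTable (residualGraph N f).val
      (N.resWeight (computeReducedCost N y).val)).val a.2 a.1 = some (x, p)) :
    N.totalCost (N.augFlow f (p.arcs ++ [a]))
      = N.totalCost f + (N.resWeight (computeReducedCost N y).val a.1 a.2 + x) := by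
  have hC := isCycleSet_candidate hN hy ha hd
  obtain ⟨-, -, hwx⟩ := (distanceTable_spec (res := (residualGraph N f).val)
    (w := N.resWeight (computeReducedCost N y).val)
    fun i j hij => hy i j (residualGraph_val.1 hij)).walk _ _ _ _ hd
  have harc : ∀ b ∈ p.arcs ++ [a], N.arc b.1 b.2 = true ∨ N.arc b.2 b.1 = true :=
    fun b hb => (hC.arcs b hb).arc_or
  have h1 := (augFlow_sub_isCirculation (f := f) hN harc hC.net).linCost_reduced N.cost y
  rw [linCost_augFlow hN harc, linCost_augFlow hN harc] at h1
  rw [augFlow_totalCost hN hf hC.arcs hC.nodup_arcs hC.net, ← h1,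
    weight_append, weight_cons, weight_nil, add_zero]
  have h2 : weight (N.resWeight fun i j => N.cost i j + y i - y j) p.arcs = x := hwx
  rw [h2, computeReducedCost_val]
  ring

/-- The value of `findSecondBestFlow`. The differences of at most one are what makes the addresses
of the priority queue determine the costs. -/
lemma findSecondBestFlow_spec (hN : N.Valid) (hf : N.IsOptimal f) :
    (∀ g, (findSecondBestFlow N f).val = some g →
      N.IsSecondBest f g ∧ ∀ i j, |g i j - f i j| ≤ 1) ∧
    ((findSecondBestFlow N f).val = none → ∀ h, N.IsFeasible h → h = f) := by
  have hy : ∀ i j, N.Res f i j →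
      0 ≤ N.resWeight (computeReducedCost N (computeNodePotential N f).val).val i j :=
    fun i j hij => reducedCost_nonneg hN hf hij
  set y := (computeNodePotential N f).val with hyd
  rcases hopt : (findAnotherOptimalFlow N f (computeReducedCost N y).val).val with _ | g₀
  · have hgt : ∀ h, N.IsFeasible h → h ≠ f → N.totalCost f < N.totalCost h :=
      fun h hh hne => not_le.1 fun hle =>
        hne (findAnotherOptimalFlow_none hN hf.1 hy hopt hh hle)
    obtain ⟨h1, h2, -⟩ := bestLoop_spec (N.OneWay f)
      (N.resWeight (computeReducedCost N y).val)
      (distanceTable (residualGraph N f).val (N.resWeight (computeReducedCost N y).val)).val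
      (pairs n) none _ rfl
    constructor
    · intro g hg
      simp only [findSecondBestFlow, val_bind, ← hyd, hopt, residualCost_val] at hg
      split at hg
      · simp at hg
      rename_i e z a p hb
      simp only [val_bind, val_pure, Option.some.injEq, Route.flatten_val] at hg
      -- `hb` and `h1`, `h2` differ in the decidability instance only
      erw [hb] at h1 h2
      rcases h1 with h1 | ⟨a', x, p', ha, hd, h1⟩
      · cases h1
      · cases h1
        have hC := isCycleSet_candidate hN hy ha hd
        rw [hC.augment_val hN] at hg
        subst hg
        refine ⟨⟨augFlow_isFeasible hN hf.1 hC.arcs hC.nodup_arcs hC.net, ?_, fun h hh hne => ?_⟩,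
          augFlow_unit hC.nodup_arcs⟩
        · obtain ⟨b, hb1, hb2⟩ := hC.proper
          exact augFlow_ne (fun b hb => (hC.arcs b hb).arc_or) hb1 hb2
        · obtain ⟨b, x', q, hb1, hb2, hb3⟩ := exists_candidate hN hf.1 hy hh (hgt h hh hne)
          obtain ⟨z, e', hz, hle⟩ := h2 b (mem_pairs b) hb1 x' q hb2
          cases hz
          rw [candidate_totalCost hN hf.1 hy ha hd]
          linarith
    · intro hnone h hh
      by_contra hne
      simp only [findSecondBestFlow, val_bind, ← hyd, hopt, residualCost_val] at hnone
      split at hnone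
      · rename_i hb
        -- `hb` and `h2` differ in the decidability instance only
        erw [hb] at h2
        obtain ⟨b, x', q, hb1, hb2, hb3⟩ := exists_candidate hN hf.1 hy hh (hgt h hh hne)
        obtain ⟨z, e', hz, -⟩ := h2 b (mem_pairs b) hb1 x' q hb2
        cases hz
      · simp at hnone
  · have hval : (findSecondBestFlow N f).val = some g₀ := by
      simp only [findSecondBestFlow, val_bind, ← hyd, hopt, val_pure]
    obtain ⟨h1, h2, h3, h4⟩ := findAnotherOptimalFlow_some hN hf.1 hopt
    rw [hval]
    refine ⟨fun g hg => ?_, fun h => by cases h⟩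
    cases hg
    exact ⟨⟨h1, h2, fun h hh _ => h4.le.trans (hf.2 h hh)⟩, h3⟩

end SecondBest

section SecondBestTime
variable {n : ℕ} {N : Network n} {f : Flow n}

lemma time_findSecondBestFlow_le (hn : 0 < n) (hN : N.Valid) (hf : N.IsOptimal f) :
    (findSecondBestFlow N f).time ≤ 150 * n ^ 3 := by
  have hy : ∀ i j, N.Res f i j →
      0 ≤ N.resWeight (computeReducedCost N (computeNodePotential N f).val).val i j :=
    fun i j hij => reducedCost_nonneg hN hf hij
  set y := (computeNodePotential N f).val with hyd
  have hsum : 20 * n ^ 3 + (n * (n * 2 + 1) + (85 * n ^ 3 + (n * (n * 2 + 1)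
      + (n * (n * 2 + 1) + ((n * (n * 2 + 1) + n * (n * (n * 2 + 1) + 1)) + (n * n * 2
      + (2 * n + (n * (n * 2 + 1) + n * 2)))))))) ≤ 150 * n ^ 3 := by
    have h1 : n ≤ n ^ 3 := Nat.le_self_pow (by norm_num) n
    have h2 : n ^ 2 ≤ n ^ 3 := Nat.pow_le_pow_right hn (by norm_num)
    ring_nf
    omega
  refine le_trans ?_ hsum
  unfold findSecondBestFlow
  refine time_bind_le (time_computeNodePotential_le hn) (time_bind_le
    (time_computeReducedCost_le _) (time_bind_le (time_findAnotherOptimalFlow_le hN hn) ?_))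
  split
  · simp
  refine time_bind_le time_residualGraph_le (time_bind_le (time_residualCost_le _) (time_bind_le
    time_distanceTable_le (time_bind_le (a := n * n * 2) ?_ ?_)))
  · refine (time_loop_le (T := 1) (fun _ _ => le_rfl) _ _).trans ?_
    rw [length_pairs]
  split
  · simp
  rename_i z a p hb
  have h1 := (bestLoop_spec (N.OneWay f) (N.resWeight (computeReducedCost N y).val)
    (distanceTable (residualGraph N f).val (N.resWeight (computeReducedCost N y).val)).val
    (pairs n) none _ rfl).1
  -- `hb` and `h1` differ in the decidability instance only
  erw [hb] at h1
  rcases h1 with h1 | ⟨a', x, p', ha, hd, h1⟩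
  · cases h1
  cases h1
  have hC := isCycleSet_candidate hN hy ha hd
  have hlen : (p.arcs ++ [a]).length ≤ n := length_le_of_nodup_sources hC.nodup
  have hne : a.2 ≠ a.1 := fun heq => ha.not_res hN (by
    have := residualGraph_val.1 ha.1
    rw [heq] at this ⊢
    exact this)
  have hsize := (distanceTable_spec (res := (residualGraph N f).val)
    (w := N.resWeight (computeReducedCost N y).val)
    fun i j hij => hy i j (residualGraph_val.1 hij)).size_eq _ _ _ _ hd hne
  rw [List.length_append, List.length_singleton] at hlen
  refine time_bind_le ?_ (time_bind_le (b := 0) ?_ (by simp))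
  · rw [Route.time_flatten]; omega
  · have := time_augment_le (N := N) f (p.flatten [a]).val
    rw [Route.flatten_val, List.length_append, List.length_singleton] at this
    rw [Route.flatten_val]
    change _ ≤ n * (n * 2 + 1) + n * 2
    omega

end SecondBestTime

/-! ### The priority queue -/

/-- The candidates in the queue. -/
def Queue.all {n : ℕ} : Queue n → List (Candidate n)
  | .empty => []
  | .bucket q => q
  | .node _ a b c => a.all ++ (b.all ++ c.all)

/-- The queue is a correct tournament tree of depth `d`, the buckets are sorted, and no key in the
bucket with the address `l` exceeds `κ + off l`. -/
def Queue.Good {n : ℕ} : Queue n → ℕ → (List Ordering → ℝ) → ℝ → Prop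
  | .empty, _, _, _ => True
  | .bucket q, d, off, κ => d = 0 ∧ q.Pairwise (fun e e' => e.key ≤ e'.key) ∧
      ∀ e ∈ q, e.key ≤ κ + off []
  | .node m a b c, d, off, κ => m = min a.minKey (min b.minKey c.minKey) ∧ ∃ d', d = d' + 1 ∧
      a.Good d' (fun l => off (.lt :: l)) κ ∧ b.Good d' (fun l => off (.eq :: l)) κ ∧
      c.Good d' (fun l => off (.gt :: l)) κ

section QueueLemmas
variable {n : ℕ}

lemma Queue.Good.mono {B : Queue n} {d : ℕ} {off : List Ordering → ℝ} {κ κ' : ℝ}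
    (h : B.Good d off κ) (hκ : κ ≤ κ') : B.Good d off κ' := by
  induction B generalizing d off with
  | empty => trivial
  | bucket q => exact ⟨h.1, h.2.1, fun e he => (h.2.2 e he).trans (by linarith)⟩
  | node m a b c iha ihb ihc =>
    obtain ⟨hm, d', hd, h1, h2, h3⟩ := h
    exact ⟨hm, d', hd, iha h1, ihb h2, ihc h3⟩

lemma Queue.Good.minKey_le {B : Queue n} {d : ℕ} {off : List Ordering → ℝ} {κ : ℝ}
    (h : B.Good d off κ) {e : Candidate n} (he : e ∈ B.all) :
    B.minKey ≤ ((e.key : ℝ) : WithTop ℝ) := by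
  induction B generalizing d off with
  | empty => cases he
  | bucket q =>
    cases q with
    | nil => cases he
    | cons b q =>
      rcases List.mem_cons.1 he with rfl | he
      · exact le_rfl
      · exact WithTop.coe_le_coe.2 (List.rel_of_pairwise_cons h.2.1 he)
  | node m a b c iha ihb ihc =>
    obtain ⟨rfl, d', -, h1, h2, h3⟩ := h
    rcases List.mem_append.1 he with he | he
    · exact (min_le_left _ _).trans (iha h1 he)
    rcases List.mem_append.1 he with he | he
    · exact (min_le_right _ _).trans ((min_le_left _ _).trans (ihb h2 he))
    · exact (min_le_right _ _).trans ((min_le_right _ _).trans (ihc h3 he))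

lemma Queue.Good.minKey_eq_top {B : Queue n} {d : ℕ} {off : List Ordering → ℝ} {κ : ℝ}
    (h : B.Good d off κ) (he : B.all = []) : B.minKey = ⊤ := by
  induction B generalizing d off with
  | empty => rfl
  | bucket q => cases he; rfl
  | node m a b c iha ihb ihc =>
    obtain ⟨rfl, d', -, h1, h2, h3⟩ := h
    simp only [Queue.all, List.append_eq_nil_iff] at he
    change min a.minKey (min b.minKey c.minKey) = ⊤
    rw [iha h1 he.1, ihb h2 he.2.1, ihc h3 he.2.2, min_self, min_self]

lemma Queue.Good.all_eq_nil {B : Queue n} {d : ℕ} {off : List Ordering → ℝ} {κ : ℝ}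
    (h : B.Good d off κ) (he : B.minKey = ⊤) : B.all = [] := by
  rw [List.eq_nil_iff_forall_not_mem]
  intro e hmem
  have := h.minKey_le hmem
  rw [he] at this
  exact absurd this (not_le.2 (WithTop.coe_lt_top _))

lemma Queue.extractMin_spec {B : Queue n} {d : ℕ} {off : List Ordering → ℝ} {κ : ℝ}
    (h : B.Good d off κ) :
    (B.extractMin.val = none → B.all = []) ∧
    (∀ e B', B.extractMin.val = some (e, B') → B.all.Perm (e :: B'.all) ∧
      ((e.key : ℝ) : WithTop ℝ) = B.minKey ∧ B'.Good d off κ) ∧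
    B.extractMin.time ≤ 3 * d + 1 := by
  induction B generalizing d off with
  | empty => exact ⟨fun _ => rfl, fun e B' hB => by simp [Queue.extractMin] at hB, by
      simp [Queue.extractMin]⟩
  | bucket q =>
    cases q with
    | nil => exact ⟨fun _ => rfl, fun e B' hB => by simp [Queue.extractMin] at hB, by
        simp [Queue.extractMin]⟩
    | cons b q =>
      refine ⟨fun hB => by simp [Queue.extractMin] at hB, fun e B' hB => ?_, by
        simp [Queue.extractMin]⟩
      simp only [Queue.extractMin, val_step, Option.some.injEq, Prod.mk.injEq] at hB
      obtain ⟨rfl, rfl⟩ := hB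
      exact ⟨.refl _, rfl, h.1, (List.pairwise_cons.1 h.2.1).2, fun e he =>
        h.2.2 e (List.mem_cons_of_mem _ he)⟩
  | node m a b c iha ihb ihc =>
    obtain ⟨rfl, d', rfl, h1, h2, h3⟩ := h
    simp only [Queue.extractMin, val_bind, time_bind, val_step, time_step, decide_eq_true_eq]
    by_cases ha : a.minKey ≤ b.minKey ∧ a.minKey ≤ c.minKey
    · obtain ⟨a1, a2, a3⟩ := iha h1
      simp only [if_pos ha, val_bind, time_bind]
      have hmin : min a.minKey (min b.minKey c.minKey) = a.minKey :=
        min_eq_left (le_min ha.1 ha.2)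
      rcases hx : a.extractMin.val with _ | ⟨e, a'⟩
      · have htop := h1.minKey_eq_top (a1 hx)
        rw [htop] at ha
        refine ⟨fun _ => ?_, fun e B' hB => by simp at hB, by simp; omega⟩
        simp [Queue.all, a1 hx, h2.all_eq_nil (top_le_iff.1 ha.1),
          h3.all_eq_nil (top_le_iff.1 ha.2)]
      · obtain ⟨p1, p2, p3⟩ := a2 e a' hx
        refine ⟨fun hB => by simp at hB, fun e' B' hB => ?_, by simp [Queue.mkNode]; omega⟩
        simp only [Queue.mkNode, val_bind, val_step, val_pure, Option.some.injEq,
          Prod.mk.injEq] at hB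
        obtain ⟨rfl, rfl⟩ := hB
        exact ⟨p1.append_right _, p2.trans hmin.symm, rfl, d', rfl, p3, h2, h3⟩
    · simp only [if_neg ha, val_bind, time_bind, val_step, time_step, decide_eq_true_eq]
      by_cases hb : b.minKey ≤ c.minKey
      · obtain ⟨a1, a2, a3⟩ := ihb h2
        have hba : b.minKey ≤ a.minKey := by
          by_contra hlt
          exact ha ⟨(not_le.1 hlt).le, (not_le.1 hlt).le.trans hb⟩
        have hmin : min a.minKey (min b.minKey c.minKey) = b.minKey := by
          rw [min_eq_left hb, min_eq_right hba]
        simp only [if_pos hb, val_bind, time_bind]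
        rcases hx : b.extractMin.val with _ | ⟨e, b'⟩
        · have htop := h2.minKey_eq_top (a1 hx)
          rw [htop] at hb hba
          refine ⟨fun _ => ?_, fun e B' hB => by simp at hB, by simp; omega⟩
          simp [Queue.all, a1 hx, h1.all_eq_nil (top_le_iff.1 hba),
            h3.all_eq_nil (top_le_iff.1 hb)]
        · obtain ⟨p1, p2, p3⟩ := a2 e b' hx
          refine ⟨fun hB => by simp at hB, fun e' B' hB => ?_, by simp [Queue.mkNode]; omega⟩
          simp only [Queue.mkNode, val_bind, val_step, val_pure, Option.some.injEq,
            Prod.mk.injEq] at hB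
          obtain ⟨rfl, rfl⟩ := hB
          exact ⟨((p1.append_right _).append_left _).trans List.perm_middle,
            p2.trans hmin.symm, rfl, d', rfl, h1, p3, h3⟩
      · obtain ⟨a1, a2, a3⟩ := ihc h3
        have hcb : c.minKey ≤ b.minKey := (not_le.1 hb).le
        have hca : c.minKey ≤ a.minKey := by
          by_contra hlt
          exact ha ⟨(not_le.1 hlt).le.trans hcb, (not_le.1 hlt).le⟩
        have hmin : min a.minKey (min b.minKey c.minKey) = c.minKey := by
          rw [min_eq_right hcb, min_eq_right hca]
        simp only [if_neg hb, val_bind, time_bind]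
        rcases hx : c.extractMin.val with _ | ⟨e, c'⟩
        · have htop := h3.minKey_eq_top (a1 hx)
          rw [htop] at hcb hca
          refine ⟨fun _ => ?_, fun e B' hB => by simp at hB, by simp; omega⟩
          simp [Queue.all, a1 hx, h1.all_eq_nil (top_le_iff.1 hca),
            h2.all_eq_nil (top_le_iff.1 hcb)]
        · obtain ⟨p1, p2, p3⟩ := a2 e c' hx
          refine ⟨fun hB => by simp at hB, fun e' B' hB => ?_, by simp [Queue.mkNode]; omega⟩
          simp only [Queue.mkNode, val_bind, val_step, val_pure, Option.some.injEq,
            Prod.mk.injEq] at hB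
          obtain ⟨rfl, rfl⟩ := hB
          refine ⟨?_, p2.trans hmin.symm, rfl, d', rfl, h1, h2, p3⟩
          refine ((p1.append_left _).append_left _).trans ?_
          exact (List.perm_middle.append_left _).trans List.perm_middle

lemma Queue.Good.children {B : Queue n} {d : ℕ} {off : List Ordering → ℝ} {κ : ℝ}
    (h : B.Good (d + 1) off κ) :
    B.children.1.Good d (fun l => off (.lt :: l)) κ ∧
    B.children.2.1.Good d (fun l => off (.eq :: l)) κ ∧
    B.children.2.2.Good d (fun l => off (.gt :: l)) κ ∧
    B.all = B.children.1.all ++ (B.children.2.1.all ++ B.children.2.2.all) := by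
  cases B with
  | empty => exact ⟨trivial, trivial, trivial, rfl⟩
  | bucket q => exact absurd h.1 (by omega)
  | node m a b c =>
    obtain ⟨-, d', hd, h1, h2, h3⟩ := h
    obtain rfl : d = d' := by omega
    exact ⟨h1, h2, h3, rfl⟩

/-- Since the new key attains the bound for its bucket, the bucket remains sorted. -/
lemma Queue.insert_spec {e : Candidate n} (l : List Ordering) : ∀ {B : Queue n}
    {off : List Ordering → ℝ} {κ : ℝ}, B.Good l.length off κ → e.key = κ + off l →
    (Queue.insert e l B).val.Good l.length off κ ∧
    (Queue.insert e l B).val.all.Perm (e :: B.all) ∧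
    (Queue.insert e l B).time ≤ 2 * l.length + 1 := by
  induction l with
  | nil =>
    intro B off κ h he
    simp only [Queue.insert, val_step, time_step]
    cases B with
    | empty => simp [Queue.Good, Queue.all, Queue.items, he]
    | bucket q =>
      obtain ⟨-, h1, h2⟩ := h
      refine ⟨⟨rfl, ?_, ?_⟩, ?_, by simp⟩
      · refine List.pairwise_append.2 ⟨h1, by simp, fun a ha b hb => ?_⟩
        rw [List.mem_singleton.1 hb, he]
        exact h2 a ha
      · intro a ha
        rcases List.mem_append.1 ha with ha | ha
        · exact h2 a ha
        · rw [List.mem_singleton.1 ha, he]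
      · exact List.perm_append_singleton e q
    | node m a b c =>
      obtain ⟨-, d', hd, -⟩ := h
      simp at hd
  | cons o l ih =>
    intro B off κ h he
    obtain ⟨h1, h2, h3, h4⟩ := Queue.Good.children h
    rw [h4]
    cases o
    · obtain ⟨i1, i2, i3⟩ := ih h1 (by simpa using he)
      simp only [Queue.insert, Queue.mkNode, val_bind, val_step, time_bind, time_step,
        List.length_cons]
      exact ⟨⟨rfl, l.length, rfl, i1, h2, h3⟩, i2.append_right _, by omega⟩
    · obtain ⟨i1, i2, i3⟩ := ih h2 (by simpa using he)
      simp only [Queue.insert, Queue.mkNode, val_bind, val_step, time_bind, time_step,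
        List.length_cons]
      exact ⟨⟨rfl, l.length, rfl, h1, i1, h3⟩,
        ((i2.append_right _).append_left _).trans List.perm_middle, by omega⟩
    · obtain ⟨i1, i2, i3⟩ := ih h3 (by simpa using he)
      simp only [Queue.insert, Queue.mkNode, val_bind, val_step, time_bind, time_step,
        List.length_cons]
      refine ⟨⟨rfl, l.length, rfl, h1, h2, i1⟩, ?_, by omega⟩
      refine ((i2.append_left _).append_left _).trans ?_
      exact (List.perm_middle.append_left _).trans List.perm_middle

/-! ### Addresses of buckets -/

lemma signs_val (f g : Flow n) (acc : List Ordering) : (signs f g acc).val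
    = ((pairs n).map fun a => compare (f a.1 a.2) (g a.1 a.2)).reverse ++ acc := by
  unfold signs
  generalize pairs n = l
  induction l generalizing acc with
  | nil => rfl
  | cons a l ih => rw [loop_cons_val, ih]; simp

lemma address_val (f old g : Flow n) : (address f old g).val
    = ((pairs n).map fun a => compare (f a.1 a.2) (old a.1 a.2)).reverse
      ++ ((pairs n).map fun a => compare (f a.1 a.2) (g a.1 a.2)).reverse := by
  simp only [address, val_bind, signs_val, List.append_nil]

lemma length_address (f old g : Flow n) : (address f old g).val.length = 2 * (n * n) := by
  rw [address_val, List.length_append, List.length_reverse, List.length_reverse, List.length_map,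
    List.length_map, length_pairs]
  ring

lemma time_address_le (f old g : Flow n) : (address f old g).time ≤ 4 * (n * n) := by
  have h : ∀ (f g : Flow n) (acc : List Ordering), (signs f g acc).time ≤ n * n * 2 := by
    intro f g acc
    refine (time_loop_le (T := 1) (fun _ _ => le_rfl) _ _).trans ?_
    rw [length_pairs]
  have h1 := h f g []
  have h2 := h f old (signs f g []).val
  simp only [address, time_bind]
  omega

/-- The two flows differ by at most one unit on every arc. -/
def UnitDiff (f g : Flow n) : Prop := ∀ i j, |g i j - f i j| ≤ 1

lemma sub_eq_of_compare_eq {a b a' b' : ℤ} (h : |b - a| ≤ 1) (h' : |b' - a'| ≤ 1)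
    (hc : compare a b = compare a' b') : b - a = b' - a' := by
  rw [abs_le] at h h'
  rcases lt_trichotomy a b with hab | hab | hab
  · rw [compare_lt_iff_lt.2 hab] at hc
    have := compare_lt_iff_lt.1 hc.symm
    omega
  · rw [compare_eq_iff_eq.2 hab] at hc
    have := compare_eq_iff_eq.1 hc.symm
    omega
  · rw [compare_gt_iff_gt.2 hab] at hc
    have := compare_gt_iff_gt.1 hc.symm
    omega

/-- The address determines the difference between the second-best flow and the previous one, hence
also the difference of their costs. -/
lemma totalCost_sub_eq_of_address_eq (N : Network n) {f old g f' old' g' : Flow n}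
    (h1 : UnitDiff f old) (h2 : UnitDiff f g) (h1' : UnitDiff f' old') (h2' : UnitDiff f' g')
    (h : (address f old g).val = (address f' old' g').val) :
    N.totalCost g - N.totalCost old = N.totalCost g' - N.totalCost old' := by
  rw [address_val, address_val] at h
  obtain ⟨ha, hb⟩ := List.append_inj h (by simp)
  have ha' := List.map_inj_left.1 (List.reverse_injective ha)
  have hb' := List.map_inj_left.1 (List.reverse_injective hb)
  have hpt : ∀ i j, g i j - old i j = g' i j - old' i j := by
    intro i j
    have e1 := sub_eq_of_compare_eq (h1 i j) (h1' i j) (ha' (i, j) (mem_pairs _))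
    have e2 := sub_eq_of_compare_eq (h2 i j) (h2' i j) (hb' (i, j) (mem_pairs _))
    omega
  have hcost : ∀ g old : Flow n, N.totalCost g - N.totalCost old
      = ∑ i, ∑ j, if N.arc i j then N.cost i j * ((g i j - old i j : ℤ) : ℝ) else 0 := by
    intro g old
    unfold Network.totalCost
    simp only [← Finset.sum_sub_distrib]
    refine Finset.sum_congr rfl fun i _ => Finset.sum_congr rfl fun j _ => ?_
    split_ifs
    · push_cast; ring
    · simp
  rw [hcost, hcost]
  simp only [hpt]

open Classical in
/-- The difference between the cost of the second-best flow and the cost of the previous one for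
the candidates that are inserted into the bucket with the address `l`. -/
noncomputable def bucketOffset (N : Network n) (l : List Ordering) : ℝ :=
  if h : ∃ t : Flow n × Flow n × Flow n, UnitDiff t.1 t.2.1 ∧ UnitDiff t.1 t.2.2 ∧
      (address t.1 t.2.1 t.2.2).val = l then
    N.totalCost h.choose.2.2 - N.totalCost h.choose.2.1
  else 0

lemma bucketOffset_address (N : Network n) {f old g : Flow n} (h1 : UnitDiff f old)
    (h2 : UnitDiff f g) :
    bucketOffset N (address f old g).val = N.totalCost g - N.totalCost old := by
  have h : ∃ t : Flow n × Flow n × Flow n, UnitDiff t.1 t.2.1 ∧ UnitDiff t.1 t.2.2 ∧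
      (address t.1 t.2.1 t.2.2).val = (address f old g).val := ⟨(f, old, g), h1, h2, rfl⟩
  rw [bucketOffset, dif_pos h]
  obtain ⟨a, b, c⟩ := h.choose_spec
  exact totalCost_sub_eq_of_address_eq N a b h1 h2 c

lemma computeCost_val (N : Network n) (f : Flow n) : (computeCost N f).val = N.totalCost f := by
  have key : ∀ (l : List (Fin n × Fin n)) (s : ℝ),
      (loop (fun (s : ℝ) (a : Fin n × Fin n) => step
        (if N.arc a.1 a.2 then s + N.cost a.1 a.2 * (f a.1 a.2 : ℝ) else s)) l s).val
        = s + (l.map fun a => if N.arc a.1 a.2 then N.cost a.1 a.2 * (f a.1 a.2 : ℝ) else 0).sum := by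
    intro l
    induction l with
    | nil => simp
    | cons a l ih =>
      intro s
      rw [loop_cons_val, ih, val_step, List.map_cons, List.sum_cons]
      split_ifs <;> ring
  have hnd : (pairs n).Nodup := (List.nodup_finRange n).product (List.nodup_finRange n)
  have huniv : (pairs n).toFinset = Finset.univ := by
    ext a
    simp only [List.mem_toFinset, mem_pairs, Finset.mem_univ]
  rw [computeCost, key, zero_add, ← List.sum_toFinset _ hnd, huniv, Fintype.sum_prod_type]
  rfl

lemma time_computeCost_le (N : Network n) (f : Flow n) : (computeCost N f).time ≤ n * n * 2 := by
  refine (time_loop_le (T := 1) (fun _ _ => le_rfl) _ _).trans ?_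
  rw [length_pairs]

end QueueLemmas

/-! ### Partition of the solution space -/

section Partition
variable {n : ℕ} {N : Network n}

lemma totalCost_congr {N M : Network n} (ha : M.arc = N.arc) (hc : M.cost = N.cost) (f : Flow n) :
    M.totalCost f = N.totalCost f := by
  unfold Network.totalCost
  rw [ha, hc]

lemma setUpper_isFeasible_iff {a : Fin n × Fin n} {v : ℤ} (ha : N.arc a.1 a.2 = true)
    (hv : v ≤ N.upper a.1 a.2) (h : Flow n) :
    (setUpper N a v).val.IsFeasible h ↔ N.IsFeasible h ∧ h a.1 a.2 ≤ v := by
  have key : (∀ i j, N.arc i j = true → N.lower i j ≤ h i j ∧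
        h i j ≤ setEntry N.upper a.1 a.2 v i j) ↔
      (∀ i j, N.arc i j = true → N.lower i j ≤ h i j ∧ h i j ≤ N.upper i j) ∧
        h a.1 a.2 ≤ v := by
    constructor
    · refine fun hs => ⟨fun i j hij => ?_, ?_⟩
      · have := hs i j hij
        rw [setEntry_apply] at this
        split_ifs at this with hc
        · obtain ⟨rfl, rfl⟩ := hc
          exact ⟨this.1, this.2.trans hv⟩
        · exact this
      · have := (hs a.1 a.2 ha).2
        rwa [setEntry_apply, if_pos ⟨rfl, rfl⟩] at this
    · rintro ⟨h1, h2⟩ i j hij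
      rw [setEntry_apply]
      split_ifs with hc
      · obtain ⟨rfl, rfl⟩ := hc
        exact ⟨(h1 _ _ hij).1, h2⟩
      · exact h1 i j hij
  constructor
  · rintro ⟨h1, h2, h3⟩
    obtain ⟨h4, h5⟩ := key.1 h2
    exact ⟨⟨h1, h4, h3⟩, h5⟩
  · rintro ⟨⟨h1, h2, h3⟩, h4⟩
    exact ⟨h1, key.2 ⟨h2, h4⟩, h3⟩

lemma setLower_isFeasible_iff {a : Fin n × Fin n} {v : ℤ} (ha : N.arc a.1 a.2 = true)
    (hv : N.lower a.1 a.2 ≤ v) (h : Flow n) :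
    (setLower N a v).val.IsFeasible h ↔ N.IsFeasible h ∧ v ≤ h a.1 a.2 := by
  have key : (∀ i j, N.arc i j = true → setEntry N.lower a.1 a.2 v i j ≤ h i j ∧
        h i j ≤ N.upper i j) ↔
      (∀ i j, N.arc i j = true → N.lower i j ≤ h i j ∧ h i j ≤ N.upper i j) ∧
        v ≤ h a.1 a.2 := by
    constructor
    · refine fun hs => ⟨fun i j hij => ?_, ?_⟩
      · have := hs i j hij
        rw [setEntry_apply] at this
        split_ifs at this with hc
        · obtain ⟨rfl, rfl⟩ := hc
          exact ⟨hv.trans this.1, this.2⟩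
        · exact this
      · have := (hs a.1 a.2 ha).1
        rwa [setEntry_apply, if_pos ⟨rfl, rfl⟩] at this
    · rintro ⟨h1, h2⟩ i j hij
      rw [setEntry_apply]
      split_ifs with hc
      · obtain ⟨rfl, rfl⟩ := hc
        exact ⟨h2, (h1 _ _ hij).2⟩
      · exact h1 i j hij
  constructor
  · rintro ⟨h1, h2, h3⟩
    obtain ⟨h4, h5⟩ := key.1 h2
    exact ⟨⟨h1, h4, h3⟩, h5⟩
  · rintro ⟨⟨h1, h2, h3⟩, h4⟩
    exact ⟨h1, key.2 ⟨h2, h4⟩, h3⟩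

lemma setUpper_valid (hN : N.Valid) (a : Fin n × Fin n) (v : ℤ) : (setUpper N a v).val.Valid := hN

lemma setLower_valid (hN : N.Valid) {a : Fin n × Fin n} {v : ℤ} (ha : N.arc a.1 a.2 = true)
    (hv : N.lower a.1 a.2 ≤ v) : (setLower N a v).val.Valid := by
  refine ⟨hN.1, fun i j hij => ?_⟩
  change 0 ≤ setEntry N.lower a.1 a.2 v i j
  rw [setEntry_apply]
  split_ifs
  · exact (hN.2 _ _ ha).trans hv
  · exact hN.2 i j hij

lemma partition_spec (hN : N.Valid) {f g : Flow n} (hf : N.IsFeasible f) (hg : N.IsFeasible g)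
    (hfg : f ≠ g) {N₁ N₂ : Network n} (hp : (partition N f g).val = (N₁, N₂)) :
    (N₁.arc = N.arc ∧ N₁.cost = N.cost ∧ N₁.Valid) ∧
    (N₂.arc = N.arc ∧ N₂.cost = N.cost ∧ N₂.Valid) ∧
    (∀ h, N.IsFeasible h ↔ N₁.IsFeasible h ∨ N₂.IsFeasible h) ∧
    (∀ h, N₁.IsFeasible h → ¬N₂.IsFeasible h) ∧ N₁.IsFeasible f ∧ N₂.IsFeasible g := by
  simp only [partition, val_bind] at hp
  split at hp
  · rename_i hd
    refine absurd ?_ hfg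
    funext i j
    have := firstSome_eq_none hd (i, j) (mem_pairs _)
    simpa using this
  rename_i a hd
  obtain ⟨b, -, hb⟩ := firstSome_eq_some hd
  have hab : b = a ∧ f b.1 b.2 ≠ g b.1 b.2 := by
    simp only [val_step] at hb
    split_ifs at hb with hc
    · exact ⟨Option.some.inj hb, hc⟩
  obtain ⟨rfl, hne⟩ := hab
  have ha : N.arc b.1 b.2 = true := by
    by_contra hc
    have hc : N.arc b.1 b.2 = false := by simpa using hc
    rw [hf.1 _ _ hc, hg.1 _ _ hc] at hne
    exact hne rfl
  have hfb := hf.2.1 _ _ ha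
  have hgb := hg.2.1 _ _ ha
  simp only [val_bind, val_step, decide_eq_true_eq] at hp
  by_cases hlt : f b.1 b.2 < g b.1 b.2
  · simp only [if_pos hlt, val_bind, val_pure, Prod.mk.injEq] at hp
    obtain ⟨rfl, rfl⟩ := hp
    have h1 := setUpper_isFeasible_iff (N := N) (a := b) (v := f b.1 b.2) ha hfb.2
    have h2 := setLower_isFeasible_iff (N := N) (a := b) (v := f b.1 b.2 + 1) ha (by omega)
    refine ⟨⟨rfl, rfl, setUpper_valid hN _ _⟩, ⟨rfl, rfl, setLower_valid hN ha (by omega)⟩,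
      fun h => ?_, fun h => ?_, (h1 f).2 ⟨hf, le_rfl⟩, (h2 g).2 ⟨hg, hlt⟩⟩
    · rw [h1, h2, ← and_or_left]
      exact ⟨fun hh => ⟨hh, by omega⟩, And.left⟩
    · rw [h1, h2]
      rintro ⟨-, hh⟩ ⟨-, hh'⟩
      omega
  · simp only [if_neg hlt, val_bind, val_pure, Prod.mk.injEq] at hp
    obtain ⟨rfl, rfl⟩ := hp
    have h1 := setLower_isFeasible_iff (N := N) (a := b) (v := f b.1 b.2) ha hfb.1
    have h2 := setUpper_isFeasible_iff (N := N) (a := b) (v := f b.1 b.2 - 1) ha (by omega)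
    refine ⟨⟨rfl, rfl, setLower_valid hN ha hfb.1⟩, ⟨rfl, rfl, setUpper_valid hN _ _⟩,
      fun h => ?_, fun h => ?_, (h1 f).2 ⟨hf, le_rfl⟩, (h2 g).2 ⟨hg, by omega⟩⟩
    · rw [h1, h2, ← and_or_left]
      exact ⟨fun hh => ⟨hh, by omega⟩, And.left⟩
    · rw [h1, h2]
      rintro ⟨-, hh⟩ ⟨-, hh'⟩
      omega

lemma time_partition_le (f g : Flow n) :
    (partition N f g).time ≤ n * n * 2 + (1 + 2 * (n * (n * 2 + 1) + 1)) := by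
  have hU : ∀ a v, (setUpper N a v).time ≤ n * (n * 2 + 1) + 1 := fun a v =>
    time_bind_le (time_fill₂_le fun _ _ => le_rfl) (by simp)
  have hL : ∀ a v, (setLower N a v).time ≤ n * (n * 2 + 1) + 1 := fun a v =>
    time_bind_le (time_fill₂_le fun _ _ => le_rfl) (by simp)
  unfold partition
  refine time_bind_le ?_ ?_
  · refine (time_firstSome_le (T := 1) (fun _ => le_rfl) _).trans ?_
    rw [length_pairs]
  · split
    · simp
    · rename_i a _
      have h1 := hU a (f a.1 a.2)
      have h2 := hL a (f a.1 a.2 + 1)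
      have h3 := hL a (f a.1 a.2)
      have h4 := hU a (f a.1 a.2 - 1)
      simp only [time_bind, time_step, val_step, decide_eq_true_eq]
      split_ifs
      · simp only [time_bind, time_pure]; omega
      · simp only [time_bind, time_pure]; omega

/-- There are only finitely many feasible integer flows. -/
lemma finite_isFeasible (N : Network n) : {f : Flow n | N.IsFeasible f}.Finite := by
  refine (Set.Finite.pi' (t := fun i => {r : Fin n → ℤ |
    ∀ j, r j ∈ Set.Icc (min 0 (N.lower i j)) (max 0 (N.upper i j))})
    fun i => Set.Finite.pi' fun j => Set.finite_Icc _ _).subset ?_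
  intro f hf i j
  by_cases hij : N.arc i j = true
  · have := hf.2.1 i j hij
    exact ⟨(min_le_right _ _).trans this.1, this.2.trans (le_max_right _ _)⟩
  · rw [hf.1 i j (by simpa using hij)]
    exact ⟨min_le_left _ _, le_max_left _ _⟩

end Partition

/-! ### Enumeration -/

/-- A candidate of the network `N`: a part of its solution space together with an optimal and a
second-best flow of this part. -/
structure Candidate.Good {n : ℕ} (N : Network n) (e : Candidate n) : Prop where
  arc_eq : e.net.arc = N.arc
  cost_eq : e.net.cost = N.cost
  valid : e.net.Valid
  sub : ∀ h, e.net.IsFeasible h → N.IsFeasible h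
  optimal : e.net.IsOptimal e.first
  second_best : e.net.IsSecondBest e.first e.second
  unit : UnitDiff e.first e.second
  key_eq : e.key = N.totalCost e.second

/-- The flows that a candidate stands for: those of its part of the solution space, except for its
optimal flow, which has been output already. -/
def Candidate.Covers {n : ℕ} (e : Candidate n) (h : Flow n) : Prop :=
  e.net.IsFeasible h ∧ h ≠ e.first

/-- The flows that have not been output. -/
def Queue.Remaining {n : ℕ} (B : Queue n) (h : Flow n) : Prop := ∃ e ∈ B.all, e.Covers h

/-- The invariant of the enumeration: the candidates in the queue stand for disjoint sets of
flows, none of which is cheaper than the last output, of cost `κ`. -/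
structure Queue.Inv {n : ℕ} (N : Network n) (κ : ℝ) (B : Queue n) : Prop where
  good : B.Good (2 * (n * n)) (bucketOffset N) κ
  cand : ∀ e ∈ B.all, e.Good N
  le_key : ∀ e ∈ B.all, κ ≤ e.key
  disjoint : B.all.Pairwise fun e e' => ∀ h, e.Covers h → ¬e'.Covers h

section Enumerate
variable {n : ℕ} {N : Network n}

lemma Candidate.Good.key_le {e : Candidate n} (he : e.Good N) {h : Flow n} (hh : e.Covers h) :
    e.key ≤ N.totalCost h := by
  have := he.second_best.2.2 h hh.1 hh.2
  rw [totalCost_congr he.arc_eq he.cost_eq, totalCost_congr he.arc_eq he.cost_eq] at this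
  rw [he.key_eq]; exact this

lemma Candidate.Good.covers_second {e : Candidate n} (he : e.Good N) : e.Covers e.second :=
  ⟨he.second_best.1, he.second_best.2.1⟩

/-- The new candidates, at most one, arrive in their bucket with the greatest key so far, because
their key is the cost `κ` of the previous flow plus the offset of the bucket. -/
lemma insertSecondBest_spec (hn : 0 < n) {M : Network n} (harc : M.arc = N.arc)
    (hcost : M.cost = N.cost) (hM : M.Valid) (hsub : ∀ h, M.IsFeasible h → N.IsFeasible h)
    {f old : Flow n} (hf : M.IsOptimal f) (hold : UnitDiff f old) {κ : ℝ}
    (hκ : N.totalCost old = κ) {B : Queue n}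
    (hB : B.Good (2 * (n * n)) (bucketOffset N) κ) :
    (∃ L : List (Candidate n), (insertSecondBest M f old B).val.all.Perm (L ++ B.all) ∧
      L.length ≤ 1 ∧ (∀ e ∈ L, e.Good N ∧ e.net = M ∧ e.first = f) ∧
      (∀ h, M.IsFeasible h → h ≠ f → ∃ e ∈ L, e.Covers h)) ∧
    (insertSecondBest M f old B).val.Good (2 * (n * n)) (bucketOffset N) κ ∧
    (insertSecondBest M f old B).time ≤ 161 * n ^ 3 := by
  obtain ⟨hs, hnone⟩ := findSecondBestFlow_spec hM hf
  have ht := time_findSecondBestFlow_le hn hM hf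
  have hpow : n * n ≤ n ^ 3 := by
    rw [← pow_two]; exact Nat.pow_le_pow_right hn (by norm_num)
  have hpow' : 0 < n ^ 3 := Nat.pow_pos hn
  simp only [insertSecondBest, val_bind, time_bind]
  rcases hv : (findSecondBestFlow M f).val with _ | g
  · simp only [val_pure, time_pure]
    exact ⟨⟨[], .refl _, by simp, by simp, fun h hh hne => absurd (hnone hv h hh) hne⟩, hB,
      by omega⟩
  · obtain ⟨hg, hunit⟩ := hs g hv
    simp only [val_bind, time_bind]
    set e : Candidate n := ⟨(computeCost M g).val, f, g, M⟩ with he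
    have hkey : e.key = N.totalCost g := by
      rw [← totalCost_congr harc hcost]; exact computeCost_val M g
    have hlen := length_address f old g
    have hins := Queue.insert_spec (e := e) (address f old g).val (B := B)
      (off := bucketOffset N) (κ := κ) (by rwa [hlen])
      (by rw [hkey, bucketOffset_address N hold hunit, hκ]; ring)
    rw [hlen] at hins
    obtain ⟨i1, i2, i3⟩ := hins
    refine ⟨⟨[e], i2, by simp, ?_, fun h hh hne => ⟨e, by simp, hh, hne⟩⟩, i1, ?_⟩
    · intro e' he'
      rw [List.mem_singleton.1 he']
      exact ⟨⟨harc, hcost, hM, hsub, hf, hg, hunit, hkey⟩, rfl, rfl⟩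
    · have h1 := time_computeCost_le M g
      have h2 := time_address_le f old g
      omega

lemma pairwise_of_length_le_one {α : Type} {R : α → α → Prop} {l : List α} (h : l.length ≤ 1) :
    l.Pairwise R := by
  rcases l with _ | ⟨a, _ | ⟨b, l⟩⟩
  · simp
  · simp
  · simp at h

/-- One pass of the enumeration: after the second-best flow of the extracted candidate has been
output, the candidates in the queue stand for the other remaining flows. -/
lemma enumerate_step (hn : 0 < n) {κ : ℝ} {B : Queue n} (hB : B.Inv N κ) {e : Candidate n}
    {B' : Queue n} (hx : B.extractMin.val = some (e, B')) {N₁ N₂ : Network n}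
    (hp : (partition e.net e.first e.second).val = (N₁, N₂)) {B₁ B₂ : Queue n}
    (hB₁ : B₁ = (insertSecondBest N₁ e.first e.second B').val)
    (hB₂ : B₂ = (insertSecondBest N₂ e.second e.second B₁).val) :
    B₂.Inv N (N.totalCost e.second) ∧
    (∀ h, B.Remaining h ↔ h = e.second ∨ B₂.Remaining h) ∧ ¬B₂.Remaining e.second ∧
    (insertSecondBest N₁ e.first e.second B').time
      + (insertSecondBest N₂ e.second e.second B₁).time ≤ 322 * n ^ 3 := by
  obtain ⟨hperm, hmin, hgood⟩ := (Queue.extractMin_spec hB.good).2.1 e B' hx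
  have he : e.Good N := hB.cand e (hperm.mem_iff.2 (by simp))
  have hκ : κ ≤ N.totalCost e.second := by
    rw [← he.key_eq]; exact hB.le_key e (hperm.mem_iff.2 (by simp))
  have hgood' := hgood.mono hκ
  have hcand' : ∀ e' ∈ B'.all, e'.Good N := fun e' h' =>
    hB.cand e' (hperm.mem_iff.2 (by simp [h']))
  have hkey' : ∀ e' ∈ B'.all, N.totalCost e.second ≤ e'.key := by
    intro e' h'
    have h1 := hB.good.minKey_le (hperm.mem_iff.2 (List.mem_cons_of_mem e h'))
    rw [← hmin, he.key_eq] at h1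
    exact WithTop.coe_le_coe.1 h1
  have hdis := List.pairwise_cons.1 ((hperm.pairwise_iff
    (R := fun e e' : Candidate n => ∀ h, e.Covers h → ¬e'.Covers h)
    (fun {a b} hab h hb ha => hab h ha hb)).1 hB.disjoint)
  have hne : e.first ≠ e.second := he.second_best.2.1.symm
  obtain ⟨⟨a1, c1, v1⟩, ⟨a2, c2, v2⟩, hiff, hexcl, hf1, hg2⟩ :=
    partition_spec he.valid he.optimal.1 he.second_best.1 hne hp
  have hnot2 : ¬N₂.IsFeasible e.first := hexcl _ hf1
  have hnot1 : ¬N₁.IsFeasible e.second := fun h => hexcl _ h hg2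
  have hopt1 : N₁.IsOptimal e.first := ⟨hf1, fun h hh => by
    rw [totalCost_congr a1 c1, totalCost_congr a1 c1]
    exact he.optimal.2 h ((hiff h).2 (Or.inl hh))⟩
  have hopt2 : N₂.IsOptimal e.second := ⟨hg2, fun h hh => by
    rw [totalCost_congr a2 c2, totalCost_congr a2 c2]
    exact he.second_best.2.2 h ((hiff h).2 (Or.inr hh)) fun heq => hnot2 (heq ▸ hh)⟩
  obtain ⟨⟨L₁, p1, l1, g1, r1⟩, good1, t1⟩ := insertSecondBest_spec hn (N := N) (a1.trans he.arc_eq)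
    (c1.trans he.cost_eq) v1 (fun h hh => he.sub h ((hiff h).2 (Or.inl hh))) hopt1 he.unit rfl
    hgood'
  rw [← hB₁] at p1 good1
  obtain ⟨⟨L₂, p2, l2, g2, r2⟩, good2, t2⟩ := insertSecondBest_spec hn (N := N) (a2.trans he.arc_eq)
    (c2.trans he.cost_eq) v2 (fun h hh => he.sub h ((hiff h).2 (Or.inr hh))) hopt2
    (old := e.second) (fun i j => by simp) rfl good1
  rw [← hB₂] at p2 good2
  have hall : B₂.all.Perm (L₂ ++ (L₁ ++ B'.all)) := p2.trans (p1.append_left _)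
  have hmem : ∀ e', e' ∈ B₂.all ↔ e' ∈ L₂ ∨ e' ∈ L₁ ∨ e' ∈ B'.all := fun e' => by
    rw [hall.mem_iff, List.mem_append, List.mem_append]
  have hc1 : ∀ e' ∈ L₁, ∀ h, e'.Covers h ↔ N₁.IsFeasible h ∧ h ≠ e.first := by
    intro e' he' h
    obtain ⟨-, h1, h2⟩ := g1 e' he'
    rw [Candidate.Covers, h1, h2]
  have hc2 : ∀ e' ∈ L₂, ∀ h, e'.Covers h ↔ N₂.IsFeasible h ∧ h ≠ e.second := by
    intro e' he' h
    obtain ⟨-, h1, h2⟩ := g2 e' he'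
    rw [Candidate.Covers, h1, h2]
  have hsub1 : ∀ e' ∈ L₁, ∀ h, e'.Covers h → e.Covers h := fun e' he' h hh =>
    ⟨(hiff h).2 (Or.inl ((hc1 e' he' h).1 hh).1), ((hc1 e' he' h).1 hh).2⟩
  have hsub2 : ∀ e' ∈ L₂, ∀ h, e'.Covers h → e.Covers h := fun e' he' h hh =>
    ⟨(hiff h).2 (Or.inr ((hc2 e' he' h).1 hh).1),
      fun heq => hnot2 (heq ▸ ((hc2 e' he' h).1 hh).1)⟩
  have hkey : ∀ e' : Candidate n, e'.Good N → (∀ h, e'.Covers h → e.Covers h) →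
      N.totalCost e.second ≤ e'.key := by
    intro e' hg hs
    rw [hg.key_eq, ← he.key_eq]
    exact he.key_le (hs _ hg.covers_second)
  refine ⟨⟨good2, ?_, ?_, ?_⟩, ?_, ?_, by omega⟩
  · intro e' he'
    rcases (hmem e').1 he' with h | h | h
    · exact (g2 e' h).1
    · exact (g1 e' h).1
    · exact hcand' e' h
  · intro e' he'
    rcases (hmem e').1 he' with h | h | h
    · exact hkey e' (g2 e' h).1 (hsub2 e' h)
    · exact hkey e' (g1 e' h).1 (hsub1 e' h)
    · exact hkey' e' h
  · refine (hall.pairwise_iff (R := fun e e' : Candidate n => ∀ h, e.Covers h → ¬e'.Covers h)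
      (fun {a b} hab h hb ha => hab h ha hb)).2 ?_
    refine List.pairwise_append.2 ⟨pairwise_of_length_le_one l2, List.pairwise_append.2
      ⟨pairwise_of_length_le_one l1, hdis.2, fun a ha b hb h hah => ?_⟩, fun a ha b hb h hah => ?_⟩
    · exact hdis.1 b hb h (hsub1 a ha h hah)
    · rcases List.mem_append.1 hb with hb | hb
      · exact fun hbh => hexcl h ((hc1 b hb h).1 hbh).1 ((hc2 a ha h).1 hah).1
      · exact hdis.1 b hb h (hsub2 a ha h hah)
  · intro h
    constructor
    · rintro ⟨e', he', hh⟩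
      rcases List.mem_cons.1 (hperm.mem_iff.1 he') with rfl | he'
      · by_cases heq : h = e'.second
        · exact Or.inl heq
        · refine Or.inr ?_
          rcases (hiff h).1 hh.1 with h1 | h2
          · obtain ⟨e'', m, c⟩ := r1 h h1 hh.2
            exact ⟨e'', (hmem e'').2 (Or.inr (Or.inl m)), c⟩
          · obtain ⟨e'', m, c⟩ := r2 h h2 heq
            exact ⟨e'', (hmem e'').2 (Or.inl m), c⟩
      · exact Or.inr ⟨e', (hmem e').2 (Or.inr (Or.inr he')), hh⟩
    · rintro (rfl | ⟨e', he', hh⟩)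
      · exact ⟨e, hperm.mem_iff.2 (by simp), he.covers_second⟩
      · rcases (hmem e').1 he' with m | m | m
        · exact ⟨e, hperm.mem_iff.2 (by simp), hsub2 e' m h hh⟩
        · exact ⟨e, hperm.mem_iff.2 (by simp), hsub1 e' m h hh⟩
        · exact ⟨e', hperm.mem_iff.2 (by simp [m]), hh⟩
  · rintro ⟨e', he', hh⟩
    rcases (hmem e').1 he' with m | m | m
    · exact ((hc2 e' m _).1 hh).2 rfl
    · exact hnot1 ((hc1 e' m _).1 hh).1
    · exact hdis.1 e' m _ he.covers_second hh

lemma Queue.Inv.finite_remaining {κ : ℝ} {B : Queue n} (hB : B.Inv N κ) :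
    {h | B.Remaining h}.Finite :=
  (finite_isFeasible N).subset fun h ⟨e, he, hh⟩ => (hB.cand e he).sub h hh.1

lemma enumerate_spec (hn : 0 < n) (k : ℕ) : ∀ {κ : ℝ} {B : Queue n}, B.Inv N κ →
    (enumerate k B).val.Nodup ∧ (∀ g ∈ (enumerate k B).val, B.Remaining g) ∧
    (enumerate k B).val.Pairwise (fun f g => N.totalCost f ≤ N.totalCost g) ∧
    (∀ g, B.Remaining g → g ∉ (enumerate k B).val →
      ∀ f ∈ (enumerate k B).val, N.totalCost f ≤ N.totalCost g) ∧
    (enumerate k B).val.length = min k {h | B.Remaining h}.ncard ∧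
    (enumerate k B).time ≤ k * (400 * n ^ 3) := by
  induction k with
  | zero => intro κ B _; simp [enumerate]
  | succ k ih =>
    intro κ B hB
    have hn1 : n ≤ n ^ 3 := Nat.le_self_pow (by norm_num) n
    have hn2 : n * n ≤ n ^ 3 := by
      rw [← pow_two]; exact Nat.pow_le_pow_right hn (by norm_num)
    have hcopy : ∀ g : Flow n, (copy g).time ≤ 3 * n ^ 3 := fun g => by
      have h1 : (copy g).time ≤ n * (n * 2 + 1) := time_fill₂_le fun _ _ => le_rfl
      have h2 : n * (n * 2 + 1) = 2 * (n * n) + n := by ring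
      omega
    have htx := (Queue.extractMin_spec hB.good).2.2
    simp only [enumerate, val_bind, time_bind]
    rcases hx : B.extractMin.val with _ | ⟨e, B'⟩
    · have hnil := (Queue.extractMin_spec hB.good).1 hx
      have hrem : {h | B.Remaining h} = ∅ := by
        ext h
        simp [Queue.Remaining, hnil]
      rw [hrem]
      simp only [val_pure, time_pure]
      refine ⟨by simp, by simp, by simp, by simp, by simp, ?_⟩
      have hk := Nat.mul_le_mul_right (400 * n ^ 3) (Nat.le_add_left 1 k)
      omega
    obtain ⟨hperm, hmin, -⟩ := (Queue.extractMin_spec hB.good).2.1 e B' hx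
    have he : e.Good N := hB.cand e (hperm.mem_iff.2 (by simp))
    have hrem : B.Remaining e.second := ⟨e, hperm.mem_iff.2 (by simp), he.covers_second⟩
    have hle : ∀ g, B.Remaining g → N.totalCost e.second ≤ N.totalCost g := by
      rintro g ⟨e', he', hg⟩
      have h1 := hB.good.minKey_le he'
      rw [← hmin, he.key_eq] at h1
      exact (WithTop.coe_le_coe.1 h1).trans ((hB.cand e' he').key_le hg)
    by_cases hk : k = 0
    · subst hk
      simp only [val_bind, val_copy, val_step, decide_true, if_true, val_pure, time_bind, time_step,
        time_pure]
      refine ⟨by simp, by simpa using hrem, by simp, fun g hg _ f hf => ?_, ?_, ?_⟩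
      · rw [List.mem_singleton.1 hf]; exact hle g hg
      · have hpos : 0 < {h | B.Remaining h}.ncard :=
          (Set.ncard_pos hB.finite_remaining).2 ⟨_, hrem⟩
        rw [List.length_singleton]
        omega
      · have := hcopy e.second
        omega
    · obtain ⟨N₁, N₂, hp⟩ : ∃ N₁ N₂, (partition e.net e.first e.second).val = (N₁, N₂) :=
        ⟨_, _, rfl⟩
      have htp := time_partition_le (N := e.net) e.first e.second
      have hcp := hcopy e.second
      obtain ⟨hInv, hiff, hnot, htime⟩ := enumerate_step hn hB hx hp rfl rfl
      simp only [val_bind, val_copy, val_step, hk, decide_false, Bool.false_eq_true, if_false,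
        time_bind, time_step, hp]
      set B₂ := (insertSecondBest N₂ e.second e.second
        (insertSecondBest N₁ e.first e.second B').val).val
      obtain ⟨i1, i2, i3, i4, i5, i6⟩ := ih hInv
      refine ⟨List.nodup_cons.2 ⟨fun hmem => hnot (i2 _ hmem), i1⟩, ?_, ?_, ?_, ?_, ?_⟩
      · intro g hg
        rcases List.mem_cons.1 hg with rfl | hg
        · exact hrem
        · exact (hiff g).2 (Or.inr (i2 g hg))
      · exact List.pairwise_cons.2 ⟨fun g hg => hle g ((hiff g).2 (Or.inr (i2 g hg))), i3⟩
      · intro g hg hgL f hf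
        rw [List.mem_cons, not_or] at hgL
        rcases List.mem_cons.1 hf with rfl | hf
        · exact hle g hg
        · exact i4 g (((hiff g).1 hg).resolve_left hgL.1) hgL.2 f hf
      · have hset : {h | B.Remaining h} = insert e.second {h | B₂.Remaining h} := by
          ext h
          exact hiff h
        have hnot' : e.second ∉ {h | B₂.Remaining h} := hnot
        rw [hset, Set.ncard_insert_of_notMem hnot' hInv.finite_remaining, List.length_cons, i5]
        omega
      · have h2 : n * (n * 2 + 1) = 2 * (n * n) + n := by ring
        have h3 : (k + 1) * (400 * n ^ 3) = k * (400 * n ^ 3) + 400 * n ^ 3 := by ring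
        have h4 : 1 ≤ n ^ 3 := Nat.pow_pos hn
        rw [h2] at htp
        omega

lemma findKBestFlows_spec (hn : 0 < n) (hN : N.Valid) {f : Flow n} (hf : N.IsOptimal f) {K : ℕ}
    (hK : 1 ≤ K) :
    (findKBestFlows N f K).time ≤ 400 * (K * n ^ 3) ∧
      N.IsKBest K (findKBestFlows N f K).val := by
  obtain ⟨k, rfl⟩ : ∃ k, K = k + 1 := ⟨K - 1, by omega⟩
  obtain ⟨⟨L, hperm, hlen, hgood, hcov⟩, hB, ht⟩ := insertSecondBest_spec hn (N := N) rfl rfl hN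
    (fun _ h => h) hf (old := f) (fun i j => by simp) rfl (B := .empty) trivial
  have hmem : ∀ e, e ∈ (insertSecondBest N f f .empty).val.all ↔ e ∈ L := fun e => by
    rw [hperm.mem_iff]; simp [Queue.all]
  have hinv : (insertSecondBest N f f .empty).val.Inv N (N.totalCost f) := by
    refine ⟨hB, fun e he => (hgood e ((hmem e).1 he)).1, fun e he => ?_, ?_⟩
    · have hg := (hgood e ((hmem e).1 he)).1
      rw [hg.key_eq]
      exact hf.2 _ (hg.sub _ hg.covers_second.1)
    · refine pairwise_of_length_le_one ?_
      rw [hperm.length_eq]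
      simpa [Queue.all] using hlen
  have hiff : ∀ h, (insertSecondBest N f f .empty).val.Remaining h ↔ N.IsFeasible h ∧ h ≠ f := by
    intro h
    constructor
    · rintro ⟨e, he, hh⟩
      obtain ⟨-, h1, h2⟩ := hgood e ((hmem e).1 he)
      rw [Candidate.Covers, h1, h2] at hh
      exact hh
    · rintro ⟨h1, h2⟩
      obtain ⟨e, he, hh⟩ := hcov h h1 h2
      exact ⟨e, (hmem e).2 he, hh⟩
  obtain ⟨e1, e2, e3, e4, e5, e6⟩ := enumerate_spec hn k hinv
  have hset : {h | N.IsFeasible h}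
      = insert f {h | (insertSecondBest N f f .empty).val.Remaining h} := by
    ext h
    simp only [Set.mem_ofPred_eq, Set.mem_insert_iff, hiff]
    constructor
    · intro hh
      by_cases heq : h = f
      · exact Or.inl heq
      · exact Or.inr ⟨hh, heq⟩
    · rintro (rfl | hh)
      · exact hf.1
      · exact hh.1
  have hnot : f ∉ {h | (insertSecondBest N f f .empty).val.Remaining h} := fun h =>
    ((hiff f).1 h).2 rfl
  have hfeas : ∀ g ∈ (enumerate k (insertSecondBest N f f .empty).val).val, N.IsFeasible g :=
    fun g hg => ((hiff g).1 (e2 g hg)).1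
  simp only [findKBestFlows, val_bind, time_bind, val_copy, Nat.add_sub_cancel, val_step, time_step]
  refine ⟨?_, ?_, ?_, ?_, ?_, ?_⟩
  · have h1 : (copy f).time ≤ n * (n * 2 + 1) := time_fill₂_le fun _ _ => le_rfl
    have h2 : n * (n * 2 + 1) = 2 * (n * n) + n := by ring
    have hn1 : n ≤ n ^ 3 := Nat.le_self_pow (by norm_num) n
    have hn2 : n * n ≤ n ^ 3 := by
      rw [← pow_two]; exact Nat.pow_le_pow_right hn (by norm_num)
    have h3 : 400 * ((k + 1) * n ^ 3) = k * (400 * n ^ 3) + 400 * n ^ 3 := by ring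
    omega
  · rw [hset, Set.ncard_insert_of_notMem hnot hinv.finite_remaining, List.length_cons, e5]
    omega
  · exact List.nodup_cons.2 ⟨fun h => hnot (e2 f h), e1⟩
  · intro g hg
    rcases List.mem_cons.1 hg with rfl | hg
    · exact hf.1
    · exact hfeas g hg
  · exact List.pairwise_cons.2 ⟨fun g hg => hf.2 g (hfeas g hg), e3⟩
  · intro g hg hgL h hh
    rw [List.mem_cons, not_or] at hgL
    rcases List.mem_cons.1 hh with rfl | hh
    · exact hf.2 g hg
    · exact e4 g ((hiff g).2 ⟨hg, hgL.1⟩) hgL.2 h hh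

end Enumerate

end KBestFlow

theorem mainTheorem2 :
    ∃ C : ℕ, ∀ (n : ℕ), 0 < n → ∀ (N : KBestFlow.Network n), N.Valid →
      ∀ (f : KBestFlow.Flow n), N.IsOptimal f →
        ((KBestFlow.findSecondBestFlow N f).time ≤ C * n ^ 3 ∧
          (∀ g, (KBestFlow.findSecondBestFlow N f).val = some g → N.IsSecondBest f g) ∧
          ((KBestFlow.findSecondBestFlow N f).val = none → ∀ g, N.IsFeasible g → g = f)) ∧
        ∀ (K : ℕ), 1 ≤ K →
          (KBestFlow.findKBestFlows N f K).time ≤ C * (K * n ^ 3) ∧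
          N.IsKBest K (KBestFlow.findKBestFlows N f K).val := by
  refine ⟨400, fun n hn N hN f hf => ⟨⟨?_, ?_, ?_⟩, fun K hK =>
    KBestFlow.findKBestFlows_spec hn hN hf hK⟩⟩
  · exact (KBestFlow.time_findSecondBestFlow_le hn hN hf).trans
      (Nat.mul_le_mul_right _ (by norm_num))
  · exact fun g hg => ((KBestFlow.findSecondBestFlow_spec hN hf).1 g hg).1
  · exact (KBestFlow.findSecondBestFlow_spec hN hf).2
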